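/- **Theorem.** Let $d,N\ge 1$ be integers. Let $\mathrm d\gamma(x)=\pi^{-d/2}e^{-|x|^2}\,\mathrm dx$ be the Gaussian measure on $\mathbf R^d$, let $L=\frac12\Delta-\langle x,\nabla\rangle$ be the Ornstein–Uhlenbeck operator on $L^2(\gamma)$ (taken in the weak sense, on its maximal domain), and let $\partial_{x_j}^*$ be the adjoint of $\partial_{x_j}$ in $L^2(\gamma)$, $1\le j\le d$. Let $$M_t(x,y)=\frac{1}{(1-e^{-2t})^{d/2}}\exp\Bigl(-\frac{|e^{-t}x-y|^2}{1-e^{-2t}}\Bigr)e^{|y|^2}$$ be the Mehler kernel. Then $L$ generates a strongly continuous semigroup $(e^{tL})_{t\ge0}$ on $L^2(\gamma)$ and, for all $t>0$ and $\alpha>1$, the operator $(t^2L)^Ne^{(t^2/\alpha)L}$ is defined on all of $L^2(\gamma)$ and there are continuous kernels $K_{t^2,N,\alpha}$ and $\tilde K_{t^2,N,\alpha,j}$ on $\mathbf R^d\times\mathbf R^d$, with $K_{t^2,N,\alpha}(\cdot,y)$ differentiable for every $y$, such that, for almost every $x$, $$\int_{\mathbf R^d}K_{t^2,N,\alpha}(x,y)u(y)\,\mathrm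 d\gamma(y)=(t^2L)^Ne^{\frac{t^2}{\alpha}L}u(x)\qquad(u\in L^2(\gamma)),$$ $$\int_{\mathbf R^d}\tilde K_{t^2,N,\alpha,j}(x,y)u(y)\,\mathrm d\gamma(y)=(t^2L)^Ne^{\frac{t^2}{\alpha}L}\,t\,\partial_{x_j}^*u(x)\qquad(u\in \mathrm{Dom}(\partial_{x_j}^*)),$$ the integrals being absolutely convergent. Let $T>0$. For $C>0$, $c>0$ and $\alpha>1$, consider the estimate: for all $0<t<T$, all $x,y\in\mathbf R^d$ with $t|x|\le C$, and all $1\le j\le d$, each of the three quantities $$|K_{t^2,N,\alpha}(x,y)|,\qquad |\tilde K_{t^2,N,\alpha,j}(x,y)|,\qquad |t\,\partial_{x_j}K_{t^2,N,\alpha}(x,y)|$$ is at most $$c\,\alpha\, e^{\alpha C^2/2}\,M_{t^2}(x,y)\,\exp\Bigl(-\frac{\alpha}{8e^{2T}}\,\frac{|e^{-t^2}x-y|^2}{1-e^{-2t^2}}\Bigr).\tag{$*$}$$ Then: 1. there is a constant $c>0$, depending only on $d,N,T$, such that for every $C>0$ the estimate $(*)$ holds for all sufficiently large $\alpha>1$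 (depending on $d,N,T,C$); 2. there is $\alpha_0>1$, depending only on $d,N,T$, such that for every $C>0$ there is a constant $c>0$, depending only on $d,N,T,C$, for which $(*)$ holds for all $\alpha\ge\alpha_0$. -/

import Mathlib

open MeasureTheory Filter Topology
open scoped ContDiff

noncomputable section

namespace OrnsteinUhlenbeck

/-- The Euclidean space `ℝ^d`. -/
abbrev E (d : ℕ) : Type := EuclideanSpace ℝ (Fin d)

/-- The Gaussian measure `dγ(x) = π^{-d/2} exp(-|x|²) dx` on `ℝ^d`. -/
def gaussianMeasure (d : ℕ) : Measure (E d) :=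
  volume.withDensity fun x =>
    ENNReal.ofReal (Real.pi ^ (-(d : ℝ) / 2) * Real.exp (-‖x‖ ^ 2))

/-- The Hilbert space `L²(ℝ^d, dγ)` (real valued). -/
abbrev L2 (d : ℕ) : Type := Lp ℝ 2 (gaussianMeasure d)

/-- Test functions: the space `C_c^∞(ℝ^d)`. -/
def IsTestFunction {d : ℕ} (φ : E d → ℝ) : Prop :=
  ContDiff ℝ ∞ φ ∧ HasCompactSupport φ

/-- The partial derivative `∂_j φ (x)`. -/
def partialDeriv {d : ℕ} (j : Fin d) (φ : E d → ℝ) (x : E d) : ℝ :=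
  fderiv ℝ φ x (EuclideanSpace.single j 1)

/-- The Ornstein-Uhlenbeck differential expression `½ Δφ(x) - ⟨x, ∇φ(x)⟩`. -/
def ouExpr {d : ℕ} (φ : E d → ℝ) (x : E d) : ℝ :=
  (1 / 2) * Laplacian.laplacian φ x - inner ℝ x (gradient φ x)

/-- The Ornstein-Uhlenbeck operator `L = ½ Δ - ⟨x, ∇⟩` on `L²(γ)`, as a graph: `ouOp f g` means
that `f` is in the domain of `L` and `L f = g`. The operator acts in the weak sense, on its maximal
domain: since the expression is symmetric in `L²(γ)` on test functions, `L f = g` means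
`∫ f (½ Δφ - ⟨x, ∇φ⟩) dγ = ∫ g φ dγ` for all test functions `φ`. -/
def ouOp {d : ℕ} (f g : L2 d) : Prop :=
  ∀ φ : E d → ℝ, IsTestFunction φ →
    ∫ x, f x * ouExpr φ x ∂(gaussianMeasure d) = ∫ x, g x * φ x ∂(gaussianMeasure d)

/-- The adjoint `∂_j^*` of `∂_j` in `L²(γ)`, as a graph: `partialAdj j f g` means that `f` is in the
domain of `∂_j^*` and `∂_j^* f = g`, that is, `∫ f ∂_jφ dγ = ∫ g φ dγ` for all test functions. -/
def partialAdj {d : ℕ} (j : Fin d) (f g : L2 d) : Prop :=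
  ∀ φ : E d → ℝ, IsTestFunction φ →
    ∫ x, f x * partialDeriv j φ x ∂(gaussianMeasure d) = ∫ x, g x * φ x ∂(gaussianMeasure d)

/-- `c A` for a scalar `c` and a (possibly unbounded) operator `A` given by its graph. -/
def opSMul {d : ℕ} (c : ℝ) (A : L2 d → L2 d → Prop) (f g : L2 d) : Prop :=
  ∃ h, A f h ∧ g = c • h

/-- `A^N` (with its natural domain) for an operator `A` given by its graph. -/
def opPow {d : ℕ} (A : L2 d → L2 d → Prop) : ℕ → L2 d → L2 d → Prop
  | 0, f, g => g = f
  | N + 1, f, g => ∃ h, opPow A N f h ∧ A h g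

/-- `S` is a strongly continuous semigroup of bounded operators on `L²(γ)` (only its values at
times `≥ 0` matter) whose generator, domain included, is the operator `A` given by its graph;
in other words `S s = exp (s A)` for `s ≥ 0`. -/
structure IsSemigroupGeneratedBy {d : ℕ} (A : L2 d → L2 d → Prop)
    (S : ℝ → L2 d →L[ℝ] L2 d) : Prop where
  zero : S 0 = ContinuousLinearMap.id ℝ (L2 d)
  add : ∀ s r : ℝ, 0 ≤ s → 0 ≤ r → S (s + r) = (S s).comp (S r)
  continuousOn : ∀ f : L2 d, ContinuousOn (fun s => S s f) (Set.Ici 0)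
  generator : ∀ f g : L2 d,
    A f g ↔ Tendsto (fun h : ℝ => h⁻¹ • (S h f - f)) (𝓝[>] 0) (𝓝 g)

/-- The operator `(t² L)^N e^{(t²/α) L}`, where `S s = e^{sL}`, as a graph. -/
def opK {d : ℕ} (S : ℝ → L2 d →L[ℝ] L2 d) (N : ℕ) (t α : ℝ) (u v : L2 d) : Prop :=
  opPow (opSMul (t ^ 2) ouOp) N (S (t ^ 2 / α) u) v

/-- The operator `(t² L)^N e^{(t²/α) L} t ∂_j^*`, where `S s = e^{sL}`, as a graph. -/
def opKtilde {d : ℕ} (S : ℝ → L2 d →L[ℝ] L2 d) (N : ℕ) (t α : ℝ) (j : Fin d)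
    (u v : L2 d) : Prop :=
  ∃ w, opSMul t (partialAdj j) u w ∧ opK S N t α w v

/-- `k` is an integral kernel, with respect to `γ`, of the operator `A` given by its graph: for all
`u` in the domain of `A` one has `∫ k(x,y) u(y) dγ(y) = (A u)(x)` for almost every `x`. -/
def IsIntegralKernel {d : ℕ} (A : L2 d → L2 d → Prop) (k : E d → E d → ℝ) : Prop :=
  ∀ u v : L2 d, A u v → ∀ᵐ x ∂(gaussianMeasure d),
    Integrable (fun y => k x y * u y) (gaussianMeasure d) ∧
      ∫ y, k x y * u y ∂(gaussianMeasure d) = v x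

/-- The Mehler kernel
`M_t(x,y) = (1 - e^{-2t})^{-d/2} exp(-|e^{-t}x - y|² / (1 - e^{-2t})) e^{|y|²}`. -/
def mehler {d : ℕ} (t : ℝ) (x y : E d) : ℝ :=
  Real.exp (-(‖Real.exp (-t) • x - y‖ ^ 2 / (1 - Real.exp (-2 * t)))) /
      (1 - Real.exp (-2 * t)) ^ ((d : ℝ) / 2) * Real.exp (‖y‖ ^ 2)

/-- The family of kernels `k t` satisfies, for all `0 < t < T` and `t |x| ≤ C`,
`|k_t(x,y)| ≤ c α e^{αC²/2} M_{t²}(x,y) exp(-(α/(8e^{2T})) |e^{-t²}x - y|² / (1 - e^{-2t²}))`. -/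
def KernelBound {d : ℕ} (T C α c : ℝ) (k : ℝ → E d → E d → ℝ) : Prop :=
  ∀ t : ℝ, 0 < t → t < T → ∀ x y : E d, t * ‖x‖ ≤ C →
    |k t x y| ≤ c * (α * Real.exp (α / 2 * C ^ 2) * mehler (t ^ 2) x y *
      Real.exp (-(α / (8 * Real.exp (2 * T)) *
        (‖Real.exp (-t ^ 2) • x - y‖ ^ 2 / (1 - Real.exp (-2 * t ^ 2))))))

end OrnsteinUhlenbeck

end

/-! Every derivative of the Mehler kernel is the kernel times a polynomial in `e^{-s}`, `x_i`, `q_i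
= (y_i - e^{-s}x_i)/(1 - e^{-2s})` and `p = 1/(1 - e^{-2s})`. With parabolic degrees 0, 1, 1, 2, a
time derivative raises the degree by 2 and a space derivative by 1 (`IsPoly`). With `s = t²/α`, the
kernel of `(t²L)^N e^{sL}` is `t^{2N} ∂_s^N M_s`. Moving `∂_j^*` onto the kernel gives `t ∂_{y_j}K`
as the kernel of the second operator. So all three quantities have the form `t^k F M_s` with `F` of
degree `k`, where `k` is `2N` or `2N + 1`.

For the estimate, write `W = |e^{-s}x - y|²/(1 - e^{-2s})` for the Gaussian exponent of `M_s`. Since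
`t|x| ≤ C` and `t²p` is at most a constant times `α`, each unit of degree, paired with one factor
`t`, costs at most a constant times `(1 + C) α (1 + √W)` (`IsPoly.exists_pow_mul_abs_le`). The
powers of `√W` are absorbed by `e^{W/10}`. The remaining `e^{-9W/10}` is compared with the Gaussian
at time `t²` (`exponent_le`): the variance at time `t²/α` is smaller by a factor of order `α`, which
produces the extra decay. The centres `e^{-s}x` and `e^{-t²}x` differ by at most `e^{-s} t C`, which
costs only `e^{3αC²/20}`. As `3/20 < 1/2`, the spare factor `e^{7αC²/20}` pays for all powers of `α`
and `1 + C`: for free once `α` is large depending on `C`, or for every `α ≥ 10e^{2T}` at the price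
of a constant depending on `C`.

For the operators, the Mehler kernel maps `cos(⟨ξ,x⟩ + θ)` to an explicit multiple of a function of
the same kind, and these functions span a dense subspace of `L²(γ)`. This yields the semigroup law
and strong continuity. The generator is identified with the maximal weak operator
(`ouOp_iff_ouGenerator`): weak identities extend from test functions to trigonometric functions by
cutoffs, weak derivatives on the invariant trigonometric span upgrade to strong ones
(`ouGenerator_of_weak`), and symmetry gives the converse. Differentiating `⟨e^{sL}u, v⟩` repeatedly
in `s` then identifies the powers of `L` on the semigroup with the kernels `∂_s^n M_s`
(`ouOp_mehlerDeriv_apply`). -/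

noncomputable section

namespace OrnsteinUhlenbeck

variable {d : ℕ}

/-! ### The Gaussian measure and its Hilbert space -/

/-- The density `π^{-d/2} exp(-|x|²)` of the Gaussian measure. -/
def gaussianDensity (x : E d) : ℝ := Real.pi ^ (-(d : ℝ) / 2) * Real.exp (-‖x‖ ^ 2)

theorem gaussianDensity_pos (x : E d) : 0 < gaussianDensity x :=
  mul_pos (Real.rpow_pos_of_pos Real.pi_pos _) (Real.exp_pos _)

theorem continuous_gaussianDensity : Continuous (gaussianDensity : E d → ℝ) := by
  unfold gaussianDensity; fun_prop

theorem gaussianMeasure_eq :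
    gaussianMeasure d = volume.withDensity fun x => ENNReal.ofReal (gaussianDensity x) := rfl

theorem integral_gaussianMeasure (f : E d → ℝ) :
    ∫ x, f x ∂(gaussianMeasure d) = ∫ x, gaussianDensity x * f x := by
  rw [gaussianMeasure_eq, integral_withDensity_eq_integral_toReal_smul
    (continuous_gaussianDensity.measurable.ennreal_ofReal) (by simp)]
  congr 1; ext x
  rw [ENNReal.toReal_ofReal (gaussianDensity_pos x).le]; rfl

theorem integrable_gaussianMeasure_iff {f : E d → ℝ} :
    Integrable f (gaussianMeasure d) ↔ Integrable (fun x => gaussianDensity x * f x) := by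
  rw [gaussianMeasure_eq, integrable_withDensity_iff_integrable_smul'
    (continuous_gaussianDensity.measurable.ennreal_ofReal) (by simp)]
  congr! 2 with x
  rw [ENNReal.toReal_ofReal (gaussianDensity_pos x).le]; rfl

theorem integrable_exp_neg_mul_sq {b : ℝ} (hb : 0 < b) :
    Integrable (fun x : E d => Real.exp (-b * ‖x‖ ^ 2)) := by
  have h := (GaussianFourier.integrable_cexp_neg_mul_sq_norm_add (V := E d) (b := (b : ℂ))
    (by simpa using hb) 0 0).re
  refine h.congr (ae_of_all _ fun x => ?_)
  have : (-(b : ℂ) * (‖x‖ : ℂ) ^ 2 + 0 * ((inner ℝ (0 : E d) x : ℝ) : ℂ))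
      = ((-b * ‖x‖ ^ 2 : ℝ) : ℂ) := by push_cast; ring
  simp only [this, ← Complex.ofReal_exp]; rfl

instance isProbabilityMeasure_gaussianMeasure : IsProbabilityMeasure (gaussianMeasure d) := by
  constructor
  have h1 : Integrable (gaussianDensity : E d → ℝ) := by
    refine ((integrable_exp_neg_mul_sq (d := d) one_pos).const_mul
      (Real.pi ^ (-(d : ℝ) / 2))).congr (ae_of_all _ fun x => ?_)
    simp [gaussianDensity]
  have h2 : ∫ x : E d, gaussianDensity x = 1 := by
    have h := GaussianFourier.integral_rexp_neg_mul_sq_norm (V := E d) one_pos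
    simp only [gaussianDensity, integral_const_mul]
    have e : (fun x : E d => Real.exp (-‖x‖ ^ 2)) = fun x => Real.exp (-1 * ‖x‖ ^ 2) := by
      ext x; simp
    rw [e, h, div_one, finrank_euclideanSpace_fin, ← Real.rpow_add Real.pi_pos]
    simp [neg_div]
  rw [gaussianMeasure, withDensity_apply _ MeasurableSet.univ, Measure.restrict_univ]
  change ∫⁻ x : E d, ENNReal.ofReal (gaussianDensity x) = 1
  rw [← ofReal_integral_eq_lintegral_ofReal h1 (ae_of_all _ fun x => (gaussianDensity_pos x).le),
    h2, ENNReal.ofReal_one]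

/-- The function `exp((1/2 - δ)|x|²)`, square integrable with respect to `γ` if `δ > 0`. -/
def weight (δ : ℝ) (x : E d) : ℝ := Real.exp ((1 / 2 - δ) * ‖x‖ ^ 2)

theorem weight_pos (δ : ℝ) (x : E d) : 0 < weight δ x := Real.exp_pos _

theorem continuous_weight (δ : ℝ) : Continuous (weight δ : E d → ℝ) := by
  unfold weight; fun_prop

theorem memLp_weight {δ : ℝ} (hδ : 0 < δ) :
    MemLp (weight δ : E d → ℝ) 2 (gaussianMeasure d) := by
  rw [memLp_two_iff_integrable_sq (continuous_weight δ).aestronglyMeasurable,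
    integrable_gaussianMeasure_iff]
  refine ((integrable_exp_neg_mul_sq (d := d) (b := 2 * δ) (by positivity)).const_mul
    (Real.pi ^ (-(d : ℝ) / 2))).congr (ae_of_all _ fun x => ?_)
  simp only [gaussianDensity, weight, ← Real.exp_nat_mul, mul_assoc, ← Real.exp_add]
  congr 2; push_cast; ring

theorem exp_mul_sq_mul_weight (a b : ℝ) (x : E d) :
    Real.exp (a * ‖x‖ ^ 2) * weight b x = weight (b - a) x := by
  rw [weight, weight, ← Real.exp_add]; congr 1; ring

theorem inner_eq_integral (f g : L2 d) :
    inner ℝ f g = ∫ x, f x * g x ∂(gaussianMeasure d) := by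
  rw [L2.inner_def]; congr 1; ext x; simp [mul_comm]

theorem integrable_L2_mul (f : L2 d) {φ : E d → ℝ} (hφ : MemLp φ 2 (gaussianMeasure d)) :
    Integrable (fun x => f x * φ x) (gaussianMeasure d) :=
  (Lp.memLp f).integrable_mul hφ

theorem inner_toLp (f : L2 d) {φ : E d → ℝ} (hφ : MemLp φ 2 (gaussianMeasure d)) :
    inner ℝ f (hφ.toLp φ) = ∫ x, f x * φ x ∂(gaussianMeasure d) := by
  rw [inner_eq_integral]
  refine integral_congr_ae ?_
  filter_upwards [hφ.coeFn_toLp] with x hx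
  rw [hx]

/-- Functions on `ℝ^d` with a bound `c exp(ε |x|²)`, `ε < 1/2`, are in `L²(γ)`. -/
theorem memLp_of_le_weight {φ : E d → ℝ} (h : Continuous φ) {c δ : ℝ} (hδ : 0 < δ)
    (hb : ∀ x, |φ x| ≤ c * weight δ x) : MemLp φ 2 (gaussianMeasure d) :=
  ((memLp_weight hδ).const_mul c).mono' h.aestronglyMeasurable (ae_of_all _ hb)

theorem memLp_of_bounded {φ : E d → ℝ} (h : Continuous φ) {c : ℝ} (hb : ∀ x, |φ x| ≤ c) :
    MemLp φ 2 (gaussianMeasure d) :=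
  MemLp.of_bound h.aestronglyMeasurable c (ae_of_all _ hb)

theorem memLp_norm : MemLp (fun x : E d => ‖x‖) 2 (gaussianMeasure d) := by
  refine memLp_of_le_weight continuous_norm (c := 2) (δ := 1 / 4) (by norm_num) fun x => ?_
  have h := Real.add_one_le_exp ((1 / 2 - 1 / 4) * ‖x‖ ^ 2)
  rw [abs_of_nonneg (norm_nonneg x), weight]
  nlinarith [sq_nonneg (‖x‖ - 1)]

theorem memLp_const_add_norm (a b : ℝ) :
    MemLp (fun x : E d => a + b * ‖x‖) 2 (gaussianMeasure d) :=
  (memLp_const a).add (memLp_norm.const_mul b)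

theorem dense_span_of_separating {D : Set (L2 d)}
    (hD : ∀ h : L2 d, (∀ e ∈ D, inner ℝ h e = 0) → h = 0) :
    Dense (Submodule.span ℝ D : Set (L2 d)) := by
  rw [Submodule.dense_iff_topologicalClosure_eq_top, Submodule.topologicalClosure_eq_top_iff,
    Submodule.eq_bot_iff]
  intro h hh
  refine hD h fun e he => ?_
  rw [real_inner_comm]
  exact (Submodule.mem_orthogonal _ _).1 hh e (Submodule.subset_span he)

/-! ### Integral operators with dominated kernels -/

/-- A continuous kernel `k` with `|k(x,y)| ≤ c exp((1/2-δ)|x|²) exp((1/2-δ)|y|²)`, `δ > 0`. -/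
structure Dominated (k : E d → E d → ℝ) : Prop where
  cont : Continuous fun p : E d × E d => k p.1 p.2
  bound : ∃ c δ : ℝ, 0 < δ ∧ ∀ x y, |k x y| ≤ c * (weight δ x * weight δ y)

namespace Dominated
variable {k : E d → E d → ℝ}

theorem swap (hk : Dominated k) : Dominated fun x y => k y x := by
  obtain ⟨c, δ, hδ, hb⟩ := hk.bound
  exact ⟨hk.cont.comp continuous_swap, c, δ, hδ, fun x y => by
    rw [mul_comm (weight δ x)]; exact hb y x⟩

theorem memLp_right (hk : Dominated k) (x : E d) : MemLp (k x) 2 (gaussianMeasure d) := by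
  obtain ⟨c, δ, hδ, hb⟩ := hk.bound
  exact memLp_of_le_weight (hk.cont.comp (by fun_prop : Continuous fun y => (x, y))) hδ
    (c := c * weight δ x) fun y => (hb x y).trans_eq (by ring)

theorem integrable (hk : Dominated k) (u : L2 d) (x : E d) :
    Integrable (fun y => k x y * u y) (gaussianMeasure d) :=
  (hk.memLp_right x).integrable_mul (Lp.memLp u)

/-- Cauchy–Schwarz in `y` against the square integrable weight. The remaining weight in `x` is again
in `L²(γ)`, so a pointwise bound is enough for boundedness on `L²(γ)`. -/
theorem exists_abs_integral_le (hk : Dominated k) : ∃ c δ : ℝ, 0 < δ ∧ 0 ≤ c ∧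
    ∀ (u : L2 d) (x : E d), |∫ y, k x y * u y ∂(gaussianMeasure d)| ≤ c * ‖u‖ * weight δ x := by
  obtain ⟨c, δ, hδ, hb⟩ := hk.bound
  set w : L2 d := (memLp_weight hδ).toLp _
  have hc : 0 ≤ c := by
    have := (abs_nonneg _).trans (hb 0 0)
    exact nonneg_of_mul_nonneg_left this (mul_pos (weight_pos _ _) (weight_pos _ _))
  refine ⟨c * ‖w‖, δ, hδ, by positivity, fun u x => ?_⟩
  have h1 : ‖∫ y, k x y * u y ∂(gaussianMeasure d)‖ ≤
      ∫ y, c * weight δ x * (|u y| * weight δ y) ∂(gaussianMeasure d) := by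
    refine norm_integral_le_of_norm_le
      ((((Lp.memLp u).abs).integrable_mul (memLp_weight hδ)).const_mul _) (ae_of_all _ fun y => ?_)
    rw [Real.norm_eq_abs, abs_mul]
    calc |k x y| * |u y| ≤ c * (weight δ x * weight δ y) * |u y| :=
          mul_le_mul_of_nonneg_right (hb x y) (abs_nonneg _)
      _ = _ := by ring
  rw [integral_const_mul] at h1
  have h2 : ∫ y, |u y| * weight δ y ∂(gaussianMeasure d) ≤ ‖u‖ * ‖w‖ := by
    have h3 : inner ℝ |u| w = ∫ y, |u y| * weight δ y ∂(gaussianMeasure d) := by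
      rw [inner_toLp]
      refine integral_congr_ae ?_
      filter_upwards [Lp.coeFn_abs u] with y hy
      rw [hy]
    rw [← h3]
    exact (real_inner_le_norm _ _).trans_eq (by rw [norm_abs_eq_norm])
  have h4 : 0 ≤ c * weight δ x := mul_nonneg hc (weight_pos _ _).le
  calc _ ≤ _ := h1
    _ ≤ c * weight δ x * (‖u‖ * ‖w‖) := mul_le_mul_of_nonneg_left h2 h4
    _ = _ := by ring

theorem aestronglyMeasurable_prod (hk : Dominated k) (u : L2 d) :
    AEStronglyMeasurable (fun p : E d × E d => k p.1 p.2 * u p.2)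
      ((gaussianMeasure d).prod (gaussianMeasure d)) :=
  hk.cont.aestronglyMeasurable.mul (Lp.aestronglyMeasurable u).comp_snd

theorem memLp_integral (hk : Dominated k) (u : L2 d) :
    MemLp (fun x => ∫ y, k x y * u y ∂(gaussianMeasure d)) 2 (gaussianMeasure d) := by
  obtain ⟨c, δ, hδ, -, hb⟩ := hk.exists_abs_integral_le
  exact ((memLp_weight hδ).const_mul (c * ‖u‖)).mono'
    (hk.aestronglyMeasurable_prod u).integral_prod_right' (ae_of_all _ fun x => hb u x)

/-- The function `x ↦ ∫ k(x,y) u(y) dγ(y)` as an element of `L²(γ)`. -/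
def apply (hk : Dominated k) (u : L2 d) : L2 d := (hk.memLp_integral u).toLp _

theorem coeFn_apply (hk : Dominated k) (u : L2 d) :
    hk.apply u =ᵐ[gaussianMeasure d] fun x => ∫ y, k x y * u y ∂(gaussianMeasure d) :=
  MemLp.coeFn_toLp _

theorem exists_norm_apply_le (hk : Dominated k) : ∃ c : ℝ, ∀ u : L2 d, ‖hk.apply u‖ ≤ c * ‖u‖ := by
  obtain ⟨c, δ, hδ, hc, hb⟩ := hk.exists_abs_integral_le
  set w : L2 d := (memLp_weight hδ).toLp _ with hw
  refine ⟨c * ‖w‖, fun u => ?_⟩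
  have : ‖hk.apply u‖ ≤ c * ‖u‖ * ‖w‖ := by
    refine Lp.norm_le_mul_norm_of_ae_le_mul ?_
    filter_upwards [hk.coeFn_apply u, (memLp_weight (d := d) hδ).coeFn_toLp] with x hx hx'
    rw [hx, hw, hx', Real.norm_eq_abs, Real.norm_eq_abs, abs_of_pos (weight_pos δ x)]
    exact hb u x
  linarith [mul_right_comm c ‖u‖ ‖w‖]

theorem apply_add (hk : Dominated k) (u v : L2 d) : hk.apply (u + v) = hk.apply u + hk.apply v := by
  apply Lp.ext
  filter_upwards [hk.coeFn_apply (u + v), hk.coeFn_apply u, hk.coeFn_apply v,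
    Lp.coeFn_add (hk.apply u) (hk.apply v)] with x h1 h2 h3 h4
  rw [h1, h4, Pi.add_apply, h2, h3, ← integral_add (hk.integrable u x) (hk.integrable v x)]
  refine integral_congr_ae ?_
  filter_upwards [Lp.coeFn_add u v] with y hy
  rw [hy, Pi.add_apply, mul_add]

theorem apply_smul (hk : Dominated k) (a : ℝ) (u : L2 d) : hk.apply (a • u) = a • hk.apply u := by
  apply Lp.ext
  filter_upwards [hk.coeFn_apply (a • u), hk.coeFn_apply u, Lp.coeFn_smul a (hk.apply u)]
    with x h1 h2 h3
  rw [h1, h3, Pi.smul_apply, h2, smul_eq_mul, ← integral_const_mul]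
  refine integral_congr_ae ?_
  filter_upwards [Lp.coeFn_smul a u] with y hy
  rw [hy, Pi.smul_apply, smul_eq_mul]; ring

/-- The bounded operator on `L²(γ)` with kernel `k`. -/
def op (hk : Dominated k) : L2 d →L[ℝ] L2 d :=
  LinearMap.mkContinuous ⟨⟨hk.apply, hk.apply_add⟩, hk.apply_smul⟩ hk.exists_norm_apply_le.choose
    hk.exists_norm_apply_le.choose_spec

theorem op_apply (hk : Dominated k) (u : L2 d) : hk.op u = hk.apply u := rfl

theorem integrable_prod (hk : Dominated k) (u v : L2 d) :
    Integrable (fun p : E d × E d => k p.1 p.2 * (v p.1 * u p.2))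
      ((gaussianMeasure d).prod (gaussianMeasure d)) := by
  obtain ⟨c, δ, hδ, hb⟩ := hk.bound
  have h := ((((Lp.memLp v).abs.integrable_mul (memLp_weight hδ)).mul_prod
    ((Lp.memLp u).abs.integrable_mul (memLp_weight hδ))).const_mul c)
  refine h.mono' (hk.cont.aestronglyMeasurable.mul
    ((Lp.aestronglyMeasurable v).comp_fst.mul (Lp.aestronglyMeasurable u).comp_snd))
    (ae_of_all _ fun p => ?_)
  simp only [Pi.mul_apply, Pi.abs_apply, Real.norm_eq_abs, abs_mul]
  calc |k p.1 p.2| * (|v p.1| * |u p.2|)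
      ≤ c * (weight δ p.1 * weight δ p.2) * (|v p.1| * |u p.2|) :=
        mul_le_mul_of_nonneg_right (hb _ _) (by positivity)
    _ = _ := by ring

theorem inner_apply (hk : Dominated k) (u v : L2 d) :
    inner ℝ (hk.apply u) v =
      ∫ p, k p.1 p.2 * (v p.1 * u p.2) ∂((gaussianMeasure d).prod (gaussianMeasure d)) := by
  rw [inner_eq_integral, integral_prod _ (hk.integrable_prod u v)]
  refine integral_congr_ae ?_
  filter_upwards [hk.coeFn_apply u] with x hx
  rw [hx, ← integral_mul_const]
  congr 1; ext y; ring

theorem inner_apply_swap (hk : Dominated k) (u v : L2 d) :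
    inner ℝ (hk.apply u) v = inner ℝ u (hk.swap.apply v) := by
  rw [real_inner_comm _ u, inner_apply, inner_apply, ← integral_prod_swap]
  congr 1; ext p; simp only [Prod.fst_swap, Prod.snd_swap]; ring

end Dominated

/-! ### Derivatives of the Mehler kernel -/

theorem exp_neg_two_mul (s : ℝ) : Real.exp (-2 * s) = Real.exp (-s) ^ 2 := by
  rw [← Real.exp_nat_mul]; congr 1; push_cast; ring

theorem one_sub_exp_pos {s : ℝ} (hs : 0 < s) : 0 < 1 - Real.exp (-2 * s) := by
  have : Real.exp (-2 * s) < 1 := by simpa using hs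
  linarith

/-- The algebra of coefficients generated by `e^{-s}`, `x_i`, `(y_i - e^{-s}x_i)/(1 - e^{-2s})` and
`1/(1 - e^{-2s})`, filtered by giving these generators the degrees `0`, `1`, `1` and `2`. -/
inductive IsPoly : ℕ → (ℝ → E d → E d → ℝ) → Prop
  | const (c : ℝ) : IsPoly 0 fun _ _ _ => c
  | r : IsPoly 0 fun s _ _ => Real.exp (-s)
  | x (i : Fin d) : IsPoly 1 fun _ x _ => x i
  | q (i : Fin d) : IsPoly 1 fun s x y => (y i - Real.exp (-s) * x i) / (1 - Real.exp (-2 * s))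
  | p : IsPoly 2 fun s _ _ => (1 - Real.exp (-2 * s))⁻¹
  | mono {k : ℕ} {F : ℝ → E d → E d → ℝ} (h : IsPoly k F) : IsPoly (k + 1) F
  | add {k : ℕ} {F G : ℝ → E d → E d → ℝ} (hF : IsPoly k F) (hG : IsPoly k G) :
      IsPoly k fun s x y => F s x y + G s x y
  | mul {k l : ℕ} {F G : ℝ → E d → E d → ℝ} (hF : IsPoly k F) (hG : IsPoly l G) :
      IsPoly (k + l) fun s x y => F s x y * G s x y

namespace IsPoly

theorem mono_le {k l : ℕ} {F : ℝ → E d → E d → ℝ} (h : IsPoly k F) (hkl : k ≤ l) : IsPoly l F := by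
  induction l, hkl using Nat.le_induction with
  | base => exact h
  | succ n _ ih => exact ih.mono

theorem mul' {k l m : ℕ} {F G : ℝ → E d → E d → ℝ} (hF : IsPoly k F) (hG : IsPoly l G)
    (h : k + l ≤ m) : IsPoly m fun s x y => F s x y * G s x y :=
  (hF.mul hG).mono_le h

theorem zero (k : ℕ) : IsPoly k fun (_ : ℝ) (_ _ : E d) => (0 : ℝ) :=
  (const 0).mono_le (Nat.zero_le k)

theorem sum {k : ℕ} {ι : Type*} (t : Finset ι) {F : ι → ℝ → E d → E d → ℝ}
    (h : ∀ i, IsPoly k (F i)) : IsPoly k fun s x y => ∑ i ∈ t, F i s x y := by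
  classical
  induction t using Finset.induction_on with
  | empty => simpa using zero k
  | insert i t hi ih => simpa only [Finset.sum_insert hi] using (h i).add ih

theorem contDiff {k : ℕ} {F : ℝ → E d → E d → ℝ} (h : IsPoly k F) (s : ℝ) :
    ContDiff ℝ ∞ fun p : E d × E d => F s p.1 p.2 := by
  induction h with
  | const c => exact contDiff_const
  | r => exact contDiff_const
  | x i => fun_prop
  | q i => fun_prop
  | p => exact contDiff_const
  | mono _ ih => exact ih
  | add _ _ h1 h2 => exact h1.add h2
  | mul _ _ h1 h2 => exact h1.mul h2

theorem hasDerivAt_one_sub_exp (s : ℝ) :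
    HasDerivAt (fun s : ℝ => 1 - Real.exp (-2 * s)) (2 * Real.exp (-s) ^ 2) s := by
  have h := (((hasDerivAt_id s).const_mul (-2)).exp).const_sub 1
  refine h.congr_deriv ?_
  rw [← exp_neg_two_mul]; simp; ring

theorem hasDerivAt_exp_neg (s : ℝ) :
    HasDerivAt (fun s : ℝ => Real.exp (-s)) (-1 * Real.exp (-s)) s := by
  refine ((hasDerivAt_id s).neg.exp).congr_deriv ?_
  simp

/-- On generators, with `r = e^{-s}`: `r' = -r`, `q' = r x p - 2r² q p` and `p' = -2r² p²`. Each
derivative has degree at most 2 more than its generator, and the Leibniz rule preserves this. -/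
theorem exists_deriv_time {k : ℕ} {F : ℝ → E d → E d → ℝ} (h : IsPoly k F) :
    ∃ G, IsPoly (k + 2) G ∧ ∀ s, 0 < s → ∀ x y, HasDerivAt (fun s => F s x y) (G s x y) s := by
  induction h with
  | const c => exact ⟨_, zero _, fun s _ x y => hasDerivAt_const s c⟩
  | r => exact ⟨_, ((const (-1)).mul r).mono_le (by lia), fun s _ x y => hasDerivAt_exp_neg s⟩
  | x i => exact ⟨_, zero _, fun s _ x y => hasDerivAt_const s _⟩
  | q i =>
    refine ⟨_, ((r.mul (x i)).mul p).mono_le (l := 3) (by lia) |>.add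
      (((const (-2)).mul (r.mul r)).mul ((q i).mul p)), fun s hs x y => ?_⟩
    have h := (((hasDerivAt_exp_neg s).mul_const (x i)).const_sub (y i)).div
      (hasDerivAt_one_sub_exp s) (one_sub_exp_pos hs).ne'
    refine h.congr_deriv ?_
    have := (one_sub_exp_pos hs).ne'
    field_simp
    ring
  | p =>
    refine ⟨_, ((const (-2)).mul (r.mul r)).mul' (p.mul p) (by lia), fun s hs x y => ?_⟩
    refine ((hasDerivAt_one_sub_exp s).inv (one_sub_exp_pos hs).ne').congr_deriv ?_
    have := (one_sub_exp_pos hs).ne'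
    field_simp
  | mono _ ih => obtain ⟨G, hG, h⟩ := ih; exact ⟨G, hG.mono, h⟩
  | add _ _ h1 h2 =>
    obtain ⟨G1, hG1, h1⟩ := h1
    obtain ⟨G2, hG2, h2⟩ := h2
    exact ⟨_, hG1.add hG2, fun s hs x y => (h1 s hs x y).add (h2 s hs x y)⟩
  | mul hF hG h1 h2 =>
    obtain ⟨G1, hG1, h1⟩ := h1
    obtain ⟨G2, hG2, h2⟩ := h2
    exact ⟨_, (hG1.mul' hG (by lia)).add (hF.mul' hG2 (by lia)),
      fun s hs x y => (h1 s hs x y).mul (h2 s hs x y)⟩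

theorem hasDerivAt_coord (x : E d) (i j : Fin d) :
    HasDerivAt (fun h : ℝ => (x + h • EuclideanSpace.single j (1 : ℝ)) i) (if i = j then 1 else 0)
      0 := by
  have : (fun h : ℝ => (x + h • EuclideanSpace.single j (1 : ℝ)) i) =
      fun h => x i + h * (if i = j then 1 else 0) := by
    ext h; simp
  rw [this]
  simpa using ((hasDerivAt_id (0 : ℝ)).mul_const (if i = j then (1 : ℝ) else 0)).const_add (x i)

theorem exists_deriv_fst {k : ℕ} {F : ℝ → E d → E d → ℝ} (h : IsPoly k F) (j : Fin d) :
    ∃ G, IsPoly (k + 1) G ∧ ∀ s, 0 < s → ∀ x y, HasDerivAt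
      (fun h : ℝ => F s (x + h • EuclideanSpace.single j (1 : ℝ)) y) (G s x y) 0 := by
  induction h with
  | const c => exact ⟨_, zero _, fun s _ x y => hasDerivAt_const _ c⟩
  | r => exact ⟨_, zero _, fun s _ x y => hasDerivAt_const _ _⟩
  | x i => exact ⟨_, (const _).mono_le (by lia), fun s _ x y => hasDerivAt_coord x i j⟩
  | q i =>
    refine ⟨_, ((const (if i = j then -1 else 0)).mul (r.mul p)).mono_le (by lia),
      fun s hs x y => ?_⟩
    have h := (((hasDerivAt_coord x i j).const_mul (Real.exp (-s))).const_sub (y i)).div_const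
      (1 - Real.exp (-2 * s))
    refine h.congr_deriv ?_
    split_ifs <;> ring
  | p => exact ⟨_, zero _, fun s _ x y => hasDerivAt_const _ _⟩
  | mono _ ih => obtain ⟨G, hG, h⟩ := ih; exact ⟨G, hG.mono, h⟩
  | add _ _ h1 h2 =>
    obtain ⟨G1, hG1, h1⟩ := h1
    obtain ⟨G2, hG2, h2⟩ := h2
    exact ⟨_, hG1.add hG2, fun s hs x y => (h1 s hs x y).add (h2 s hs x y)⟩
  | mul hF hG h1 h2 =>
    obtain ⟨G1, hG1, h1⟩ := h1
    obtain ⟨G2, hG2, h2⟩ := h2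
    exact ⟨_, (hG1.mul' hG (by lia)).add (hF.mul' hG2 (by lia)),
      fun s hs x y => ((h1 s hs x y).mul (h2 s hs x y)).congr_deriv (by simp)⟩

theorem exists_deriv_snd {k : ℕ} {F : ℝ → E d → E d → ℝ} (h : IsPoly k F) (j : Fin d) :
    ∃ G, IsPoly (k + 1) G ∧ ∀ s, 0 < s → ∀ x y, HasDerivAt
      (fun h : ℝ => F s x (y + h • EuclideanSpace.single j (1 : ℝ))) (G s x y) 0 := by
  induction h with
  | const c => exact ⟨_, zero _, fun s _ x y => hasDerivAt_const _ c⟩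
  | r => exact ⟨_, zero _, fun s _ x y => hasDerivAt_const _ _⟩
  | x i => exact ⟨_, zero _, fun s _ x y => hasDerivAt_const _ _⟩
  | q i =>
    refine ⟨_, ((const (if i = j then 1 else 0)).mul p).mono_le (by lia),
      fun s hs x y => ?_⟩
    have h := ((hasDerivAt_coord y i j).sub_const (Real.exp (-s) * x i)).div_const
      (1 - Real.exp (-2 * s))
    exact h
  | p => exact ⟨_, zero _, fun s _ x y => hasDerivAt_const _ _⟩
  | mono _ ih => obtain ⟨G, hG, h⟩ := ih; exact ⟨G, hG.mono, h⟩
  | add _ _ h1 h2 =>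
    obtain ⟨G1, hG1, h1⟩ := h1
    obtain ⟨G2, hG2, h2⟩ := h2
    exact ⟨_, hG1.add hG2, fun s hs x y => (h1 s hs x y).add (h2 s hs x y)⟩
  | mul hF hG h1 h2 =>
    obtain ⟨G1, hG1, h1⟩ := h1
    obtain ⟨G2, hG2, h2⟩ := h2
    exact ⟨_, (hG1.mul' hG (by lia)).add (hF.mul' hG2 (by lia)),
      fun s hs x y => ((h1 s hs x y).mul (h2 s hs x y)).congr_deriv (by simp)⟩

end IsPoly

/-- The logarithm of the Mehler kernel. -/
def logMehler (s : ℝ) (x y : E d) : ℝ :=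
  -((d : ℝ) / 2) * Real.log (1 - Real.exp (-2 * s))
    - (∑ i, (y i - Real.exp (-s) * x i) ^ 2) / (1 - Real.exp (-2 * s)) + ∑ i, y i ^ 2

theorem norm_sub_sq_eq_sum (r : ℝ) (x y : E d) : ‖r • x - y‖ ^ 2 = ∑ i, (y i - r * x i) ^ 2 := by
  rw [EuclideanSpace.real_norm_sq_eq]
  refine Finset.sum_congr rfl fun i _ => ?_
  simp; ring

theorem mehler_eq_exp {s : ℝ} (hs : 0 < s) (x y : E d) :
    mehler s x y = Real.exp (logMehler s x y) := by
  rw [mehler, logMehler, norm_sub_sq_eq_sum, EuclideanSpace.real_norm_sq_eq y,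
    Real.rpow_def_of_pos (one_sub_exp_pos hs), div_eq_mul_inv, ← Real.exp_neg, ← Real.exp_add,
    ← Real.exp_add]
  congr 1; ring

theorem mehler_pos {s : ℝ} (hs : 0 < s) (x y : E d) : 0 < mehler s x y := by
  rw [mehler_eq_exp hs]; exact Real.exp_pos _

theorem contDiff_mehler (s : ℝ) : ContDiff ℝ ∞ fun p : E d × E d => mehler s p.1 p.2 := by
  unfold mehler
  have h1 : ContDiff ℝ ∞ fun p : E d × E d => ‖Real.exp (-s) • p.1 - p.2‖ ^ 2 :=
    ContDiff.norm_sq ℝ (by fun_prop)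
  have h2 : ContDiff ℝ ∞ fun p : E d × E d => ‖p.2‖ ^ 2 := ContDiff.norm_sq ℝ (by fun_prop)
  exact ((h1.div_const _).neg.exp.div_const _).mul h2.exp

theorem exists_hasDerivAt_mehler : ∃ G : ℝ → E d → E d → ℝ, IsPoly 2 G ∧ ∀ s, 0 < s → ∀ x y,
    HasDerivAt (fun s => mehler s x y) (G s x y * mehler s x y) s := by
  -- The logarithmic derivative of the kernel in `s` is `-d r² p + ∑ (-2r x_i q_i + 2r² q_i²)`; this
  -- is its sum, in generator form.
  have hsum : IsPoly 2 fun (s : ℝ) (x y : E d) => ∑ i,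
      (((-2 * (Real.exp (-s) * x i)) * ((y i - Real.exp (-s) * x i) / (1 - Real.exp (-2 * s))))
      + (2 * (Real.exp (-s) * Real.exp (-s))) * (((y i - Real.exp (-s) * x i) /
        (1 - Real.exp (-2 * s))) * ((y i - Real.exp (-s) * x i) / (1 - Real.exp (-2 * s))))) := by
    refine IsPoly.sum _ fun i => ?_
    exact ((((IsPoly.const (-2)).mul (IsPoly.r.mul (IsPoly.x i))).mul' (IsPoly.q i) (by lia)).add
      (((IsPoly.const 2).mul (IsPoly.r.mul IsPoly.r)).mul' ((IsPoly.q i).mul (IsPoly.q i))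
        (by lia)))
  refine ⟨_, ((((IsPoly.const (-(d : ℝ))).mul (IsPoly.r.mul IsPoly.r)).mul' IsPoly.p
    (by lia)).add hsum), fun s hs x y => ?_⟩
  have hp := (one_sub_exp_pos hs).ne'
  have h1 : HasDerivAt (fun s : ℝ => ∑ i, (y i - Real.exp (-s) * x i) ^ 2)
      (∑ i, 2 * (Real.exp (-s) * x i) * (y i - Real.exp (-s) * x i)) s := by
    refine HasDerivAt.fun_sum fun i _ => ?_
    refine ((((IsPoly.hasDerivAt_exp_neg s).mul_const (x i)).const_sub (y i)).pow 2).congr_deriv ?_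
    simp; ring
  have h2 := ((((IsPoly.hasDerivAt_one_sub_exp s).log hp).const_mul (-((d : ℝ) / 2))).sub
    (h1.div (IsPoly.hasDerivAt_one_sub_exp s) hp)).add_const (∑ i, y i ^ 2)
  have h3 := h2.exp
  have h4 : (fun s => mehler s x y) =ᶠ[𝓝 s] fun s => Real.exp (logMehler s x y) := by
    filter_upwards [lt_mem_nhds hs] with s hs using mehler_eq_exp hs x y
  rw [mehler_eq_exp hs]
  refine (h3.congr_of_eventuallyEq h4).congr_deriv ?_
  rw [mul_comm]
  unfold logMehler
  congr 1
  have e : ∑ i, (((-2 * (Real.exp (-s) * x i)) * ((y i - Real.exp (-s) * x i) /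
      (1 - Real.exp (-2 * s)))) + (2 * (Real.exp (-s) * Real.exp (-s))) *
      (((y i - Real.exp (-s) * x i) / (1 - Real.exp (-2 * s))) *
      ((y i - Real.exp (-s) * x i) / (1 - Real.exp (-2 * s))))) =
      -(∑ i, 2 * (Real.exp (-s) * x i) * (y i - Real.exp (-s) * x i)) / (1 - Real.exp (-2 * s)) +
      (2 * Real.exp (-s) ^ 2) * (∑ i, (y i - Real.exp (-s) * x i) ^ 2) /
        (1 - Real.exp (-2 * s)) ^ 2 := by
    rw [← Finset.sum_neg_distrib, Finset.sum_div, Finset.mul_sum, Finset.sum_div,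
      ← Finset.sum_add_distrib]
    refine Finset.sum_congr rfl fun i _ => ?_
    field_simp
  rw [e]
  field_simp
  ring

theorem exists_deriv_fst_mehler (j : Fin d) : ∃ G : ℝ → E d → E d → ℝ, IsPoly 1 G ∧
    ∀ s, 0 < s → ∀ x y, HasDerivAt (fun h : ℝ => mehler s
      (x + h • EuclideanSpace.single j (1 : ℝ)) y) (G s x y * mehler s x y) 0 := by
  refine ⟨_, ((IsPoly.const 2).mul IsPoly.r).mul' (IsPoly.q j) (by lia), fun s hs x y => ?_⟩
  simp only [mehler_eq_exp hs]
  have h1 : HasDerivAt (fun h : ℝ => ∑ i, (y i - Real.exp (-s) *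
      (x + h • EuclideanSpace.single j (1 : ℝ)) i) ^ 2)
      (∑ i, 2 * (y i - Real.exp (-s) * x i) * (-(Real.exp (-s) * if i = j then 1 else 0))) 0 := by
    refine HasDerivAt.fun_sum fun i _ => ?_
    refine ((((IsPoly.hasDerivAt_coord x i j).const_mul (Real.exp (-s))).const_sub
      (y i)).pow 2).congr_deriv ?_
    simp
  have h2 := (((h1.div_const (1 - Real.exp (-2 * s))).const_sub (-((d : ℝ) / 2) *
    Real.log (1 - Real.exp (-2 * s)))).add_const (∑ i, y i ^ 2)).exp
  refine h2.congr_deriv ?_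
  rw [mul_comm, zero_smul, add_zero]
  unfold logMehler
  congr 1
  simp
  ring

/-- The logarithmic derivative is `2y_j - 2q_j`, and `y_j` is not a generator. Substituting `y_j =
(1 - r²)q_j + r x_j` turns it into `2r x_j - 2r² q_j`, which stays in the algebra. -/
theorem exists_deriv_snd_mehler (j : Fin d) : ∃ G : ℝ → E d → E d → ℝ, IsPoly 1 G ∧
    ∀ s, 0 < s → ∀ x y, HasDerivAt (fun h : ℝ => mehler s x
      (y + h • EuclideanSpace.single j (1 : ℝ))) (G s x y * mehler s x y) 0 := by
  refine ⟨_, (((IsPoly.const 2).mul IsPoly.r).mul' (IsPoly.x j) (by lia)).add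
    (((IsPoly.const (-2)).mul (IsPoly.r.mul IsPoly.r)).mul' (IsPoly.q j) (by lia)),
    fun s hs x y => ?_⟩
  simp only [mehler_eq_exp hs]
  have hp := (one_sub_exp_pos hs).ne'
  have h1 : HasDerivAt (fun h : ℝ => ∑ i, ((y + h • EuclideanSpace.single j (1 : ℝ)) i -
      Real.exp (-s) * x i) ^ 2)
      (∑ i, 2 * (y i - Real.exp (-s) * x i) * (if i = j then 1 else 0)) 0 := by
    refine HasDerivAt.fun_sum fun i _ => ?_
    refine (((IsPoly.hasDerivAt_coord y i j).sub_const (Real.exp (-s) * x i)).pow 2).congr_deriv ?_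
    simp
  have h1' : HasDerivAt (fun h : ℝ => ∑ i, ((y + h • EuclideanSpace.single j (1 : ℝ)) i) ^ 2)
      (∑ i, 2 * y i * (if i = j then 1 else 0)) 0 := by
    refine HasDerivAt.fun_sum fun i _ => ?_
    refine ((IsPoly.hasDerivAt_coord y i j).pow 2).congr_deriv ?_
    simp
  have h2 := (((h1.div_const (1 - Real.exp (-2 * s))).const_sub (-((d : ℝ) / 2) *
    Real.log (1 - Real.exp (-2 * s)))).add h1').exp
  refine h2.congr_deriv ?_
  rw [mul_comm]
  simp only [Pi.add_apply, zero_smul, add_zero]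
  unfold logMehler
  congr 1
  simp only [mul_ite, mul_one, mul_zero, Finset.sum_ite_eq', Finset.mem_univ, if_true]
  rw [exp_neg_two_mul] at hp ⊢
  field_simp
  ring

theorem partialDeriv_eq_of_hasDerivAt {f : E d → ℝ} {x : E d} {j : Fin d} {a : ℝ}
    (hf : DifferentiableAt ℝ f x)
    (h : HasDerivAt (fun h : ℝ => f (x + h • EuclideanSpace.single j (1 : ℝ))) a 0) :
    partialDeriv j f x = a := by
  rw [partialDeriv, ← hf.lineDeriv_eq_fderiv, lineDeriv, h.deriv]

namespace IsPoly
variable {k : ℕ} {F : ℝ → E d → E d → ℝ}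

theorem contDiff_mul_mehler (h : IsPoly k F) (s : ℝ) :
    ContDiff ℝ ∞ fun p : E d × E d => F s p.1 p.2 * mehler s p.1 p.2 :=
  (h.contDiff s).mul (contDiff_mehler s)

theorem contDiff_mul_mehler_fst (h : IsPoly k F) (s : ℝ) (y : E d) :
    ContDiff ℝ ∞ fun x : E d => F s x y * mehler s x y :=
  (h.contDiff_mul_mehler s).comp (by fun_prop : ContDiff ℝ ∞ fun x : E d => (x, y))

theorem contDiff_mul_mehler_snd (h : IsPoly k F) (s : ℝ) (x : E d) :
    ContDiff ℝ ∞ fun y : E d => F s x y * mehler s x y :=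
  (h.contDiff_mul_mehler s).comp (by fun_prop : ContDiff ℝ ∞ fun y : E d => (x, y))

theorem exists_hasDerivAt_mul_mehler (h : IsPoly k F) : ∃ G, IsPoly (k + 2) G ∧
    ∀ s, 0 < s → ∀ x y,
      HasDerivAt (fun s => F s x y * mehler s x y) (G s x y * mehler s x y) s := by
  obtain ⟨G, hG, h1⟩ := h.exists_deriv_time
  obtain ⟨H, hH, h2⟩ := exists_hasDerivAt_mehler (d := d)
  refine ⟨_, hG.add (h.mul hH), fun s hs x y => ?_⟩
  exact ((h1 s hs x y).mul (h2 s hs x y)).congr_deriv (by ring)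

theorem exists_partialDeriv_fst (h : IsPoly k F) (j : Fin d) : ∃ G, IsPoly (k + 1) G ∧
    ∀ s, 0 < s → ∀ x y,
      partialDeriv j (fun x => F s x y * mehler s x y) x = G s x y * mehler s x y := by
  obtain ⟨G, hG, h1⟩ := h.exists_deriv_fst j
  obtain ⟨H, hH, h2⟩ := exists_deriv_fst_mehler j
  refine ⟨_, hG.add (h.mul hH), fun s hs x y => ?_⟩
  refine partialDeriv_eq_of_hasDerivAt
    ((h.contDiff_mul_mehler_fst s y).differentiable (by simp) x) ?_
  exact ((h1 s hs x y).mul (h2 s hs x y)).congr_deriv (by simp; ring)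

theorem exists_partialDeriv_snd (h : IsPoly k F) (j : Fin d) : ∃ G, IsPoly (k + 1) G ∧
    ∀ s, 0 < s → ∀ x y,
      partialDeriv j (fun y => F s x y * mehler s x y) y = G s x y * mehler s x y := by
  obtain ⟨G, hG, h1⟩ := h.exists_deriv_snd j
  obtain ⟨H, hH, h2⟩ := exists_deriv_snd_mehler j
  refine ⟨_, hG.add (h.mul hH), fun s hs x y => ?_⟩
  refine partialDeriv_eq_of_hasDerivAt
    ((h.contDiff_mul_mehler_snd s x).differentiable (by simp) y) ?_
  exact ((h1 s hs x y).mul (h2 s hs x y)).congr_deriv (by simp; ring)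

end IsPoly

/-! ### Bounds for the derivatives of the Mehler kernel -/

theorem le_mul_exp_sq {ε : ℝ} (hε : 0 < ε) (t : ℝ) :
    t ≤ (1 + 1 / ε) * Real.exp (ε * t ^ 2) := by
  have h1 := Real.add_one_le_exp (ε * t ^ 2)
  have h2 : (1 + 1 / ε) * (ε * t ^ 2 + 1) = 1 + t ^ 2 + 1 / ε + ε * t ^ 2 := by
    field_simp; ring
  have h3 : 0 < 1 / ε := by positivity
  have h4 := mul_le_mul_of_nonneg_left h1 (by positivity : 0 ≤ 1 + 1 / ε)
  nlinarith [sq_nonneg (t - 1), mul_nonneg hε.le (sq_nonneg t)]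

theorem abs_coord_le_norm (x : E d) (i : Fin d) : |x i| ≤ ‖x‖ := by
  simpa using PiLp.norm_apply_le x i

theorem exp_neg_le_one {s : ℝ} (hs : 0 < s) : Real.exp (-s) ≤ 1 :=
  Real.exp_le_one_iff.2 (by linarith)

theorem one_sub_exp_mono {a s : ℝ} (hs : a ≤ s) :
    1 - Real.exp (-2 * a) ≤ 1 - Real.exp (-2 * s) := by
  have : Real.exp (-2 * s) ≤ Real.exp (-2 * a) := Real.exp_le_exp.2 (by linarith)
  linarith

/-- Away from `s = 0` the denominators are bounded below, so the growth is polynomial and is beaten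
by any Gaussian of positive rate. Quantifying over `ε` inside the induction lets a product split its
rate as `ε/2 + ε/2`. -/
theorem IsPoly.exists_abs_le {k : ℕ} {F : ℝ → E d → E d → ℝ} (h : IsPoly k F) {a : ℝ}
    (ha : 0 < a) : ∀ ε : ℝ, 0 < ε → ∃ c : ℝ, 0 ≤ c ∧ ∀ s, a ≤ s → ∀ x y,
      |F s x y| ≤ c * Real.exp (ε * (‖x‖ ^ 2 + ‖y‖ ^ 2)) := by
  have hone : ∀ ε : ℝ, 0 < ε → ∀ x y : E d, 1 ≤ Real.exp (ε * (‖x‖ ^ 2 + ‖y‖ ^ 2)) :=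
    fun ε hε x y => Real.one_le_exp (by positivity)
  have hcoord : ∀ ε : ℝ, 0 < ε → ∀ (x y : E d) (i : Fin d),
      |x i| ≤ (1 + 1 / ε) * Real.exp (ε * (‖x‖ ^ 2 + ‖y‖ ^ 2)) ∧
      |y i| ≤ (1 + 1 / ε) * Real.exp (ε * (‖x‖ ^ 2 + ‖y‖ ^ 2)) := by
    intro ε hε x y i
    constructor
    · refine (abs_coord_le_norm x i).trans ((le_mul_exp_sq hε ‖x‖).trans ?_)
      gcongr
      nlinarith [sq_nonneg ‖y‖]
    · refine (abs_coord_le_norm y i).trans ((le_mul_exp_sq hε ‖y‖).trans ?_)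
      gcongr
      nlinarith [sq_nonneg ‖x‖]
  have hp := one_sub_exp_pos ha
  induction h with
  | const c =>
    exact fun ε hε => ⟨|c|, abs_nonneg _, fun s _ x y =>
      le_mul_of_one_le_right (abs_nonneg _) (hone ε hε x y)⟩
  | r =>
    refine fun ε hε => ⟨1, zero_le_one, fun s hs x y => ?_⟩
    rw [abs_of_pos (Real.exp_pos _), one_mul]
    exact (exp_neg_le_one (ha.trans_le hs)).trans (hone ε hε x y)
  | x i => exact fun ε hε => ⟨_, by positivity, fun s _ x y => (hcoord ε hε x y i).1⟩
  | q i =>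
    refine fun ε hε => ⟨2 * (1 + 1 / ε) / (1 - Real.exp (-2 * a)), by positivity,
      fun s hs x y => ?_⟩
    obtain ⟨h1, h2⟩ := hcoord ε hε x y i
    have h3 := one_sub_exp_mono hs
    rw [abs_div, abs_of_pos (hp.trans_le h3), div_mul_eq_mul_div]
    refine div_le_div₀ (by positivity) ?_ hp h3
    have h4 : |y i - Real.exp (-s) * x i| ≤ |y i| + |x i| := by
      refine (abs_sub _ _).trans ?_
      rw [abs_mul, abs_of_pos (Real.exp_pos _)]
      gcongr
      exact mul_le_of_le_one_left (abs_nonneg _) (exp_neg_le_one (ha.trans_le hs))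
    linarith
  | p =>
    refine fun ε hε => ⟨(1 - Real.exp (-2 * a))⁻¹, by positivity, fun s hs x y => ?_⟩
    have h3 := one_sub_exp_mono hs
    rw [abs_of_pos (inv_pos.2 (hp.trans_le h3))]
    exact (inv_anti₀ hp h3).trans
      (le_mul_of_one_le_right (by positivity) (hone ε hε x y))
  | mono _ ih => exact ih
  | add _ _ h1 h2 =>
    intro ε hε
    obtain ⟨c1, hc1, h1⟩ := h1 ε hε
    obtain ⟨c2, hc2, h2⟩ := h2 ε hε
    refine ⟨c1 + c2, by positivity, fun s hs x y => (abs_add_le _ _).trans ?_⟩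
    rw [add_mul]
    exact add_le_add (h1 s hs x y) (h2 s hs x y)
  | mul _ _ h1 h2 =>
    intro ε hε
    obtain ⟨c1, hc1, h1⟩ := h1 (ε / 2) (by positivity)
    obtain ⟨c2, hc2, h2⟩ := h2 (ε / 2) (by positivity)
    refine ⟨c1 * c2, by positivity, fun s hs x y => ?_⟩
    rw [abs_mul]
    refine (mul_le_mul (h1 s hs x y) (h2 s hs x y) (abs_nonneg _) (by positivity)).trans_eq ?_
    rw [mul_mul_mul_comm, ← Real.exp_add]
    congr 2; ring

/-- The exponent equals `(2r⟨x,y⟩ - r²(|x|² + |y|²))/(1 - r²)`, which is at most `r/(1 + r) (|x|² +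
|y|²)` because `2⟨x,y⟩ ≤ |x|² + |y|²`. The rate `r/(1 + r)` increases with `r` and is below `1/2`;
`δ` is its gap to `1/2` at `r = e^{-a}`. -/
theorem exists_mehler_le {a : ℝ} (ha : 0 < a) : ∃ c δ : ℝ, 0 < δ ∧ 0 ≤ c ∧ ∀ s, a ≤ s →
    ∀ x y : E d, mehler s x y ≤ c * (weight δ x * weight δ y) := by
  set ra := Real.exp (-a) with hra
  have hra0 : 0 < ra := Real.exp_pos _
  have hra1 : ra < 1 := by simpa [hra] using ha
  have hp := one_sub_exp_pos ha
  refine ⟨((1 - Real.exp (-2 * a)) ^ ((d : ℝ) / 2))⁻¹, (1 - ra) / (2 * (1 + ra)),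
    div_pos (by linarith) (by linarith), by positivity, fun s hs x y => ?_⟩
  have hs0 := ha.trans_le hs
  have hps := one_sub_exp_pos hs0
  set r := Real.exp (-s) with hr
  have hr0 : 0 < r := Real.exp_pos _
  have hrra : r ≤ ra := Real.exp_le_exp.2 (by linarith)
  have key : -(‖r • x - y‖ ^ 2 / (1 - Real.exp (-2 * s))) + ‖y‖ ^ 2 ≤
      (1 / 2 - (1 - ra) / (2 * (1 + ra))) * ‖x‖ ^ 2 +
      (1 / 2 - (1 - ra) / (2 * (1 + ra))) * ‖y‖ ^ 2 := by
    have e1 : 1 / 2 - (1 - ra) / (2 * (1 + ra)) = ra / (1 + ra) := by field_simp; ring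
    have e2 : r / (1 + r) ≤ ra / (1 + ra) := by
      rw [div_le_div_iff₀ (by linarith) (by linarith)]; nlinarith
    have e3 : -(‖r • x - y‖ ^ 2 / (1 - Real.exp (-2 * s))) + ‖y‖ ^ 2 ≤
        r / (1 + r) * (‖x‖ ^ 2 + ‖y‖ ^ 2) := by
      rw [exp_neg_two_mul, ← hr] at hps ⊢
      have e4 : r / (1 + r) = r * (1 - r) / (1 - r ^ 2) := by
        rw [div_eq_div_iff (by linarith) hps.ne']; ring
      rw [e4, ← sub_nonneg]
      have e5 : r * (1 - r) / (1 - r ^ 2) * (‖x‖ ^ 2 + ‖y‖ ^ 2) -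
          (-(‖r • x - y‖ ^ 2 / (1 - r ^ 2)) + ‖y‖ ^ 2) =
          (r * (1 - r) * (‖x‖ ^ 2 + ‖y‖ ^ 2) + ‖r • x - y‖ ^ 2 - (1 - r ^ 2) * ‖y‖ ^ 2) /
            (1 - r ^ 2) := by
        field_simp; ring
      rw [e5]
      refine div_nonneg ?_ hps.le
      have e6 : ‖r • x - y‖ ^ 2 = r ^ 2 * ‖x‖ ^ 2 - 2 * (r * inner ℝ x y) + ‖y‖ ^ 2 := by
        rw [norm_sub_sq_real, norm_smul, mul_pow, real_inner_smul_left, Real.norm_eq_abs, sq_abs]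
      have e7 := norm_sub_sq_real x y
      rw [e6]
      nlinarith [sq_nonneg ‖x - y‖, mul_nonneg hr0.le (sq_nonneg ‖x - y‖)]
    rw [e1, ← mul_add]
    refine e3.trans (mul_le_mul_of_nonneg_right e2 (by positivity))
  rw [mehler, div_mul_eq_mul_div, ← Real.exp_add, weight, weight, ← Real.exp_add, div_eq_inv_mul]
  refine mul_le_mul ?_ (Real.exp_le_exp.2 key) (Real.exp_pos _).le (by positivity)
  exact inv_anti₀ (by positivity) (Real.rpow_le_rpow hp.le (one_sub_exp_mono hs) (by positivity))

namespace IsPoly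
variable {k : ℕ} {F : ℝ → E d → E d → ℝ}

/-- Half of the gap `δ` of the Mehler kernel is spent on the polynomial factor. Uniformity in `s ≥
a` is what later allows differentiation under the integral. -/
theorem exists_abs_mul_mehler_le (h : IsPoly k F) {a : ℝ} (ha : 0 < a) :
    ∃ c δ : ℝ, 0 < δ ∧ ∀ s, a ≤ s → ∀ x y : E d,
      |F s x y * mehler s x y| ≤ c * (weight δ x * weight δ y) := by
  obtain ⟨c1, δ, hδ, hc1, h1⟩ := exists_mehler_le (d := d) ha
  obtain ⟨c2, hc2, h2⟩ := h.exists_abs_le ha (δ / 2) (by positivity)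
  refine ⟨c2 * c1, δ / 2, by positivity, fun s hs x y => ?_⟩
  rw [abs_mul, abs_of_pos (mehler_pos (ha.trans_le hs) x y)]
  refine (mul_le_mul (h2 s hs x y) (h1 s hs x y) (mehler_pos (ha.trans_le hs) x y).le
    (by positivity)).trans_eq ?_
  have e : ∀ x : E d, weight (δ / 2) x = Real.exp (δ / 2 * ‖x‖ ^ 2) * weight δ x := fun x => by
    rw [exp_mul_sq_mul_weight]; congr 1; ring
  rw [e x, e y, mul_add, Real.exp_add]
  ring

theorem dominated (h : IsPoly k F) {s : ℝ} (hs : 0 < s) :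
    Dominated fun x y : E d => F s x y * mehler s x y := by
  obtain ⟨c, δ, hδ, hb⟩ := h.exists_abs_mul_mehler_le hs
  exact ⟨(h.contDiff_mul_mehler s).continuous, c, δ, hδ, hb s le_rfl⟩

end IsPoly

theorem dominated_mehler {s : ℝ} (hs : 0 < s) : Dominated (mehler s : E d → E d → ℝ) := by
  simpa using (IsPoly.const (d := d) 1).dominated hs

/-! ### The pointwise estimate -/

theorem one_sub_exp_le (s : ℝ) : 1 - Real.exp (-2 * s) ≤ 2 * s := by
  linarith [Real.add_one_le_exp (-2 * s)]

theorem two_mul_exp_le (s : ℝ) : 2 * s * Real.exp (-2 * s) ≤ 1 - Real.exp (-2 * s) := by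
  have h1 := Real.add_one_le_exp (2 * s)
  have h2 : Real.exp (2 * s) * Real.exp (-2 * s) = 1 := by
    rw [← Real.exp_add]; simp
  nlinarith [mul_le_mul_of_nonneg_right h1 (Real.exp_pos (-2 * s)).le]

/-- `t² / (1 - e^{-2t²/α}) ≤ α e^{2T²} / 2`. -/
theorem sq_div_one_sub_exp_le {T t α : ℝ} (ht : 0 < t) (htT : t < T) (hα : 1 ≤ α) :
    t ^ 2 / (1 - Real.exp (-2 * (t ^ 2 / α))) ≤ α * Real.exp (2 * T ^ 2) / 2 := by
  have hα0 : 0 < α := by linarith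
  have hs : 0 < t ^ 2 / α := by positivity
  have h1 := two_mul_exp_le (t ^ 2 / α)
  have h2 : t ^ 2 / α ≤ T ^ 2 :=
    (div_le_self (by positivity) hα).trans (by gcongr)
  rw [div_le_iff₀ (one_sub_exp_pos hs)]
  have h3 : 1 ≤ Real.exp (2 * T ^ 2) * Real.exp (-2 * (t ^ 2 / α)) := by
    rw [← Real.exp_add]; exact Real.one_le_exp (by linarith)
  calc t ^ 2 = α * (t ^ 2 / α) * 1 := by field_simp
    _ ≤ α * (t ^ 2 / α) * (Real.exp (2 * T ^ 2) * Real.exp (-2 * (t ^ 2 / α))) := by gcongr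
    _ = α * Real.exp (2 * T ^ 2) / 2 * (2 * (t ^ 2 / α) * Real.exp (-2 * (t ^ 2 / α))) := by ring
    _ ≤ _ := by gcongr

/-- The parabolic degree counts the factors `t` needed: `t|x_i| ≤ C`, while `t²p` and `(t|q_i|)²/z²`
are both at most `α e^{2T²}/2`. Raising the degree artificially costs a factor `T`. The constant
depends on `F` and `T` but not on `α`, `C`, `z`, as both parts of the theorem require. -/
theorem IsPoly.exists_pow_mul_abs_le {k : ℕ} {F : ℝ → E d → E d → ℝ} (h : IsPoly k F) {T : ℝ}
    (hT : 0 < T) : ∃ c : ℝ, 0 ≤ c ∧ ∀ t α C z : ℝ, 0 < t → t < T → 1 ≤ α → 0 ≤ C → 0 ≤ z →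
      ∀ x y : E d, t * ‖x‖ ≤ C →
      ‖Real.exp (-(t ^ 2 / α)) • x - y‖ ^ 2 / (1 - Real.exp (-2 * (t ^ 2 / α))) ≤ z ^ 2 →
      t ^ k * |F (t ^ 2 / α) x y| ≤ c * ((1 + C) * α * (1 + z)) ^ k := by
  have hbase : ∀ {α C z : ℝ}, 1 ≤ α → 0 ≤ C → 0 ≤ z → 1 ≤ (1 + C) * α * (1 + z) :=
    fun hα hC hz => one_le_mul_of_one_le_of_one_le
      (one_le_mul_of_one_le_of_one_le (by linarith) hα) (by linarith)
  induction h with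
  | const c =>
    exact ⟨|c|, abs_nonneg _, fun t α C z _ _ _ _ _ x y _ _ => by simp⟩
  | r =>
    refine ⟨1, zero_le_one, fun t α C z ht _ hα _ _ x y _ _ => ?_⟩
    have : 0 < t ^ 2 / α := by positivity
    simpa using this.le
  | x i =>
    refine ⟨1, zero_le_one, fun t α C z ht _ hα hC hz x y hx _ => ?_⟩
    rw [pow_one, pow_one, one_mul]
    calc t * |x i| ≤ t * ‖x‖ := by gcongr; exact abs_coord_le_norm x i
      _ ≤ (1 + C) * 1 * 1 := by linarith
      _ ≤ (1 + C) * α * (1 + z) := by gcongr; linarith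
  | q i =>
    refine ⟨Real.exp (2 * T ^ 2), (Real.exp_pos _).le, fun t α C z ht htT hα hC hz x y hx hz2 => ?_⟩
    have hs : 0 < t ^ 2 / α := by positivity
    have hp := one_sub_exp_pos hs
    have h1 := sq_div_one_sub_exp_le ht htT hα
    set r := Real.exp (-(t ^ 2 / α))
    set ρ := 1 - Real.exp (-2 * (t ^ 2 / α))
    set B := Real.exp (2 * T ^ 2)
    have hB : 1 ≤ B := Real.one_le_exp (by positivity)
    have h2 : (y i - r * x i) ^ 2 ≤ ‖r • x - y‖ ^ 2 := by
      rw [norm_sub_sq_eq_sum]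
      exact Finset.single_le_sum (f := fun i => (y i - r * x i) ^ 2) (fun i _ => sq_nonneg _)
        (Finset.mem_univ i)
    have h3 : (t * |(y i - r * x i) / ρ|) ^ 2 ≤ (B * (α * z)) ^ 2 := by
      rw [mul_pow, sq_abs, div_pow]
      calc t ^ 2 * ((y i - r * x i) ^ 2 / ρ ^ 2) = (t ^ 2 / ρ) * ((y i - r * x i) ^ 2 / ρ) := by
            field_simp
        _ ≤ (α * B / 2) * z ^ 2 := by
            gcongr
            exact (by gcongr : (y i - r * x i) ^ 2 / ρ ≤ _).trans hz2
        -- The factor `αB/2` is enlarged to a perfect square, using `αB ≥ 1`, so that a square root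
        -- can be taken; powers of `α` are harmless.
        _ ≤ (α * B) ^ 2 * z ^ 2 := by
            gcongr
            have : 1 ≤ α * B := one_le_mul_of_one_le_of_one_le hα hB
            nlinarith
        _ = _ := by ring
    have h4 := abs_le_of_sq_le_sq h3 (by positivity)
    rw [pow_one, pow_one]
    refine ((le_abs_self _).trans h4).trans (mul_le_mul_of_nonneg_left ?_ (Real.exp_pos _).le)
    nlinarith [mul_nonneg hC (by positivity : 0 ≤ α * (1 + z))]
  | p =>
    refine ⟨Real.exp (2 * T ^ 2), (Real.exp_pos _).le, fun t α C z ht htT hα hC hz x y hx hz2 => ?_⟩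
    have hs : 0 < t ^ 2 / α := by positivity
    have hp := one_sub_exp_pos hs
    have h1 := sq_div_one_sub_exp_le ht htT hα
    rw [abs_of_pos (inv_pos.2 hp), ← div_eq_mul_inv]
    refine h1.trans ?_
    have h2 : α ≤ ((1 + C) * α * (1 + z)) ^ 2 := by
      have h3 : α ≤ (1 + C) * α * (1 + z) := by
        nlinarith [mul_nonneg hC (by positivity : 0 ≤ α * (1 + z)), mul_nonneg hz (by positivity : 0 ≤ α)]
      exact h3.trans (le_self_pow₀ (hbase hα hC hz) two_ne_zero)
    nlinarith [mul_le_mul_of_nonneg_left h2 (Real.exp_pos (2 * T ^ 2)).le, Real.exp_pos (2 * T ^ 2)]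
  | mono _ ih =>
    obtain ⟨c, hc, h⟩ := ih
    refine ⟨T * c, by positivity, fun t α C z ht htT hα hC hz x y hx hz2 => ?_⟩
    have h1 := h t α C z ht htT hα hC hz x y hx hz2
    have h2 := hbase hα hC hz
    rw [pow_succ' t, mul_assoc]
    refine (mul_le_mul htT.le h1 (by positivity) hT.le).trans ?_
    rw [← mul_assoc]
    exact mul_le_mul_of_nonneg_left (pow_le_pow_right₀ h2 (Nat.le_succ _)) (by positivity)
  | add _ _ h1 h2 =>
    obtain ⟨c1, hc1, h1⟩ := h1
    obtain ⟨c2, hc2, h2⟩ := h2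
    refine ⟨c1 + c2, by positivity, fun t α C z ht htT hα hC hz x y hx hz2 => ?_⟩
    have h1 := h1 t α C z ht htT hα hC hz x y hx hz2
    have h2 := h2 t α C z ht htT hα hC hz x y hx hz2
    rw [add_mul]
    refine (mul_le_mul_of_nonneg_left (abs_add_le _ _) (by positivity)).trans ?_
    rw [mul_add]
    exact add_le_add h1 h2
  | mul _ _ h1 h2 =>
    obtain ⟨c1, hc1, h1⟩ := h1
    obtain ⟨c2, hc2, h2⟩ := h2
    refine ⟨c1 * c2, by positivity, fun t α C z ht htT hα hC hz x y hx hz2 => ?_⟩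
    have h1 := h1 t α C z ht htT hα hC hz x y hx hz2
    have h2 := h2 t α C z ht htT hα hC hz x y hx hz2
    rw [abs_mul, pow_add, pow_add, mul_mul_mul_comm, mul_mul_mul_comm c1]
    exact mul_le_mul h1 h2 (by positivity) (by positivity)

/-! ### Comparison of the Gaussians at times `t²/α` and `t²`. -/

theorem one_add_pow_le_exp_sq (k : ℕ) {z : ℝ} (hz : 0 ≤ z) :
    (1 + z) ^ k ≤ k.factorial * Real.exp (7 / 2) * Real.exp (z ^ 2 / 10) := by
  have h := Real.pow_div_factorial_le_exp (1 + z) (by linarith) k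
  rw [div_le_iff₀ (by positivity)] at h
  rw [mul_assoc, ← Real.exp_add, mul_comm (k.factorial : ℝ)]
  refine h.trans (mul_le_mul_of_nonneg_right (Real.exp_le_exp.2 ?_) (by positivity))
  -- `(z - 5)² ≥ 0` is exactly `1 + z ≤ 7/2 + z²/10`.
  nlinarith [sq_nonneg (z - 5)]

/-- Here `1 - e^{-v} ≥ v/(1 + v)` and `1 + v ≤ 1 + 2T + 2T² ≤ e^{2T}`. The cruder `v e^{-v} ≤ 1 -
e^{-v}` would give `e^{-2T²}`, too weak when `T > 1` for the factor `e^{2T}` in the target exponent.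
-/
theorem mul_exp_le_one_sub_exp {T v : ℝ} (hT : 0 < T) (hv : 0 ≤ v) (hvT : v ≤ 2 * T ^ 2) :
    v * Real.exp (-(2 * T)) ≤ 1 - Real.exp (-v) := by
  have h1 := Real.add_one_le_exp v
  have h2 := Real.quadratic_le_exp_of_nonneg (x := 2 * T) (by positivity)
  have h3 : Real.exp (-v) ≤ (1 + v)⁻¹ := by
    rw [Real.exp_neg]; exact inv_anti₀ (by linarith) (by linarith)
  have h4 : Real.exp (-(2 * T)) ≤ (1 + v)⁻¹ := by
    rw [Real.exp_neg]; exact inv_anti₀ (by linarith) (by nlinarith)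
  have h5 : v * (1 + v)⁻¹ = 1 - (1 + v)⁻¹ := by field_simp; ring
  have h6 := mul_le_mul_of_nonneg_left h4 hv
  linarith

/-- Let `W`, `Q` be the exponents at times `t²/α` and `t²`, and `B = e^{2T}`. Shifting the centre
gives `W ≥ |e^{-t²}x - y|²/(4ρ) - αC²/6`, and comparing variances gives `|e^{-t²}x - y|²/ρ ≥ (α/B)
Q`. Multiplying by `9/10` leaves `(9/40)(α/B) Q - 3αC²/20`. As `9/40 = 1/8 + 1/10`, the hypothesis
`α/B ≥ 10` supplies both the extra decay and one full `Q`. -/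
theorem exponent_le {T t α C : ℝ} (ht : 0 < t) (htT : t < T) (hα : 10 * Real.exp (2 * T) ≤ α)
    (x y : E d) (hx : t * ‖x‖ ≤ C) :
    -(9 / 10 * (‖Real.exp (-(t ^ 2 / α)) • x - y‖ ^ 2 / (1 - Real.exp (-2 * (t ^ 2 / α))))) ≤
      3 / 20 * α * C ^ 2 - ‖Real.exp (-t ^ 2) • x - y‖ ^ 2 / (1 - Real.exp (-2 * t ^ 2)) -
      α / (8 * Real.exp (2 * T)) *
        (‖Real.exp (-t ^ 2) • x - y‖ ^ 2 / (1 - Real.exp (-2 * t ^ 2))) := by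
  have hT : 0 < T := ht.trans htT
  have hB : 1 ≤ Real.exp (2 * T) := Real.one_le_exp (by positivity)
  have hα1 : 1 ≤ α := by linarith
  have hs : 0 < t ^ 2 / α := by positivity
  have hρ := one_sub_exp_pos hs
  have hρt := one_sub_exp_pos (pow_pos ht 2)
  have hst : t ^ 2 / α ≤ t ^ 2 := div_le_self (by positivity) hα1
  have hρ1 : 2 * (t ^ 2 / α) * Real.exp (-(t ^ 2 / α)) ^ 2 ≤ 1 - Real.exp (-2 * (t ^ 2 / α)) := by
    rw [← exp_neg_two_mul]; exact two_mul_exp_le _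
  have hρ2 := one_sub_exp_le (t ^ 2 / α)
  have hρ3 : 2 * t ^ 2 * (Real.exp (2 * T))⁻¹ ≤ 1 - Real.exp (-2 * t ^ 2) := by
    have h := mul_exp_le_one_sub_exp (v := 2 * t ^ 2) hT (by positivity) (by gcongr)
    rwa [Real.exp_neg (2 * T), ← neg_mul] at h
  -- The factor `e^{-s}` is kept on the right because the bound `2s e^{-2s} ≤ 1 - e^{-2s}` absorbs
  -- its square, so the loss is `αC²/2` with no constant depending on `T`.
  have hr : Real.exp (-(t ^ 2 / α)) - Real.exp (-t ^ 2) ≤ Real.exp (-(t ^ 2 / α)) * t ^ 2 := by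
    have h1 := Real.add_one_le_exp (-t ^ 2 + t ^ 2 / α)
    have h2 : Real.exp (-t ^ 2) = Real.exp (-(t ^ 2 / α)) * Real.exp (-t ^ 2 + t ^ 2 / α) := by
      rw [← Real.exp_add]; congr 1; ring
    have h3 := mul_le_mul_of_nonneg_left h1 (Real.exp_pos (-(t ^ 2 / α))).le
    rw [h2]
    nlinarith [mul_pos (Real.exp_pos (-(t ^ 2 / α))) hs]
  have hr0 : 0 ≤ Real.exp (-(t ^ 2 / α)) - Real.exp (-t ^ 2) :=
    sub_nonneg.2 (Real.exp_le_exp.2 (by linarith))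
  set r := Real.exp (-(t ^ 2 / α))
  set rt := Real.exp (-t ^ 2)
  set ρ := 1 - Real.exp (-2 * (t ^ 2 / α))
  set ρt := 1 - Real.exp (-2 * t ^ 2)
  set B := Real.exp (2 * T)
  have hq : ‖rt • x - y‖ ≤ ‖r • x - y‖ + (r - rt) * ‖x‖ := by
    have e : rt • x - y = (r • x - y) - (r - rt) • x := by rw [sub_smul]; abel
    rw [e]
    refine (norm_sub_le _ _).trans_eq ?_
    rw [norm_smul, Real.norm_eq_abs, abs_of_nonneg hr0]
  have ha : (r - rt) * ‖x‖ ≤ r * (t * C) := by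
    calc (r - rt) * ‖x‖ ≤ r * t ^ 2 * ‖x‖ := by gcongr
      _ = r * (t * (t * ‖x‖)) := by ring
      _ ≤ _ := by gcongr
  have ha2 : ((r - rt) * ‖x‖) ^ 2 ≤ α * C ^ 2 / 2 * ρ := by
    calc ((r - rt) * ‖x‖) ^ 2 ≤ (r * (t * C)) ^ 2 := by gcongr
      _ = α * C ^ 2 / 2 * (2 * (t ^ 2 / α) * r ^ 2) := by field_simp
      _ ≤ _ := by gcongr
  -- Young's inequality with weights `1 + 3` and `1 + 1/3`. These weights put the final coefficients
  -- at `9/40 > 1/8` and `3/20 < 1/2`.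
  have hw : ‖rt • x - y‖ ^ 2 ≤ 4 * ‖r • x - y‖ ^ 2 + 4 / 3 * ((r - rt) * ‖x‖) ^ 2 := by
    have h1 := pow_le_pow_left₀ (norm_nonneg _) hq 2
    nlinarith [sq_nonneg (3 * ‖r • x - y‖ - (r - rt) * ‖x‖)]
  have h1 : ‖rt • x - y‖ ^ 2 / 4 - α * C ^ 2 / 6 * ρ ≤ ‖r • x - y‖ ^ 2 := by linarith
  have h2 : ‖rt • x - y‖ ^ 2 / ρ / 4 - α * C ^ 2 / 6 ≤ ‖r • x - y‖ ^ 2 / ρ := by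
    rw [le_div_iff₀ hρ]
    refine le_trans (le_of_eq ?_) h1
    field_simp
  have h3 : α / B * (‖rt • x - y‖ ^ 2 / ρt) ≤ ‖rt • x - y‖ ^ 2 / ρ := by
    have : α / B * ρ ≤ ρt := by
      refine le_trans ?_ hρ3
      calc α / B * ρ ≤ α / B * (2 * (t ^ 2 / α)) := by gcongr
        _ = _ := by field_simp
    rw [mul_div_assoc', div_le_div_iff₀ hρt hρ]
    calc α / B * ‖rt • x - y‖ ^ 2 * ρ = ‖rt • x - y‖ ^ 2 * (α / B * ρ) := by ring
      _ ≤ _ := by gcongr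
  have h4 : (10 : ℝ) ≤ α / B := by rw [le_div_iff₀ (by positivity)]; exact hα
  have h5 : α / (8 * B) = α / B / 8 := by rw [div_div]; ring
  rw [h5]
  set Q := ‖rt • x - y‖ ^ 2 / ρt
  have hQ : 0 ≤ Q := by positivity
  nlinarith [mul_le_mul_of_nonneg_right h4 hQ]

/-- `exponent_le` handles the exponentials. The normalising factors are compared through `1 -
e^{-2t²} ≤ 2t² ≤ α e^{2T²} (1 - e^{-2t²/α})`. The factor `e^{W/10}` on the left is room for the
polynomial part. -/
theorem mehler_le_mehler {T t α C : ℝ} (ht : 0 < t) (htT : t < T)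
    (hα : 10 * Real.exp (2 * T) ≤ α) (x y : E d) (hx : t * ‖x‖ ≤ C) :
    Real.exp (‖Real.exp (-(t ^ 2 / α)) • x - y‖ ^ 2 / (1 - Real.exp (-2 * (t ^ 2 / α))) / 10) *
      mehler (t ^ 2 / α) x y ≤ Real.exp (2 * T ^ 2) ^ d * α ^ d * Real.exp (3 / 20 * α * C ^ 2) *
      (mehler (t ^ 2) x y * Real.exp (-(α / (8 * Real.exp (2 * T)) *
        (‖Real.exp (-t ^ 2) • x - y‖ ^ 2 / (1 - Real.exp (-2 * t ^ 2)))))) := by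
  have hT : 0 < T := ht.trans htT
  have hα1 : 1 ≤ α := by linarith [Real.one_le_exp (by positivity : 0 ≤ 2 * T)]
  have hs : 0 < t ^ 2 / α := by positivity
  have hρ := one_sub_exp_pos hs
  have hρt := one_sub_exp_pos (pow_pos ht 2)
  have h1 := exponent_le ht htT hα x y hx
  have h2 := sq_div_one_sub_exp_le ht htT hα1
  have h3 := one_sub_exp_le (t ^ 2)
  set B := Real.exp (2 * T ^ 2) with hBdef
  have hB : 1 ≤ B := Real.one_le_exp (by positivity)
  rw [mehler, mehler]
  set W := ‖Real.exp (-(t ^ 2 / α)) • x - y‖ ^ 2 / (1 - Real.exp (-2 * (t ^ 2 / α)))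
  set Q := ‖Real.exp (-t ^ 2) • x - y‖ ^ 2 / (1 - Real.exp (-2 * t ^ 2))
  set ρ := 1 - Real.exp (-2 * (t ^ 2 / α))
  set ρt := 1 - Real.exp (-2 * t ^ 2)
  have h4 : ρt ^ ((d : ℝ) / 2) ≤ B ^ d * α ^ d * ρ ^ ((d : ℝ) / 2) := by
    rw [div_le_iff₀ hρ] at h2
    calc ρt ^ ((d : ℝ) / 2) ≤ (B * α * ρ) ^ ((d : ℝ) / 2) :=
          Real.rpow_le_rpow hρt.le (by linarith) (by positivity)
      _ = (B * α) ^ ((d : ℝ) / 2) * ρ ^ ((d : ℝ) / 2) :=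
          Real.mul_rpow (by positivity) hρ.le
      -- The exponent `d/2` is rounded up to `d` because `Bα ≥ 1`, which keeps later powers of `α`
      -- natural.
      _ ≤ (B * α) ^ (d : ℝ) * ρ ^ ((d : ℝ) / 2) := by
          gcongr
          · exact one_le_mul_of_one_le_of_one_le hB hα1
          · linarith [(Nat.cast_nonneg d : (0 : ℝ) ≤ d)]
      _ = _ := by rw [Real.rpow_natCast, mul_pow]
  have h5 : (ρ ^ ((d : ℝ) / 2))⁻¹ ≤ B ^ d * α ^ d * (ρt ^ ((d : ℝ) / 2))⁻¹ := by
    rw [← div_eq_mul_inv, le_div_iff₀ (by positivity), inv_mul_le_iff₀ (by positivity)]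
    linarith
  have h6 : Real.exp (W / 10) * Real.exp (-W) ≤
      Real.exp (3 / 20 * α * C ^ 2) * (Real.exp (-Q) *
        Real.exp (-(α / (8 * Real.exp (2 * T)) * Q))) := by
    rw [← Real.exp_add, ← Real.exp_add, ← Real.exp_add]
    exact Real.exp_le_exp.2 (by linarith)
  calc _ = (Real.exp (W / 10) * Real.exp (-W)) * (ρ ^ ((d : ℝ) / 2))⁻¹ * Real.exp (‖y‖ ^ 2) := by
        rw [div_eq_mul_inv]; ring
    _ ≤ (Real.exp (3 / 20 * α * C ^ 2) * (Real.exp (-Q) *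
        Real.exp (-(α / (8 * Real.exp (2 * T)) * Q)))) *
          (B ^ d * α ^ d * (ρt ^ ((d : ℝ) / 2))⁻¹) * Real.exp (‖y‖ ^ 2) := by gcongr
    _ = _ := by rw [div_eq_mul_inv]; ring

/-- The bound with the exponent `3αC²/20` and polynomial losses in `α` and `C`. -/
def PreBound (T : ℝ) (m : ℕ) (c : ℝ) (k : ℝ → ℝ → E d → E d → ℝ) : Prop :=
  ∀ t α C : ℝ, 0 < t → t < T → 10 * Real.exp (2 * T) ≤ α → 0 ≤ C → ∀ x y : E d, t * ‖x‖ ≤ C →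
    |k t α x y| ≤ c * ((1 + C) ^ m * α ^ (m + d) * Real.exp (3 / 20 * α * C ^ 2) *
      (mehler (t ^ 2) x y * Real.exp (-(α / (8 * Real.exp (2 * T)) *
        (‖Real.exp (-t ^ 2) • x - y‖ ^ 2 / (1 - Real.exp (-2 * t ^ 2)))))))

theorem PreBound.mono {T : ℝ} {m m' : ℕ} {c c' : ℝ} {k : ℝ → ℝ → E d → E d → ℝ} (hc : 0 ≤ c)
    (h : PreBound T m c k) (hm : m ≤ m') (hcc : c ≤ c') : PreBound T m' c' k := by
  intro t α C ht htT hα hC x y hx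
  have hα1 : 1 ≤ α := by linarith [Real.one_le_exp (by linarith : 0 ≤ 2 * T)]
  have hM := mehler_pos (pow_pos ht 2) x y
  refine (h t α C ht htT hα hC x y hx).trans ?_
  gcongr <;> linarith

theorem IsPoly.exists_preBound {k : ℕ} {F : ℝ → E d → E d → ℝ} (h : IsPoly k F) {T : ℝ}
    (hT : 0 < T) : ∃ c : ℝ, 0 ≤ c ∧ PreBound T k c fun t α x y =>
      t ^ k * (F (t ^ 2 / α) x y * mehler (t ^ 2 / α) x y) := by
  obtain ⟨c, hc, hF⟩ := h.exists_pow_mul_abs_le hT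
  refine ⟨c * (k.factorial * Real.exp (7 / 2)) * Real.exp (2 * T ^ 2) ^ d, by positivity, ?_⟩
  intro t α C ht htT hα hC x y hx
  have hα1 : 1 ≤ α := by linarith [Real.one_le_exp (by positivity : 0 ≤ 2 * T)]
  have hs : 0 < t ^ 2 / α := by positivity
  have hρ := one_sub_exp_pos hs
  have h2 := mehler_le_mehler ht htT hα x y hx
  set W := ‖Real.exp (-(t ^ 2 / α)) • x - y‖ ^ 2 / (1 - Real.exp (-2 * (t ^ 2 / α))) with hW
  have hW0 : 0 ≤ W := by positivity
  have hz : √W ^ 2 = W := Real.sq_sqrt hW0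
  have h1 := hF t α C (√W) ht htT hα1 hC (Real.sqrt_nonneg _) x y hx hz.ge
  have h3 := one_add_pow_le_exp_sq k (Real.sqrt_nonneg W)
  rw [hz] at h3
  have hM := mehler_pos hs x y
  rw [abs_mul, abs_mul, abs_of_pos hM, abs_of_pos (pow_pos ht k), ← mul_assoc]
  calc t ^ k * |F (t ^ 2 / α) x y| * mehler (t ^ 2 / α) x y
      ≤ c * ((1 + C) * α * (1 + √W)) ^ k * mehler (t ^ 2 / α) x y := by gcongr
    _ = c * ((1 + C) ^ k * α ^ k) * ((1 + √W) ^ k * mehler (t ^ 2 / α) x y) := by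
        rw [mul_pow, mul_pow]; ring
    _ ≤ c * ((1 + C) ^ k * α ^ k) * (k.factorial * Real.exp (7 / 2) * Real.exp (W / 10) *
          mehler (t ^ 2 / α) x y) := by gcongr
    _ = c * ((1 + C) ^ k * α ^ k) * (k.factorial * Real.exp (7 / 2)) * (Real.exp (W / 10) *
          mehler (t ^ 2 / α) x y) := by ring
    _ ≤ c * ((1 + C) ^ k * α ^ k) * (k.factorial * Real.exp (7 / 2)) * _ :=
        mul_le_mul_of_nonneg_left h2 (by positivity)
    _ = _ := by rw [pow_add]; ring

theorem PreBound.kernelBound {T C α c c' : ℝ} {m : ℕ} {k : ℝ → ℝ → E d → E d → ℝ}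
    (h : PreBound T m c k) (hC : 0 < C) (hα : 10 * Real.exp (2 * T) ≤ α)
    (hcc : c * ((1 + C) ^ m * α ^ (m + d) * Real.exp (3 / 20 * α * C ^ 2)) ≤
      c' * (α * Real.exp (α / 2 * C ^ 2))) :
    KernelBound T C α c' fun t => k t α := by
  intro t ht htT x y hx
  have hM := mehler_pos (pow_pos ht 2) x y
  refine (h t α C ht htT hα hC.le x y hx).trans ?_
  rw [← mul_assoc c]
  refine (mul_le_mul_of_nonneg_right hcc (by positivity)).trans_eq (by ring)

/-! ### Absorbing powers of `α` and `1 + C` into the spare factor `e^{7αC²/20}`. -/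

theorem exp_split (α C : ℝ) : Real.exp (α / 2 * C ^ 2) =
    Real.exp (3 / 20 * α * C ^ 2) * Real.exp (7 / 20 * C ^ 2 * α) := by
  rw [← Real.exp_add]; congr 1; ring

/-- For fixed `C > 0`, `(1 + C)^m α^n e^{-7αC²/20}` tends to `0`, so it is eventually below `1`: no
constant is left over. This gives the first assertion. -/
theorem exists_threshold (m n : ℕ) {C : ℝ} (hC : 0 < C) : ∃ α₀ : ℝ, 1 < α₀ ∧ ∀ α : ℝ, α₀ ≤ α →
    (1 + C) ^ m * α ^ n * Real.exp (3 / 20 * α * C ^ 2) ≤ α * Real.exp (α / 2 * C ^ 2) := by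
  have hb : 0 < 7 / 20 * C ^ 2 := by positivity
  have h1 := tendsto_rpow_mul_exp_neg_mul_atTop_nhds_zero (n : ℝ) (7 / 20 * C ^ 2) hb
  have h2 := h1.eventually (gt_mem_nhds (by positivity : (0 : ℝ) < ((1 + C) ^ m)⁻¹))
  obtain ⟨A, hA⟩ := eventually_atTop.1 h2
  refine ⟨max A 2, by simp, fun α hα => ?_⟩
  have h3 := hA α ((le_max_left _ _).trans hα)
  have hα2 : 2 ≤ α := (le_max_right _ _).trans hα
  rw [Real.rpow_natCast, neg_mul, Real.exp_neg, ← div_eq_mul_inv, div_lt_iff₀ (Real.exp_pos _),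
    ← div_eq_inv_mul, lt_div_iff₀ (by positivity)] at h3
  rw [exp_split]
  have h4 : 0 < Real.exp (3 / 20 * α * C ^ 2) := Real.exp_pos _
  calc (1 + C) ^ m * α ^ n * Real.exp (3 / 20 * α * C ^ 2)
      ≤ Real.exp (7 / 20 * C ^ 2 * α) * Real.exp (3 / 20 * α * C ^ 2) := by
        gcongr; linarith
    _ = 1 * (Real.exp (3 / 20 * α * C ^ 2) * Real.exp (7 / 20 * C ^ 2 * α)) := by ring
    _ ≤ _ := by gcongr; linarith

/-- With `b = 7C²/20`, `α^n ≤ (n!/b^n) e^{bα}` holds for every `α`, and the constant carries the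
dependence on `C`. This gives the second assertion. -/
theorem exists_factor (m n : ℕ) {C : ℝ} (hC : 0 < C) : ∃ c : ℝ, 0 < c ∧ ∀ α : ℝ, 1 ≤ α →
    (1 + C) ^ m * α ^ n * Real.exp (3 / 20 * α * C ^ 2) ≤ c * (α * Real.exp (α / 2 * C ^ 2)) := by
  have hb : 0 < 7 / 20 * C ^ 2 := by positivity
  set b := 7 / 20 * C ^ 2 with hbdef
  refine ⟨(1 + C) ^ m * (n.factorial / b ^ n), by positivity, fun α hα => ?_⟩
  have h1 := Real.pow_div_factorial_le_exp (b * α) (by positivity) n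
  rw [div_le_iff₀ (by positivity), mul_pow, mul_comm, ← le_div_iff₀ (by positivity)] at h1
  have h2 : α ^ n ≤ n.factorial / b ^ n * Real.exp (b * α) := by
    refine h1.trans_eq (by ring)
  rw [exp_split, ← hbdef]
  calc (1 + C) ^ m * α ^ n * Real.exp (3 / 20 * α * C ^ 2)
      ≤ (1 + C) ^ m * (n.factorial / b ^ n * Real.exp (b * α)) * Real.exp (3 / 20 * α * C ^ 2) := by
        gcongr
    _ = (1 + C) ^ m * (n.factorial / b ^ n) * (1 * (Real.exp (3 / 20 * α * C ^ 2) *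
          Real.exp (b * α))) := by ring
    _ ≤ _ := by gcongr

/-! ### Trigonometric functions -/

/-- The function `x ↦ cos(⟨ξ, x⟩ + θ)`. -/
def trig (ξ : E d) (θ : ℝ) (x : E d) : ℝ := Real.cos (inner ℝ ξ x + θ)

theorem contDiff_trig (ξ : E d) (θ : ℝ) : ContDiff ℝ ∞ (trig ξ θ) := by
  exact Real.contDiff_cos.comp ((contDiff_const.inner ℝ contDiff_id).add contDiff_const)

theorem abs_trig_le (ξ : E d) (θ : ℝ) (x : E d) : |trig ξ θ x| ≤ 1 := Real.abs_cos_le_one _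

theorem memLp_trig (ξ : E d) (θ : ℝ) : MemLp (trig ξ θ) 2 (gaussianMeasure d) :=
  memLp_of_bounded (contDiff_trig ξ θ).continuous (abs_trig_le ξ θ)

/-- The function `x ↦ cos(⟨ξ, x⟩ + θ)` as an element of `L²(γ)`. -/
def trigL2 (ξ : E d) (θ : ℝ) : L2 d := (memLp_trig ξ θ).toLp _

theorem coeFn_trigL2 (ξ : E d) (θ : ℝ) : trigL2 ξ θ =ᵐ[gaussianMeasure d] trig ξ θ :=
  MemLp.coeFn_toLp _

theorem inner_trigL2 (f : L2 d) (ξ : E d) (θ : ℝ) :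
    inner ℝ f (trigL2 ξ θ) = ∫ x, f x * trig ξ θ x ∂(gaussianMeasure d) :=
  inner_toLp f (memLp_trig ξ θ)

/-- Real part of the Fourier transform of a Gaussian, after multiplication by the phase `e^{iβ}`. -/
theorem integral_exp_mul_cos {b : ℝ} (hb : 0 < b) (ξ : E d) (β : ℝ) :
    ∫ v : E d, Real.exp (-b * ‖v‖ ^ 2) * Real.cos (inner ℝ ξ v + β) =
      (Real.pi / b) ^ ((d : ℝ) / 2) * Real.exp (-(‖ξ‖ ^ 2 / (4 * b))) * Real.cos β := by
  have hb' : 0 < (b : ℂ).re := by simpa using hb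
  have h1 := GaussianFourier.integral_cexp_neg_mul_sq_norm_add (V := E d) hb' Complex.I ξ
  have h2 := (GaussianFourier.integrable_cexp_neg_mul_sq_norm_add (V := E d) hb'
    Complex.I ξ).mul_const (Complex.exp (β * Complex.I))
  have h3 : ∀ v : E d, Real.exp (-b * ‖v‖ ^ 2) * Real.cos (inner ℝ ξ v + β) =
      RCLike.re (Complex.exp (-b * ‖v‖ ^ 2 + Complex.I * (inner ℝ ξ v : ℝ)) *
        Complex.exp (β * Complex.I)) := by
    intro v
    rw [← Complex.exp_add]
    have : -(b : ℂ) * (‖v‖ : ℂ) ^ 2 + Complex.I * ((inner ℝ ξ v : ℝ) : ℂ) + β * Complex.I =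
        ((-b * ‖v‖ ^ 2 : ℝ) : ℂ) + ((inner ℝ ξ v + β : ℝ) : ℂ) * Complex.I := by
      push_cast; ring
    rw [this, Complex.exp_add, ← Complex.ofReal_exp]
    simp only [RCLike.re_eq_complex_re, Complex.re_ofReal_mul, Complex.exp_ofReal_mul_I_re]
  simp_rw [h3]
  rw [integral_re h2, integral_mul_const, h1, finrank_euclideanSpace_fin]
  have e1 : ((Real.pi : ℂ) / b) ^ ((d : ℂ) / 2) = (((Real.pi / b) ^ ((d : ℝ) / 2) : ℝ) : ℂ) := by
    rw [Complex.ofReal_cpow (by positivity)]; push_cast; rfl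
  have e2 : Complex.exp (Complex.I ^ 2 * (‖ξ‖ : ℂ) ^ 2 / (4 * b)) =
      ((Real.exp (-(‖ξ‖ ^ 2 / (4 * b))) : ℝ) : ℂ) := by
    rw [Complex.ofReal_exp]; congr 1; push_cast; rw [Complex.I_sq]; ring
  rw [e1, e2, ← Complex.ofReal_mul]
  simp only [RCLike.re_eq_complex_re, Complex.re_ofReal_mul, Complex.exp_ofReal_mul_I_re]

/-- The factor `e^{|y|²}` cancels against the density: the transition law is a normal distribution
centred at `e^{-s}x`. -/
theorem gaussianDensity_mul_mehler {s : ℝ} (hs : 0 < s) (x y : E d) :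
    gaussianDensity y * mehler s x y =
      (Real.pi * (1 - Real.exp (-2 * s))) ^ (-((d : ℝ) / 2)) *
        Real.exp (-(1 - Real.exp (-2 * s))⁻¹ * ‖y - Real.exp (-s) • x‖ ^ 2) := by
  have hρ := one_sub_exp_pos hs
  rw [gaussianDensity, mehler, Real.mul_rpow Real.pi_pos.le hρ.le, Real.rpow_neg hρ.le,
    norm_sub_rev y, neg_div]
  have h : Real.exp (-‖y‖ ^ 2) * Real.exp (‖y‖ ^ 2) = 1 := by rw [← Real.exp_add]; simp
  have e : -(1 - Real.exp (-2 * s))⁻¹ * ‖Real.exp (-s) • x - y‖ ^ 2 =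
      -(‖Real.exp (-s) • x - y‖ ^ 2 / (1 - Real.exp (-2 * s))) := by
    rw [div_eq_inv_mul, neg_mul]
  rw [e, mul_mul_mul_comm, mul_comm (Real.exp (-‖y‖ ^ 2)), mul_assoc, mul_assoc]
  rw [mul_comm (Real.exp (‖y‖ ^ 2)), h, mul_one, ← div_eq_inv_mul]

theorem integral_mehler_mul_trig {s : ℝ} (hs : 0 < s) (ξ : E d) (θ : ℝ) (x : E d) :
    ∫ y, mehler s x y * trig ξ θ y ∂(gaussianMeasure d) =
      Real.exp (-((1 - Real.exp (-2 * s)) * ‖ξ‖ ^ 2 / 4)) * trig (Real.exp (-s) • ξ) θ x := by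
  have hρ := one_sub_exp_pos hs
  rw [integral_gaussianMeasure]
  simp_rw [← mul_assoc, gaussianDensity_mul_mehler hs, mul_assoc]
  rw [integral_const_mul, ← integral_add_right_eq_self _ (Real.exp (-s) • x)]
  have e : ∀ v : E d, trig ξ θ (v + Real.exp (-s) • x) =
      Real.cos (inner ℝ ξ v + (inner ℝ (Real.exp (-s) • ξ) x + θ)) := by
    intro v
    rw [trig, inner_add_right, real_inner_smul_right, real_inner_smul_left, add_assoc]
  simp_rw [e, add_sub_cancel_right]
  rw [integral_exp_mul_cos (inv_pos.2 hρ), trig, div_inv_eq_mul, ← mul_assoc, ← mul_assoc,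
    ← Real.rpow_add (by positivity), neg_add_cancel, Real.rpow_zero, one_mul]
  congr 3
  field_simp

theorem integral_mehler {s : ℝ} (hs : 0 < s) (x : E d) :
    ∫ y, mehler s x y ∂(gaussianMeasure d) = 1 := by
  simpa [trig] using integral_mehler_mul_trig hs 0 0 x

theorem mehler_comm (s : ℝ) (hs : 0 < s) (x y : E d) : mehler s x y = mehler s y x := by
  have hρ := one_sub_exp_pos hs
  have key : ∀ x y : E d, -(‖Real.exp (-s) • x - y‖ ^ 2 / (1 - Real.exp (-2 * s))) + ‖y‖ ^ 2 =
      (2 * Real.exp (-s) * inner ℝ x y - Real.exp (-s) ^ 2 * (‖x‖ ^ 2 + ‖y‖ ^ 2)) /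
        (1 - Real.exp (-2 * s)) := by
    intro x y
    rw [norm_sub_sq_real, norm_smul, mul_pow, real_inner_smul_left, Real.norm_eq_abs, sq_abs]
    rw [exp_neg_two_mul] at hρ ⊢
    field_simp
    ring
  rw [mehler, mehler, div_mul_eq_mul_div, div_mul_eq_mul_div, ← Real.exp_add, ← Real.exp_add,
    key, key, real_inner_comm x y, add_comm (‖x‖ ^ 2)]

/-- The positive and negative parts of `h` are densities of two finite measures. Vanishing against
`θ = 0` (cosine) and `θ = -π/2` (sine) says that their characteristic functions agree, so the
measures agree and `h = 0` almost everywhere. -/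
theorem eq_zero_of_inner_trigL2 (h : L2 d) (hh : ∀ ξ θ, inner ℝ h (trigL2 ξ θ) = 0) : h = 0 := by
  have hint : Integrable (fun x => h x) (gaussianMeasure d) :=
    (Lp.memLp h).integrable (by norm_num)
  have hm : AEMeasurable (fun x => h x) (gaussianMeasure d) := hint.aestronglyMeasurable.aemeasurable
  have key : ∀ g : E d → ℝ, Integrable g (gaussianMeasure d) → ∀ ξ,
      charFun ((gaussianMeasure d).withDensity fun x => ENNReal.ofReal (g x)) ξ =
        ∫ x, ((max (g x) 0 : ℝ) : ℂ) * Complex.exp ((inner ℝ x ξ : ℝ) * Complex.I)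
          ∂(gaussianMeasure d) := by
    intro g hg ξ
    rw [charFun_apply, integral_withDensity_eq_integral_toReal_smul₀
      hg.aestronglyMeasurable.aemeasurable.ennreal_ofReal (by simp)]
    simp only [ENNReal.toReal_ofReal', Complex.real_smul]
  have fin1 : IsFiniteMeasure ((gaussianMeasure d).withDensity fun x => ENNReal.ofReal (h x)) :=
    isFiniteMeasure_withDensity_ofReal hint.2
  have fin2 : IsFiniteMeasure ((gaussianMeasure d).withDensity fun x => ENNReal.ofReal (-h x)) :=
    isFiniteMeasure_withDensity_ofReal hint.neg.2
  have hbd : ∀ g : E d → ℝ, Integrable g (gaussianMeasure d) → ∀ ξ, Integrable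
      (fun x => ((g x : ℝ) : ℂ) * Complex.exp ((inner ℝ x ξ : ℝ) * Complex.I))
      (gaussianMeasure d) := by
    intro g hg ξ
    refine hg.ofReal.mul_bdd (c := 1) ?_ (ae_of_all _ fun x => ?_)
    · exact Continuous.aestronglyMeasurable (by fun_prop)
    · rw [Complex.norm_exp_ofReal_mul_I]
  have hμ := Measure.ext_of_charFun (funext fun ξ => by
    rw [key _ hint, key _ hint.neg, ← sub_eq_zero,
      ← integral_sub (hbd _ hint.pos_part ξ) (hbd _ hint.neg.pos_part ξ)]
    have e : ∀ x, ((max (h x) 0 : ℝ) : ℂ) * Complex.exp ((inner ℝ x ξ : ℝ) * Complex.I) -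
        ((max (-h x) 0 : ℝ) : ℂ) * Complex.exp ((inner ℝ x ξ : ℝ) * Complex.I) =
        ((h x * trig ξ 0 x : ℝ) : ℂ) + ((h x * trig ξ (-(Real.pi / 2)) x : ℝ) : ℂ) * Complex.I := by
      intro x
      rw [← sub_mul, ← Complex.ofReal_sub, max_zero_sub_max_neg_zero_eq_self,
        Complex.exp_mul_I, trig, trig, ← sub_eq_add_neg, Real.cos_sub_pi_div_two, add_zero,
        real_inner_comm]
      push_cast; ring
    simp only [Pi.neg_apply, e]
    rw [integral_add (integrable_L2_mul h (memLp_trig ξ _)).ofReal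
      ((integrable_L2_mul h (memLp_trig ξ _)).ofReal.mul_const _), integral_mul_const,
      integral_complex_ofReal, integral_complex_ofReal, ← inner_trigL2, ← inner_trigL2, hh, hh]
    simp :
    charFun ((gaussianMeasure d).withDensity fun x => ENNReal.ofReal (h x)) =
    charFun ((gaussianMeasure d).withDensity fun x => ENNReal.ofReal ((-fun x => h x) x)))
  have h0 := (withDensity_eq_iff hm.ennreal_ofReal hm.neg.ennreal_ofReal
    hint.lintegral_lt_top.ne).1 hμ
  apply Lp.ext
  filter_upwards [h0, Lp.coeFn_zero ℝ 2 (gaussianMeasure d)] with x hx hx0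
  rw [hx0, Pi.zero_apply]
  simp only [Pi.neg_apply] at hx
  rcases le_total 0 (h x) with h1 | h1
  · rw [ENNReal.ofReal_eq_zero.2 (by linarith : -h x ≤ 0), ENNReal.ofReal_eq_zero] at hx
    linarith
  · rw [ENNReal.ofReal_eq_zero.2 h1, eq_comm, ENNReal.ofReal_eq_zero] at hx
    linarith

/-- The linear span of the functions `cos(⟨ξ, x⟩ + θ)`. -/
def trigSpan (d : ℕ) : Submodule ℝ (L2 d) := Submodule.span ℝ {e | ∃ ξ θ, e = trigL2 ξ θ}

theorem dense_trigSpan : Dense (trigSpan d : Set (L2 d)) :=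
  dense_span_of_separating fun h hh =>
    eq_zero_of_inner_trigL2 h fun ξ θ => hh _ ⟨ξ, θ, rfl⟩

theorem trigL2_mem (ξ : E d) (θ : ℝ) : trigL2 ξ θ ∈ trigSpan d :=
  Submodule.subset_span ⟨ξ, θ, rfl⟩

theorem continuousLinearMap_ext_trig {A B : L2 d →L[ℝ] L2 d}
    (h : ∀ ξ θ, A (trigL2 ξ θ) = B (trigL2 ξ θ)) : A = B :=
  ContinuousLinearMap.ext_on dense_trigSpan (by rintro _ ⟨ξ, θ, rfl⟩; exact h ξ θ)

theorem norm_trigL2_sub_le (θ : ℝ) : ∃ c : ℝ, ∀ ξ η : E d,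
    ‖trigL2 ξ θ - trigL2 η θ‖ ≤ c * ‖ξ - η‖ := by
  refine ⟨‖(memLp_norm (d := d)).toLp _‖, fun ξ η => ?_⟩
  rw [mul_comm]
  refine Lp.norm_le_mul_norm_of_ae_le_mul ?_
  filter_upwards [Lp.coeFn_sub (trigL2 ξ θ) (trigL2 η θ), coeFn_trigL2 ξ θ, coeFn_trigL2 η θ,
    (memLp_norm (d := d)).coeFn_toLp] with x h1 h2 h3 h4
  rw [h1, Pi.sub_apply, h2, h3, h4, norm_norm, trig, trig]
  have h5 : ‖Real.cos (inner ℝ ξ x + θ) - Real.cos (inner ℝ η x + θ)‖ ≤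
      ‖(inner ℝ ξ x + θ) - (inner ℝ η x + θ)‖ := by
    exact Real.abs_cos_sub_cos_le _ _
  refine h5.trans ?_
  rw [add_sub_add_right_eq_sub, ← inner_sub_left]
  exact norm_inner_le_norm _ _

/-! ### The Ornstein-Uhlenbeck semigroup -/

/-- The Ornstein-Uhlenbeck semigroup, given by the Mehler kernel. -/
def ouSemigroup (s : ℝ) : L2 d →L[ℝ] L2 d :=
  if hs : 0 < s then (dominated_mehler hs).op else ContinuousLinearMap.id ℝ (L2 d)

theorem ouSemigroup_of_pos {s : ℝ} (hs : 0 < s) (u : L2 d) :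
    ouSemigroup s u = (dominated_mehler hs).apply u := by
  rw [ouSemigroup, dif_pos hs, Dominated.op_apply]

theorem ouSemigroup_zero : ouSemigroup 0 = ContinuousLinearMap.id ℝ (L2 d) := by
  rw [ouSemigroup, dif_neg (lt_irrefl 0)]

theorem ouSemigroup_trigL2 {s : ℝ} (hs : 0 ≤ s) (ξ : E d) (θ : ℝ) :
    ouSemigroup s (trigL2 ξ θ) = Real.exp (-((1 - Real.exp (-2 * s)) * ‖ξ‖ ^ 2 / 4)) •
      trigL2 (Real.exp (-s) • ξ) θ := by
  rcases hs.eq_or_lt with rfl | hs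
  · simp [ouSemigroup_zero]
  · rw [ouSemigroup_of_pos hs]
    apply Lp.ext
    filter_upwards [(dominated_mehler hs).coeFn_apply (trigL2 ξ θ),
      Lp.coeFn_smul (Real.exp (-((1 - Real.exp (-2 * s)) * ‖ξ‖ ^ 2 / 4)))
        (trigL2 (Real.exp (-s) • ξ) θ), coeFn_trigL2 (Real.exp (-s) • ξ) θ] with x h1 h2 h3
    rw [h1, h2, Pi.smul_apply, h3, smul_eq_mul, ← integral_mehler_mul_trig hs]
    refine integral_congr_ae ?_
    filter_upwards [coeFn_trigL2 ξ θ] with y hy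
    rw [hy]

/-- On trigonometric functions the law reduces to `1 - e^{-2(s+r)} = (1 - e^{-2r}) + e^{-2r}(1 -
e^{-2s})`. Density then replaces a Chapman–Kolmogorov integral. -/
theorem ouSemigroup_add {s r : ℝ} (hs : 0 ≤ s) (hr : 0 ≤ r) :
    (ouSemigroup (s + r) : L2 d →L[ℝ] L2 d) = (ouSemigroup s).comp (ouSemigroup r) := by
  refine continuousLinearMap_ext_trig fun ξ θ => ?_
  rw [ContinuousLinearMap.comp_apply, ouSemigroup_trigL2 hr, map_smul, ouSemigroup_trigL2 hs,
    ouSemigroup_trigL2 (add_nonneg hs hr), smul_smul, ← Real.exp_add, smul_smul, ← Real.exp_add,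
    neg_add, norm_smul, mul_pow, Real.norm_eq_abs, sq_abs, ← exp_neg_two_mul]
  congr 2
  have : Real.exp (-2 * (s + r)) = Real.exp (-2 * s) * Real.exp (-2 * r) := by
    rw [← Real.exp_add]; congr 1; ring
  rw [this]; ring

theorem Dominated.apply_congr {k k' : E d → E d → ℝ} (hk : Dominated k) (hk' : Dominated k')
    (h : k = k') (u : L2 d) : hk.apply u = hk'.apply u := by
  subst h; rfl

theorem inner_ouSemigroup_comm {s : ℝ} (hs : 0 ≤ s) (u v : L2 d) :
    inner ℝ (ouSemigroup s u) v = inner ℝ u (ouSemigroup s v) := by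
  rcases hs.eq_or_lt with rfl | hs
  · simp [ouSemigroup_zero]
  · rw [ouSemigroup_of_pos hs, ouSemigroup_of_pos hs, Dominated.inner_apply_swap]
    congr 1
    exact Dominated.apply_congr _ _ (by ext x y; exact mehler_comm s hs y x) v

theorem integrable_mehler_mul_sq {s : ℝ} (hs : 0 < s) (u : L2 d) :
    Integrable (fun p : E d × E d => mehler s p.1 p.2 * u p.2 ^ 2)
      ((gaussianMeasure d).prod (gaussianMeasure d)) ∧
    ∫ p, mehler s p.1 p.2 * u p.2 ^ 2 ∂((gaussianMeasure d).prod (gaussianMeasure d)) =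
      ‖u‖ ^ 2 := by
  have hm : AEStronglyMeasurable (fun p : E d × E d => mehler s p.1 p.2 * u p.2 ^ 2)
      ((gaussianMeasure d).prod (gaussianMeasure d)) :=
    (dominated_mehler hs).cont.aestronglyMeasurable.mul
      ((Lp.aestronglyMeasurable u).comp_snd.pow 2)
  have h1 : ∀ y : E d, ∫ x, mehler s x y * u y ^ 2 ∂(gaussianMeasure d) = u y ^ 2 := by
    intro y
    rw [integral_mul_const]
    simp_rw [fun x => mehler_comm s hs x y]
    rw [integral_mehler hs, one_mul]
  have hu : Integrable (fun y => u y ^ 2) (gaussianMeasure d) := (Lp.memLp u).integrable_sq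
  have h2 : Integrable (fun p : E d × E d => mehler s p.1 p.2 * u p.2 ^ 2)
      ((gaussianMeasure d).prod (gaussianMeasure d)) := by
    rw [integrable_prod_iff' hm]
    refine ⟨ae_of_all _ fun y => ?_, ?_⟩
    · have h : MemLp (fun x => mehler s x y) 2 (gaussianMeasure d) :=
        (dominated_mehler hs).swap.memLp_right y
      have h' : Integrable (fun x => mehler s x y) (gaussianMeasure d) := h.integrable (by norm_num)
      exact h'.mul_const (u y ^ 2)
    · refine hu.congr (ae_of_all _ fun y => ?_)
      refine (h1 y).symm.trans (integral_congr_ae (ae_of_all _ fun x => ?_))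
      dsimp only
      rw [Real.norm_of_nonneg (mul_nonneg (mehler_pos hs x y).le (sq_nonneg _))]
  refine ⟨h2, ?_⟩
  rw [integral_prod_symm _ h2]
  simp_rw [h1]
  rw [← real_inner_self_eq_norm_sq, inner_eq_integral]
  simp_rw [sq]

/-- The kernel is positive, symmetric and of mass one in each variable, so `2uv ≤ u² + v²` under the
double integral bounds `⟨e^{sL}u, v⟩` by `(‖u‖² + ‖v‖²)/2`; then take `v = e^{sL}u`. -/
theorem norm_ouSemigroup_le {s : ℝ} (hs : 0 ≤ s) (u : L2 d) : ‖ouSemigroup s u‖ ≤ ‖u‖ := by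
  rcases hs.eq_or_lt with rfl | hs
  · simp [ouSemigroup_zero]
  have key : ∀ v : L2 d, inner ℝ (ouSemigroup s u) v ≤ (‖u‖ ^ 2 + ‖v‖ ^ 2) / 2 := by
    intro v
    obtain ⟨h1, h2⟩ := integrable_mehler_mul_sq hs u
    obtain ⟨h3, h4⟩ := integrable_mehler_mul_sq hs v
    have h3' : Integrable (fun p : E d × E d => mehler s p.2 p.1 * v p.1 ^ 2)
      ((gaussianMeasure d).prod (gaussianMeasure d)) := h3.swap
    have h4' : ∫ p : E d × E d, mehler s p.2 p.1 * v p.1 ^ 2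
        ∂((gaussianMeasure d).prod (gaussianMeasure d)) = ‖v‖ ^ 2 :=
      (integral_prod_swap (fun p : E d × E d => mehler s p.1 p.2 * v p.2 ^ 2)).trans h4
    rw [ouSemigroup_of_pos hs, Dominated.inner_apply, ← h2, ← h4', ← integral_add h1 h3',
      ← integral_div]
    refine integral_mono ((dominated_mehler hs).integrable_prod u v) ((h1.add h3').div_const 2) ?_
    intro p
    simp only [mehler_comm s hs p.2 p.1]
    linarith [mul_nonneg (mehler_pos hs p.1 p.2).le (sq_nonneg (u p.2 - v p.1))]
  have h := key (ouSemigroup s u)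
  rw [real_inner_self_eq_norm_sq] at h
  exact le_of_sq_le_sq (by linarith) (norm_nonneg _)

/-- The orbits of trigonometric functions are explicit and continuous. Contractivity makes
approximation by them uniform in time. -/
theorem continuousOn_ouSemigroup (f : L2 d) :
    ContinuousOn (fun s => ouSemigroup s f) (Set.Ici 0) := by
  have htrig : ∀ f ∈ trigSpan d, ContinuousOn (fun s => ouSemigroup s f) (Set.Ici 0) := by
    intro f hf
    induction hf using Submodule.span_induction with
    | mem f hf =>
      obtain ⟨ξ, θ, rfl⟩ := hf
      refine ContinuousOn.congr (f := fun s => Real.exp (-((1 - Real.exp (-2 * s)) *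
        ‖ξ‖ ^ 2 / 4)) • trigL2 (Real.exp (-s) • ξ) θ) ?_ fun s hs => ouSemigroup_trigL2 hs ξ θ
      obtain ⟨c, hc⟩ := norm_trigL2_sub_le (d := d) θ
      have h1 : Continuous fun ξ : E d => trigL2 ξ θ :=
        (LipschitzWith.of_dist_le' (K := c) fun ξ η => by
          rw [dist_eq_norm, dist_eq_norm]; exact hc ξ η).continuous
      have h2 : Continuous fun s : ℝ => Real.exp (-((1 - Real.exp (-2 * s)) * ‖ξ‖ ^ 2 / 4)) := by
        fun_prop
      have h3 : Continuous fun s : ℝ => Real.exp (-s) • ξ := by fun_prop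
      exact (h2.smul (h1.comp h3)).continuousOn
    | zero => simpa using continuousOn_const
    | add f g _ _ hf hg => simp only [map_add]; exact hf.add hg
    | smul a f _ hf => simp only [map_smul]; exact hf.const_smul a
  refine continuousOn_of_uniform_approx_of_continuousOn fun u hu => ?_
  obtain ⟨ε, hε, hεu⟩ := Metric.mem_uniformity_dist.1 hu
  obtain ⟨g, hg, hfg⟩ := Metric.dense_iff.1 dense_trigSpan f ε hε
  refine ⟨_, htrig g hfg, fun s hs => hεu ?_⟩
  rw [dist_eq_norm, ← map_sub]
  refine (norm_ouSemigroup_le hs _).trans_lt ?_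
  rwa [← dist_eq_norm, dist_comm]

/-! ### Calculus for the Ornstein-Uhlenbeck expression -/

theorem partialDeriv_mul {φ ψ : E d → ℝ} (j : Fin d) {x : E d} (hφ : DifferentiableAt ℝ φ x)
    (hψ : DifferentiableAt ℝ ψ x) : partialDeriv j (fun x => φ x * ψ x) x =
      partialDeriv j φ x * ψ x + φ x * partialDeriv j ψ x := by
  rw [partialDeriv, fderiv_fun_mul hφ hψ]
  simp [partialDeriv]; ring

theorem partialDeriv_add {φ ψ : E d → ℝ} (j : Fin d) {x : E d} (hφ : DifferentiableAt ℝ φ x)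
    (hψ : DifferentiableAt ℝ ψ x) : partialDeriv j (fun x => φ x + ψ x) x =
      partialDeriv j φ x + partialDeriv j ψ x := by
  rw [partialDeriv, fderiv_fun_add hφ hψ]; rfl

theorem _root_.ContDiff.partialDeriv {φ : E d → ℝ} (hφ : ContDiff ℝ ∞ φ) (j : Fin d) :
    ContDiff ℝ ∞ (partialDeriv j φ) :=
  (hφ.fderiv_right (m := ∞) (by simp)).clm_apply contDiff_const

theorem _root_.ContDiff.differentiable_infty {φ : E d → ℝ} (hφ : ContDiff ℝ ∞ φ) :
    Differentiable ℝ φ := hφ.differentiable (by simp)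

theorem hasCompactSupport_partialDeriv {φ : E d → ℝ} (hφ : HasCompactSupport φ) (j : Fin d) :
    HasCompactSupport (partialDeriv j φ) :=
  (hφ.fderiv ℝ).comp_left (g := fun L : E d →L[ℝ] ℝ => L (EuclideanSpace.single j 1)) rfl

theorem fderiv_apply_eq_sum (φ : E d → ℝ) (x v : E d) :
    fderiv ℝ φ x v = ∑ j, v j * partialDeriv j φ x := by
  conv_lhs => rw [← (EuclideanSpace.basisFun (Fin d) ℝ).sum_repr v]
  simp [partialDeriv]

theorem ouExpr_eq {φ : E d → ℝ} (hφ : ContDiff ℝ ∞ φ) (x : E d) : ouExpr φ x =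
    1 / 2 * ∑ j, partialDeriv j (partialDeriv j φ) x - ∑ j, x j * partialDeriv j φ x := by
  rw [ouExpr, InnerProductSpace.laplacian_eq_iteratedFDeriv_orthonormalBasis φ
    (EuclideanSpace.basisFun (Fin d) ℝ), real_inner_comm, gradient,
    InnerProductSpace.toDual_symm_apply, fderiv_apply_eq_sum]
  congr 2
  refine Finset.sum_congr rfl fun j _ => ?_
  rw [iteratedFDeriv_two_apply]
  change _ = fderiv ℝ (fun y => fderiv ℝ φ y (EuclideanSpace.single j 1)) x
    (EuclideanSpace.single j 1)
  rw [fderiv_clm_apply ((hφ.fderiv_right (m := ∞) (by simp)).differentiable (by simp) x)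
    (differentiableAt_const _)]
  simp

theorem continuous_ouExpr {φ : E d → ℝ} (hφ : ContDiff ℝ ∞ φ) : Continuous (ouExpr φ) := by
  rw [funext (ouExpr_eq hφ)]
  have h1 := fun j => (hφ.partialDeriv j).continuous
  have h2 := fun j => ((hφ.partialDeriv j).partialDeriv j).continuous
  fun_prop

theorem ouExpr_mul {φ ψ : E d → ℝ} (hφ : ContDiff ℝ ∞ φ) (hψ : ContDiff ℝ ∞ ψ) (x : E d) :
    ouExpr (fun x => φ x * ψ x) x = φ x * ouExpr ψ x + ψ x * ouExpr φ x +
      ∑ j, partialDeriv j φ x * partialDeriv j ψ x := by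
  rw [ouExpr_eq (hφ.mul hψ), ouExpr_eq hφ, ouExpr_eq hψ]
  have h1 : ∀ j, partialDeriv j (fun x => φ x * ψ x) = fun x =>
      partialDeriv j φ x * ψ x + φ x * partialDeriv j ψ x := fun j => funext fun x =>
    partialDeriv_mul j (hφ.differentiable_infty x) (hψ.differentiable_infty x)
  have h2 : ∀ j, partialDeriv j (partialDeriv j (fun x => φ x * ψ x)) x =
      partialDeriv j (partialDeriv j φ) x * ψ x + φ x * partialDeriv j (partialDeriv j ψ) x +
        2 * (partialDeriv j φ x * partialDeriv j ψ x) := by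
    intro j
    have a1 := (hφ.partialDeriv j)
    have a2 := (hψ.partialDeriv j)
    rw [h1, partialDeriv_add j ((a1.mul hψ).differentiable_infty x)
      ((hφ.mul a2).differentiable_infty x), partialDeriv_mul j (a1.differentiable_infty x)
      (hψ.differentiable_infty x), partialDeriv_mul j (hφ.differentiable_infty x)
      (a2.differentiable_infty x)]
    ring
  rw [Finset.sum_congr rfl fun j _ => h2 j]
  simp only [h1, Finset.sum_add_distrib, ← Finset.mul_sum, ← Finset.sum_mul, mul_add]
  have h3 : ∑ j, x j * (partialDeriv j φ x * ψ x) = (∑ j, x j * partialDeriv j φ x) * ψ x := by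
    rw [Finset.sum_mul]; exact Finset.sum_congr rfl fun j _ => by ring
  have h4 : ∑ j, x j * (φ x * partialDeriv j ψ x) = φ x * ∑ j, x j * partialDeriv j ψ x := by
    rw [Finset.mul_sum]; exact Finset.sum_congr rfl fun j _ => by ring
  rw [h3, h4]; ring

/-! ### Integration by parts for test functions -/

theorem IsTestFunction.bounded {φ : E d → ℝ} (hφ : Continuous φ) (h : HasCompactSupport φ) :
    ∃ c, ∀ x, |φ x| ≤ c := by
  obtain ⟨c, hc⟩ := h.exists_bound_of_continuous hφ
  exact ⟨c, hc⟩

theorem memLp_of_hasCompactSupport {φ : E d → ℝ} (hφ : Continuous φ) (h : HasCompactSupport φ) :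
    MemLp φ 2 (gaussianMeasure d) := by
  obtain ⟨c, hc⟩ := IsTestFunction.bounded hφ h
  exact memLp_of_bounded hφ hc

theorem IsTestFunction.memLp {φ : E d → ℝ} (h : IsTestFunction φ) :
    MemLp φ 2 (gaussianMeasure d) := memLp_of_hasCompactSupport h.1.continuous h.2

theorem IsTestFunction.memLp_ouExpr {φ : E d → ℝ} (h : IsTestFunction φ) :
    MemLp (ouExpr φ) 2 (gaussianMeasure d) := by
  refine memLp_of_hasCompactSupport (continuous_ouExpr h.1) ?_
  refine HasCompactSupport.of_support_subset_isCompact h.2 ?_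
  intro x hx
  by_contra hx'
  refine hx ?_
  have h1 : ∀ {ψ : E d → ℝ}, x ∉ tsupport ψ → ∀ j, x ∉ tsupport (partialDeriv j ψ) := by
    intro ψ hψ j hj
    refine hψ (tsupport_fderiv_subset ℝ (closure_mono (fun y hy => ?_) hj))
    intro hy'
    refine hy ?_
    rw [partialDeriv, hy']; rfl
  rw [ouExpr_eq h.1]
  have h2 : ∀ j, partialDeriv j φ x = 0 := fun j => image_eq_zero_of_notMem_tsupport (h1 hx' j)
  have h3 : ∀ j, partialDeriv j (partialDeriv j φ) x = 0 := fun j =>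
    image_eq_zero_of_notMem_tsupport (h1 (h1 hx' j) j)
  simp [h2, h3]

theorem contDiff_gaussianDensity : ContDiff ℝ ∞ (gaussianDensity : E d → ℝ) := by
  unfold gaussianDensity
  exact contDiff_const.mul (ContDiff.norm_sq ℝ contDiff_id).neg.exp

theorem partialDeriv_gaussianDensity (j : Fin d) (x : E d) :
    partialDeriv j gaussianDensity x = -2 * x j * gaussianDensity x := by
  refine partialDeriv_eq_of_hasDerivAt (contDiff_gaussianDensity.differentiable_infty x) ?_
  unfold gaussianDensity
  have h1 : HasDerivAt (fun h : ℝ => ‖x + h • EuclideanSpace.single j (1 : ℝ)‖ ^ 2)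
      (2 * x j) 0 := by
    have := (((hasDerivAt_id (0 : ℝ)).smul_const (EuclideanSpace.single j (1 : ℝ))).const_add
      x).norm_sq
    simpa [EuclideanSpace.inner_single_right] using this
  refine (h1.neg.exp.const_mul _).congr_deriv ?_
  simp; ring

/-- Divergence form: the density times `ouExpr ψ` is `½ ∑ ∂_j(G_j)`, where `G_j` is the density
times `∂_jψ`. The drift is exactly what differentiating the density produces. -/
theorem integral_mul_ouExpr {φ ψ : E d → ℝ} (hφ : ContDiff ℝ ∞ φ) (hψ : IsTestFunction ψ) :
    ∫ x, φ x * ouExpr ψ x ∂(gaussianMeasure d) =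
      -(1 / 2) * ∑ j, ∫ x, gaussianDensity x * (partialDeriv j φ x * partialDeriv j ψ x) := by
  rw [integral_gaussianMeasure]
  set G : Fin d → E d → ℝ := fun j x => gaussianDensity x * partialDeriv j ψ x with hG
  have hGs : ∀ j, ContDiff ℝ ∞ (G j) := fun j =>
    contDiff_gaussianDensity.mul (hψ.1.partialDeriv j)
  have hGc : ∀ j, HasCompactSupport (G j) := fun j =>
    (hasCompactSupport_partialDeriv hψ.2 j).mul_left
  have hint : ∀ {f g : E d → ℝ}, Continuous f → Continuous g → HasCompactSupport g →
      Integrable (fun x => f x * g x) := fun hf hg hgc =>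
    (hf.mul hg).integrable_of_hasCompactSupport hgc.mul_left
  have h1 : ∀ x, gaussianDensity x * (φ x * ouExpr ψ x) =
      1 / 2 * ∑ j, φ x * partialDeriv j (G j) x := by
    intro x
    rw [ouExpr_eq hψ.1]
    have : ∀ j, partialDeriv j (G j) x = -2 * x j * gaussianDensity x * partialDeriv j ψ x +
        gaussianDensity x * partialDeriv j (partialDeriv j ψ) x := fun j => by
      rw [hG, partialDeriv_mul j (contDiff_gaussianDensity.differentiable_infty x)
        ((hψ.1.partialDeriv j).differentiable_infty x), partialDeriv_gaussianDensity]
    simp only [this]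
    rw [← Finset.mul_sum, Finset.sum_add_distrib, ← Finset.mul_sum]
    have e : ∑ j, -2 * x j * gaussianDensity x * partialDeriv j ψ x =
        -2 * gaussianDensity x * ∑ j, x j * partialDeriv j ψ x := by
      rw [Finset.mul_sum]; exact Finset.sum_congr rfl fun j _ => by ring
    rw [e]; ring
  simp_rw [h1]
  rw [integral_const_mul, integral_finsetSum]
  · have h2 : ∀ j, ∫ x, φ x * partialDeriv j (G j) x =
        -∫ x, gaussianDensity x * (partialDeriv j φ x * partialDeriv j ψ x) := by
      intro j
      have h3 := integral_mul_fderiv_eq_neg_fderiv_mul_of_integrable (μ := volume)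
        (f := φ) (g := G j) (v := EuclideanSpace.single j 1)
        (hint (hφ.partialDeriv j).continuous (hGs j).continuous (hGc j))
        (hint hφ.continuous ((hGs j).partialDeriv j).continuous
          (hasCompactSupport_partialDeriv (hGc j) j))
        (hint hφ.continuous (hGs j).continuous (hGc j))
        (fun x _ => hφ.differentiable_infty x) (fun x _ => (hGs j).differentiable_infty x)
      refine h3.trans ?_
      congr 2; ext x
      simp only [hG, partialDeriv]; ring
    simp_rw [h2]
    rw [Finset.sum_neg_distrib]; ring
  · intro j _
    exact hint hφ.continuous ((hGs j).partialDeriv j).continuous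
      (hasCompactSupport_partialDeriv (hGc j) j)

theorem integral_mul_ouExpr_comm {φ ψ : E d → ℝ} (hφ : IsTestFunction φ) (hψ : IsTestFunction ψ) :
    ∫ x, φ x * ouExpr ψ x ∂(gaussianMeasure d) = ∫ x, ouExpr φ x * ψ x ∂(gaussianMeasure d) := by
  rw [integral_mul_ouExpr hφ.1 hψ]
  simp_rw [mul_comm (ouExpr φ _)]
  rw [integral_mul_ouExpr hψ.1 hφ]
  simp_rw [mul_comm (partialDeriv _ ψ _)]

/-! ### Cutoff functions -/

/-- A cutoff function at scale `1/ε`. -/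
def cutoff (ε : ℝ) (x : E d) : ℝ :=
  (⟨1, 2, one_pos, one_lt_two⟩ : ContDiffBump (0 : E d)) (ε • x)

theorem contDiff_cutoff (ε : ℝ) : ContDiff ℝ ∞ (cutoff ε : E d → ℝ) :=
  (ContDiffBump.contDiff _).comp (contDiff_const_smul ε)

theorem cutoff_eq (ε : ℝ) (x : E d) : cutoff ε x = cutoff 1 (ε • x) := by
  simp [cutoff]

theorem hasCompactSupport_cutoff {ε : ℝ} (hε : ε ≠ 0) :
    HasCompactSupport (cutoff ε : E d → ℝ) :=
  (ContDiffBump.hasCompactSupport _).comp_smul hε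

theorem abs_cutoff_le (ε : ℝ) (x : E d) : |cutoff ε x| ≤ 1 := by
  rw [cutoff, abs_of_nonneg (ContDiffBump.nonneg _)]
  exact ContDiffBump.le_one _

theorem cutoff_zero : cutoff 1 (0 : E d) = 1 := by
  simp only [cutoff, smul_zero]
  exact ContDiffBump.one_of_mem_closedBall _ (by simp)

theorem partialDeriv_comp_smul (j : Fin d) (ε : ℝ) {φ : E d → ℝ} (hφ : Differentiable ℝ φ)
    (x : E d) : partialDeriv j (fun x => φ (ε • x)) x = ε * partialDeriv j φ (ε • x) := by
  have h : HasFDerivAt (fun x : E d => φ (ε • x))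
      ((fderiv ℝ φ (ε • x)).comp (ε • ContinuousLinearMap.id ℝ (E d))) x :=
    (hφ (ε • x)).hasFDerivAt.comp x ((hasFDerivAt_id x).const_smul ε)
  rw [partialDeriv, h.fderiv]
  simp [partialDeriv]

theorem partialDeriv_cutoff (j : Fin d) (ε : ℝ) :
    partialDeriv j (cutoff ε : E d → ℝ) = fun x => ε * partialDeriv j (cutoff 1) (ε • x) := by
  ext x
  rw [funext (cutoff_eq ε), partialDeriv_comp_smul j ε (contDiff_cutoff 1).differentiable_infty]

theorem partialDeriv_const_mul (j : Fin d) (a : ℝ) {φ : E d → ℝ} {x : E d}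
    (hφ : DifferentiableAt ℝ φ x) :
    partialDeriv j (fun x => a * φ x) x = a * partialDeriv j φ x := by
  rw [partialDeriv, fderiv_const_mul hφ]; rfl

theorem ouExpr_cutoff (ε : ℝ) (x : E d) : ouExpr (cutoff ε : E d → ℝ) x =
    ε ^ 2 * (1 / 2 * ∑ j, partialDeriv j (partialDeriv j (cutoff 1)) (ε • x)) -
      ∑ j, (ε • x) j * partialDeriv j (cutoff 1) (ε • x) := by
  rw [ouExpr_eq (contDiff_cutoff ε)]
  have h : ∀ j, partialDeriv j (partialDeriv j (cutoff ε : E d → ℝ)) x =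
      ε ^ 2 * partialDeriv j (partialDeriv j (cutoff 1)) (ε • x) := by
    intro j
    have h1 := ((contDiff_cutoff (d := d) 1).partialDeriv j)
    have h2 : DifferentiableAt ℝ (fun x : E d => partialDeriv j (cutoff 1) (ε • x)) x :=
      (h1.comp (contDiff_const_smul ε)).differentiable_infty x
    rw [partialDeriv_cutoff, partialDeriv_const_mul j ε h2,
      partialDeriv_comp_smul j ε h1.differentiable_infty]
    ring
  rw [Finset.sum_congr rfl fun j _ => h j]
  simp only [fun j => partialDeriv_cutoff (d := d) j ε, ← Finset.mul_sum]
  have h2 : ∑ j, x j * (ε * partialDeriv j (cutoff 1) (ε • x)) =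
      ∑ j, (ε • x) j * partialDeriv j (cutoff 1) (ε • x) :=
    Finset.sum_congr rfl fun j _ => by simp; ring
  rw [h2]; ring

/-- The unbounded drift does no harm: `⟨x, ∇(χ(εx))⟩ = ⟨εx, (∇χ)(εx)⟩` is a fixed compactly
supported function evaluated at `εx`. -/
theorem exists_cutoff_bound : ∃ c : ℝ, 0 ≤ c ∧ ∀ ε : ℝ, 0 ≤ ε → ε ≤ 1 → ∀ x : E d,
    (∀ j, |partialDeriv j (cutoff ε) x| ≤ c * ε) ∧ |ouExpr (cutoff ε) x| ≤ c := by
  have hc := hasCompactSupport_cutoff (d := d) one_ne_zero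
  have hs := contDiff_cutoff (d := d) 1
  have h1 : ∀ j, ∃ c, ∀ x : E d, |partialDeriv j (cutoff 1) x| ≤ c := fun j =>
    IsTestFunction.bounded (hs.partialDeriv j).continuous (hasCompactSupport_partialDeriv hc j)
  have h2 : ∀ j, ∃ c, ∀ x : E d, |partialDeriv j (partialDeriv j (cutoff 1)) x| ≤ c := fun j =>
    IsTestFunction.bounded ((hs.partialDeriv j).partialDeriv j).continuous
      (hasCompactSupport_partialDeriv (hasCompactSupport_partialDeriv hc j) j)
  have h3 : ∀ j, ∃ c, ∀ x : E d, |x j * partialDeriv j (cutoff 1) x| ≤ c := fun j =>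
    IsTestFunction.bounded (Continuous.mul (by fun_prop) (hs.partialDeriv j).continuous)
      (hasCompactSupport_partialDeriv hc j).mul_left
  choose c1 hc1 using h1
  choose c2 hc2 using h2
  choose c3 hc3 using h3
  have p1 := fun j => (abs_nonneg _).trans (hc1 j 0)
  have p2 := fun j => (abs_nonneg _).trans (hc2 j 0)
  have p3 := fun j => (abs_nonneg _).trans (hc3 j 0)
  refine ⟨∑ j, (c1 j + c2 j + c3 j), Finset.sum_nonneg fun j _ =>
    add_nonneg (add_nonneg (p1 j) (p2 j)) (p3 j), fun ε hε0 hε1 x => ⟨fun j => ?_, ?_⟩⟩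
  · rw [partialDeriv_cutoff, abs_mul, abs_of_nonneg hε0, mul_comm]
    refine mul_le_mul_of_nonneg_right ((hc1 j _).trans ?_) hε0
    refine le_trans ?_ (Finset.single_le_sum (f := fun j => c1 j + c2 j + c3 j)
      (fun j _ => add_nonneg (add_nonneg (p1 j) (p2 j)) (p3 j)) (Finset.mem_univ j))
    dsimp only
    linarith [p2 j, p3 j]
  · rw [ouExpr_cutoff]
    refine (abs_sub _ _).trans ?_
    have e1 : |ε ^ 2 * (1 / 2 * ∑ j, partialDeriv j (partialDeriv j (cutoff 1)) (ε • x))| ≤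
        ∑ j, c2 j := by
      rw [abs_mul, abs_mul, abs_of_nonneg (sq_nonneg ε), abs_of_pos (one_half_pos (α := ℝ))]
      have e2 : |∑ j, partialDeriv j (partialDeriv j (cutoff 1)) (ε • x)| ≤ ∑ j, c2 j :=
        (Finset.abs_sum_le_sum_abs _ _).trans (Finset.sum_le_sum fun j _ => hc2 j _)
      have e3 : ε ^ 2 ≤ 1 := pow_le_one₀ hε0 hε1
      nlinarith [abs_nonneg (∑ j, partialDeriv j (partialDeriv j (cutoff 1)) (ε • x)),
        sq_nonneg ε]
    have e4 : |∑ j, (ε • x) j * partialDeriv j (cutoff 1) (ε • x)| ≤ ∑ j, c3 j :=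
      (Finset.abs_sum_le_sum_abs _ _).trans (Finset.sum_le_sum fun j _ => hc3 j _)
    rw [Finset.sum_add_distrib, Finset.sum_add_distrib]
    have e5 : 0 ≤ ∑ j, c1 j := Finset.sum_nonneg fun j _ => p1 j
    linarith

/-- The scales `1/(n+1)`. -/
def scale (n : ℕ) : ℝ := 1 / ((n : ℝ) + 1)

theorem scale_pos (n : ℕ) : 0 < scale n := Nat.one_div_pos_of_nat

theorem scale_le_one (n : ℕ) : scale n ≤ 1 := by
  rw [scale, div_le_one (by positivity)]; linarith [(Nat.cast_nonneg n : (0 : ℝ) ≤ n)]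

theorem tendsto_scale : Tendsto scale atTop (𝓝 0) := tendsto_one_div_add_atTop_nhds_zero_nat

theorem tendsto_scale_smul (x : E d) : Tendsto (fun n => scale n • x) atTop (𝓝 0) := by
  simpa using tendsto_scale.smul_const x

theorem tendsto_cutoff (x : E d) : Tendsto (fun n => cutoff (scale n) x) atTop (𝓝 1) := by
  simp_rw [fun n => cutoff_eq (scale n) x]
  have h := ((contDiff_cutoff (d := d) 1).continuous.tendsto 0).comp (tendsto_scale_smul x)
  rwa [cutoff_zero] at h

theorem tendsto_partialDeriv_cutoff (j : Fin d) (x : E d) :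
    Tendsto (fun n => partialDeriv j (cutoff (scale n)) x) atTop (𝓝 0) := by
  simp_rw [fun n => partialDeriv_cutoff (d := d) j (scale n)]
  have h := (((contDiff_cutoff (d := d) 1).partialDeriv j).continuous.tendsto 0).comp
    (tendsto_scale_smul x)
  simpa using tendsto_scale.mul h

theorem tendsto_ouExpr_cutoff (x : E d) :
    Tendsto (fun n => ouExpr (cutoff (scale n)) x) atTop (𝓝 0) := by
  simp_rw [ouExpr_cutoff]
  have hs := contDiff_cutoff (d := d) 1
  have hcont : Continuous fun p : ℝ × E d =>
      p.1 ^ 2 * (1 / 2 * ∑ j, partialDeriv j (partialDeriv j (cutoff 1)) p.2) -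
      ∑ j, p.2 j * partialDeriv j (cutoff 1) p.2 := by
    have h1 := fun j => (hs.partialDeriv j).continuous
    have h2 := fun j => ((hs.partialDeriv j).partialDeriv j).continuous
    fun_prop
  have h := (hcont.tendsto (0, 0)).comp (tendsto_scale.prodMk_nhds (tendsto_scale_smul x))
  simpa [Function.comp_def] using h

theorem isTestFunction_cutoff_mul {φ : E d → ℝ} (hφ : ContDiff ℝ ∞ φ) (n : ℕ) :
    IsTestFunction fun x => cutoff (scale n) x * φ x :=
  ⟨(contDiff_cutoff _).mul hφ, (hasCompactSupport_cutoff (scale_pos n).ne').mul_right⟩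

theorem tendsto_integral_cutoff_mul (g : L2 d) {φ : E d → ℝ}
    (hφ2 : MemLp φ 2 (gaussianMeasure d)) :
    Tendsto (fun n => ∫ x, g x * (cutoff (scale n) x * φ x) ∂(gaussianMeasure d)) atTop
      (𝓝 (∫ x, g x * φ x ∂(gaussianMeasure d))) := by
  refine tendsto_integral_of_dominated_convergence (fun x => ‖g x * φ x‖) (fun n => ?_)
    (integrable_L2_mul g hφ2).norm (fun n => ae_of_all _ fun x => ?_) (ae_of_all _ fun x => ?_)
  · exact (Lp.aestronglyMeasurable g).mul
      ((contDiff_cutoff _).continuous.aestronglyMeasurable.mul hφ2.1)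
  · rw [norm_mul, norm_mul, norm_mul]
    exact mul_le_mul_of_nonneg_left (mul_le_of_le_one_left (norm_nonneg _) (abs_cutoff_le _ _))
      (norm_nonneg _)
  · simpa using ((tendsto_cutoff x).mul_const (φ x)).const_mul (g x)

/-- The definition is tested on cutoff times `φ`. By the product rule the extra terms carry
derivatives of the cutoff, which are bounded and tend to `0` pointwise, so dominated convergence
applies. It is needed for trigonometric functions, which lack compact support. -/
theorem ouOp.integral_eq {f g : L2 d} (h : ouOp f g) {φ : E d → ℝ} (hφ : ContDiff ℝ ∞ φ)
    (hφ2 : MemLp φ 2 (gaussianMeasure d)) (hd : ∀ j, MemLp (partialDeriv j φ) 2 (gaussianMeasure d))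
    (hL : MemLp (ouExpr φ) 2 (gaussianMeasure d)) :
    ∫ x, f x * ouExpr φ x ∂(gaussianMeasure d) = ∫ x, g x * φ x ∂(gaussianMeasure d) := by
  obtain ⟨c, hc0, hc⟩ := exists_cutoff_bound (d := d)
  refine tendsto_nhds_unique ?_ (tendsto_integral_cutoff_mul g hφ2)
  simp_rw [fun n => (h _ (isTestFunction_cutoff_mul hφ n)).symm,
    fun n => ouExpr_mul (contDiff_cutoff (d := d) (scale n)) hφ]
  refine tendsto_integral_of_dominated_convergence
    (fun x => |f x * ouExpr φ x| + c * |f x * φ x| + c * ∑ j, |f x * partialDeriv j φ x|)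
    (fun n => ?_) ?_ (fun n => ae_of_all _ fun x => ?_) (ae_of_all _ fun x => ?_)
  · refine (Lp.aestronglyMeasurable f).mul (Continuous.aestronglyMeasurable ?_)
    have h1 := (contDiff_cutoff (d := d) (scale n)).continuous
    have h2 := continuous_ouExpr (contDiff_cutoff (d := d) (scale n))
    have h3 := continuous_ouExpr hφ
    have h4 := hφ.continuous
    have h5 := fun j => (hφ.partialDeriv j).continuous
    have h6 := fun j => ((contDiff_cutoff (d := d) (scale n)).partialDeriv j).continuous
    fun_prop
  · refine ((integrable_L2_mul f hL).abs.add ((integrable_L2_mul f hφ2).abs.const_mul c)).add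
      (Integrable.const_mul ?_ c)
    exact integrable_finsetSum _ fun j _ => (integrable_L2_mul f (hd j)).abs
  · obtain ⟨h1, h2⟩ := hc (scale n) (scale_pos n).le (scale_le_one n) x
    have h3 := abs_cutoff_le (scale n) x
    have h4 : |∑ j, partialDeriv j (cutoff (scale n)) x * partialDeriv j φ x| ≤
        c * ∑ j, |partialDeriv j φ x| := by
      rw [Finset.mul_sum]
      refine (Finset.abs_sum_le_sum_abs _ _).trans (Finset.sum_le_sum fun j _ => ?_)
      rw [abs_mul]
      refine mul_le_mul_of_nonneg_right ((h1 j).trans ?_) (abs_nonneg _)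
      exact mul_le_of_le_one_right hc0 (scale_le_one n)
    rw [Real.norm_eq_abs, abs_mul]
    simp only [abs_mul (f x), ← Finset.mul_sum]
    have h5 : |cutoff (scale n) x * ouExpr φ x + φ x * ouExpr (cutoff (scale n)) x +
        ∑ j, partialDeriv j (cutoff (scale n)) x * partialDeriv j φ x| ≤
        |ouExpr φ x| + c * |φ x| + c * ∑ j, |partialDeriv j φ x| := by
      refine (abs_add_le _ _).trans (add_le_add ((abs_add_le _ _).trans (add_le_add ?_ ?_)) h4)
      · rw [abs_mul]; exact mul_le_of_le_one_left (abs_nonneg _) h3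
      · rw [abs_mul, mul_comm]; exact mul_le_mul_of_nonneg_right h2 (abs_nonneg _)
    refine (mul_le_mul_of_nonneg_left h5 (abs_nonneg _)).trans_eq (by ring)
  · have h1 := ((tendsto_cutoff x).mul_const (ouExpr φ x)).add
      ((tendsto_ouExpr_cutoff x).const_mul (φ x))
    have h2 : Tendsto (fun n => ∑ j, partialDeriv j (cutoff (scale n)) x * partialDeriv j φ x)
        atTop (𝓝 (∑ j, 0 * partialDeriv j φ x)) :=
      tendsto_finsetSum _ fun j _ => (tendsto_partialDeriv_cutoff j x).mul_const _
    simpa using (h1.add h2).const_mul (f x)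

/-- The same cutoff argument; it is applied with `φ = K(x, ·)` to move `∂_j^*` onto the kernel. -/
theorem partialAdj.integral_eq {j : Fin d} {f g : L2 d} (h : partialAdj j f g) {φ : E d → ℝ}
    (hφ : ContDiff ℝ ∞ φ) (hφ2 : MemLp φ 2 (gaussianMeasure d))
    (hd : MemLp (partialDeriv j φ) 2 (gaussianMeasure d)) :
    ∫ x, f x * partialDeriv j φ x ∂(gaussianMeasure d) = ∫ x, g x * φ x ∂(gaussianMeasure d) := by
  obtain ⟨c, hc0, hc⟩ := exists_cutoff_bound (d := d)
  refine tendsto_nhds_unique ?_ (tendsto_integral_cutoff_mul g hφ2)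
  simp_rw [fun n => (h _ (isTestFunction_cutoff_mul hφ n)).symm, fun n x =>
    partialDeriv_mul j (((contDiff_cutoff (d := d) (scale n))).differentiable_infty x)
      (hφ.differentiable_infty x)]
  refine tendsto_integral_of_dominated_convergence
    (fun x => c * |f x * φ x| + |f x * partialDeriv j φ x|)
    (fun n => ?_) ?_ (fun n => ae_of_all _ fun x => ?_) (ae_of_all _ fun x => ?_)
  · refine (Lp.aestronglyMeasurable f).mul (Continuous.aestronglyMeasurable ?_)
    have h1 := (contDiff_cutoff (d := d) (scale n)).continuous
    have h4 := hφ.continuous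
    have h5 := (hφ.partialDeriv j).continuous
    have h6 := ((contDiff_cutoff (d := d) (scale n)).partialDeriv j).continuous
    fun_prop
  · exact ((integrable_L2_mul f hφ2).abs.const_mul c).add (integrable_L2_mul f hd).abs
  · have h1 := ((hc (scale n) (scale_pos n).le (scale_le_one n) x).1 j).trans
      (mul_le_of_le_one_right hc0 (scale_le_one n))
    have h3 := abs_cutoff_le (scale n) x
    rw [Real.norm_eq_abs, abs_mul, abs_mul, abs_mul]
    have h5 : |partialDeriv j (cutoff (scale n)) x * φ x + cutoff (scale n) x * partialDeriv j φ x|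
        ≤ c * |φ x| + |partialDeriv j φ x| := by
      refine (abs_add_le _ _).trans (add_le_add ?_ ?_)
      · rw [abs_mul]; exact mul_le_mul_of_nonneg_right h1 (abs_nonneg _)
      · rw [abs_mul]; exact mul_le_of_le_one_left (abs_nonneg _) h3
    refine (mul_le_mul_of_nonneg_left h5 (abs_nonneg _)).trans_eq (by ring)
  · have h1 := ((tendsto_partialDeriv_cutoff j x).mul_const (φ x)).add
      ((tendsto_cutoff x).mul_const (partialDeriv j φ x))
    simpa using h1.const_mul (f x)

/-! ### The generator of the semigroup -/

theorem partialDeriv_trig (j : Fin d) (ξ : E d) (θ : ℝ) :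
    partialDeriv j (trig ξ θ) = fun x => ξ j * trig ξ (θ + Real.pi / 2) x := by
  ext x
  refine partialDeriv_eq_of_hasDerivAt ((contDiff_trig ξ θ).differentiable_infty x) ?_
  have h1 : HasDerivAt (fun h : ℝ => inner ℝ ξ (x + h • EuclideanSpace.single j (1 : ℝ)) + θ)
      (ξ j) 0 := by
    have := (((hasDerivAt_id (0 : ℝ)).mul_const (ξ j)).const_add (inner ℝ ξ x + θ))
    rw [one_mul] at this
    refine this.congr_of_eventuallyEq (Eventually.of_forall fun h => ?_)
    simp [inner_add_right, real_inner_smul_right, EuclideanSpace.inner_single_right]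
    ring
  refine h1.cos.congr_deriv ?_
  rw [trig, ← add_assoc, Real.cos_add_pi_div_two]
  simp; ring

theorem ouExpr_trig (ξ : E d) (θ : ℝ) (x : E d) : ouExpr (trig ξ θ) x =
    -(‖ξ‖ ^ 2 / 2) * trig ξ θ x - inner ℝ ξ x * trig ξ (θ + Real.pi / 2) x := by
  rw [ouExpr_eq (contDiff_trig ξ θ)]
  have h1 : ∀ j, partialDeriv j (partialDeriv j (trig ξ θ)) x = ξ j ^ 2 * -trig ξ θ x := by
    intro j
    rw [partialDeriv_trig, partialDeriv_const_mul j _ ((contDiff_trig ξ _).differentiable_infty x),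
      partialDeriv_trig]
    simp only [trig]
    rw [add_assoc θ, add_halves, ← add_assoc, Real.cos_add_pi]
    ring
  rw [Finset.sum_congr rfl fun j _ => h1 j]
  simp only [ ← Finset.sum_mul, partialDeriv_trig, ← EuclideanSpace.real_norm_sq_eq]
  have h2 : ∑ j, x j * (ξ j * trig ξ (θ + Real.pi / 2) x) =
      inner ℝ ξ x * trig ξ (θ + Real.pi / 2) x := by
    rw [PiLp.inner_apply, Finset.sum_mul]
    refine Finset.sum_congr rfl fun j _ => ?_
    simp; ring
  rw [h2]; ring

theorem memLp_partialDeriv_trig (j : Fin d) (ξ : E d) (θ : ℝ) :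
    MemLp (partialDeriv j (trig ξ θ)) 2 (gaussianMeasure d) := by
  rw [partialDeriv_trig]
  exact (memLp_trig ξ _).const_mul _

theorem memLp_ouExpr_trig (ξ : E d) (θ : ℝ) :
    MemLp (ouExpr (trig ξ θ)) 2 (gaussianMeasure d) := by
  refine (memLp_const_add_norm (‖ξ‖ ^ 2 / 2) ‖ξ‖).mono'
    (continuous_ouExpr (contDiff_trig ξ θ)).aestronglyMeasurable (ae_of_all _ fun x => ?_)
  rw [ouExpr_trig, Real.norm_eq_abs]
  refine (abs_sub _ _).trans (add_le_add ?_ ?_)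
  · rw [abs_mul, abs_neg, abs_of_nonneg (by positivity)]
    exact mul_le_of_le_one_right (by positivity) (abs_trig_le _ _ _)
  · rw [abs_mul]
    exact (mul_le_of_le_one_right (abs_nonneg _) (abs_trig_le _ _ _)).trans
      (abs_real_inner_le_norm _ _)

/-- The function `e^{hL} cos(⟨ξ, ·⟩ + θ)`. -/
def trigFlow (ξ : E d) (θ h : ℝ) (x : E d) : ℝ :=
  Real.exp (-((1 - Real.exp (-2 * h)) * ‖ξ‖ ^ 2 / 4)) *
    Real.cos (Real.exp (-h) * inner ℝ ξ x + θ)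

/-- The derivative in time of `trigFlow`. -/
def trigFlowDeriv (ξ : E d) (θ h : ℝ) (x : E d) : ℝ :=
  Real.exp (-((1 - Real.exp (-2 * h)) * ‖ξ‖ ^ 2 / 4)) *
    (-(Real.exp (-h) ^ 2 * ‖ξ‖ ^ 2 / 2) * Real.cos (Real.exp (-h) * inner ℝ ξ x + θ) +
      Real.exp (-h) * inner ℝ ξ x * Real.sin (Real.exp (-h) * inner ℝ ξ x + θ))

theorem continuous_trigFlow (ξ : E d) (θ h : ℝ) : Continuous (trigFlow ξ θ h) := by
  unfold trigFlow; fun_prop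

theorem continuous_trigFlowDeriv (ξ : E d) (θ h : ℝ) : Continuous (trigFlowDeriv ξ θ h) := by
  unfold trigFlowDeriv; fun_prop

theorem hasDerivAt_trigFlow (ξ : E d) (θ h : ℝ) (x : E d) :
    HasDerivAt (fun h : ℝ => trigFlow ξ θ h x) (trigFlowDeriv ξ θ h x) h := by
  have h1 := ((((IsPoly.hasDerivAt_one_sub_exp h).mul_const (‖ξ‖ ^ 2)).div_const 4).neg).exp
  have h2 := (((IsPoly.hasDerivAt_exp_neg h).mul_const (inner ℝ ξ x)).add_const θ).cos
  refine (h1.mul h2).congr_deriv ?_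
  simp only [Pi.neg_apply, trigFlowDeriv]
  ring

theorem memLp_trigFlow (ξ : E d) (θ h : ℝ) : MemLp (trigFlow ξ θ h) 2 (gaussianMeasure d) := by
  refine memLp_of_bounded (continuous_trigFlow ξ θ h)
    (c := Real.exp (-((1 - Real.exp (-2 * h)) * ‖ξ‖ ^ 2 / 4))) fun x => ?_
  rw [trigFlow, abs_mul, abs_of_pos (Real.exp_pos _)]
  exact mul_le_of_le_one_right (Real.exp_pos _).le (Real.abs_cos_le_one _)

theorem abs_trigFlowDeriv_le (ξ : E d) (θ : ℝ) {h : ℝ} (hh : -1 < h) (x : E d) :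
    |trigFlowDeriv ξ θ h x| ≤ Real.exp (Real.exp 2 * ‖ξ‖ ^ 2 / 4) *
      (Real.exp 1 ^ 2 * ‖ξ‖ ^ 2 / 2) + Real.exp (Real.exp 2 * ‖ξ‖ ^ 2 / 4) *
      (Real.exp 1 * ‖ξ‖) * ‖x‖ := by
  have e1 : Real.exp (-h) ≤ Real.exp 1 := Real.exp_le_exp.2 (by linarith)
  have e2 : Real.exp (-((1 - Real.exp (-2 * h)) * ‖ξ‖ ^ 2 / 4)) ≤
      Real.exp (Real.exp 2 * ‖ξ‖ ^ 2 / 4) := by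
    refine Real.exp_le_exp.2 ?_
    have e3 : Real.exp (-2 * h) ≤ Real.exp 2 := Real.exp_le_exp.2 (by linarith)
    nlinarith [sq_nonneg ‖ξ‖, mul_le_mul_of_nonneg_right e3 (sq_nonneg ‖ξ‖)]
  have e4 : |inner ℝ ξ x| ≤ ‖ξ‖ * ‖x‖ := abs_real_inner_le_norm _ _
  rw [trigFlowDeriv, abs_mul, abs_of_pos (Real.exp_pos _),
    mul_assoc (Real.exp (Real.exp 2 * ‖ξ‖ ^ 2 / 4)), ← mul_add]
  refine mul_le_mul e2 ((abs_add_le _ _).trans (add_le_add ?_ ?_)) (abs_nonneg _)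
    (Real.exp_pos _).le
  · rw [abs_mul, abs_neg, abs_of_nonneg (by positivity)]
    refine (mul_le_of_le_one_right (by positivity) (Real.abs_cos_le_one _)).trans ?_
    gcongr
  · rw [abs_mul, abs_mul, abs_of_pos (Real.exp_pos _)]
    refine (mul_le_of_le_one_right (by positivity) (Real.abs_sin_le_one _)).trans ?_
    rw [mul_assoc]
    gcongr

theorem trigFlowDeriv_zero (ξ : E d) (θ : ℝ) : trigFlowDeriv ξ θ 0 = ouExpr (trig ξ θ) := by
  ext x
  rw [ouExpr_trig, trig, trig, ← add_assoc, Real.cos_add_pi_div_two, trigFlowDeriv]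
  simp

/-- The closed formula makes sense for negative times as well, so a two-sided derivative at `0` is
available. For `h > -1` the time derivative is bounded by an affine function of `|x|`, which is in
`L²(γ)`. -/
theorem hasDerivAt_integral_trigFlow (f : L2 d) (ξ : E d) (θ : ℝ) :
    HasDerivAt (fun h : ℝ => ∫ x, f x * trigFlow ξ θ h x ∂(gaussianMeasure d))
      (∫ x, f x * ouExpr (trig ξ θ) x ∂(gaussianMeasure d)) 0 := by
  rw [← trigFlowDeriv_zero]
  refine (hasDerivAt_integral_of_dominated_loc_of_deriv_le (μ := gaussianMeasure d)
    (F := fun h x => f x * trigFlow ξ θ h x) (F' := fun h x => f x * trigFlowDeriv ξ θ h x)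
    (bound := fun x => |f x * (Real.exp (Real.exp 2 * ‖ξ‖ ^ 2 / 4) *
      (Real.exp 1 ^ 2 * ‖ξ‖ ^ 2 / 2) + Real.exp (Real.exp 2 * ‖ξ‖ ^ 2 / 4) *
      (Real.exp 1 * ‖ξ‖) * ‖x‖)|)
    (Ioi_mem_nhds (by norm_num : (-1 : ℝ) < 0)) ?_ ?_ ?_ ?_ ?_ ?_).2
  · exact Eventually.of_forall fun h => (Lp.aestronglyMeasurable f).mul
      (continuous_trigFlow ξ θ h).aestronglyMeasurable
  · exact integrable_L2_mul f (memLp_trigFlow ξ θ 0)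
  · exact (Lp.aestronglyMeasurable f).mul (continuous_trigFlowDeriv ξ θ 0).aestronglyMeasurable
  · refine ae_of_all _ fun x h hh => ?_
    rw [Real.norm_eq_abs, abs_mul, abs_mul]
    exact mul_le_mul_of_nonneg_left ((abs_trigFlowDeriv_le ξ θ hh x).trans (le_abs_self _))
      (abs_nonneg _)
  · exact (integrable_L2_mul f (memLp_const_add_norm _ _)).abs
  · exact ae_of_all _ fun x h _ => (hasDerivAt_trigFlow ξ θ h x).const_mul (f x)

theorem tendsto_inner_trigL2 (f : L2 d) (ξ : E d) (θ : ℝ) :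
    Tendsto (fun h : ℝ => h⁻¹ * inner ℝ f (ouSemigroup h (trigL2 ξ θ) - trigL2 ξ θ)) (𝓝[>] 0)
      (𝓝 (∫ x, f x * ouExpr (trig ξ θ) x ∂(gaussianMeasure d))) := by
  have h1 := (hasDerivAt_iff_tendsto_slope_zero.1 (hasDerivAt_integral_trigFlow f ξ θ)).mono_left
    (nhdsWithin_mono 0 fun (h : ℝ) (hh : 0 < h) => hh.ne')
  have key : ∀ h : ℝ, 0 ≤ h → inner ℝ f (ouSemigroup h (trigL2 ξ θ)) =
      ∫ x, f x * trigFlow ξ θ h x ∂(gaussianMeasure d) := by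
    intro h hh
    rw [ouSemigroup_trigL2 hh, real_inner_smul_right, inner_trigL2, ← integral_const_mul]
    congr 1; ext x
    rw [trig, trigFlow, real_inner_smul_left]; ring
  refine h1.congr' ?_
  filter_upwards [self_mem_nhdsWithin] with h hh
  have k0 := key 0 le_rfl
  rw [ouSemigroup_zero, ContinuousLinearMap.id_apply] at k0
  rw [zero_add, smul_eq_mul, ← key h (le_of_lt hh), ← k0, inner_sub_right]

/-- The generator of the semigroup `ouSemigroup`, as a graph. -/
def ouGenerator (f g : L2 d) : Prop :=
  Tendsto (fun h : ℝ => h⁻¹ • (ouSemigroup h f - f)) (𝓝[>] 0) (𝓝 g)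

theorem ouGenerator.inner {f g : L2 d} (h : ouGenerator f g) (v : L2 d) :
    Tendsto (fun h : ℝ => h⁻¹ * inner ℝ (ouSemigroup h f - f) v) (𝓝[>] 0) (𝓝 (inner ℝ g v)) := by
  have := Filter.Tendsto.inner (𝕜 := ℝ) h (tendsto_const_nhds (x := v))
  simpa only [real_inner_smul_left] using this

theorem ouSemigroup_mem_trigSpan {s : ℝ} (hs : 0 ≤ s) {v : L2 d} (hv : v ∈ trigSpan d) :
    ouSemigroup s v ∈ trigSpan d := by
  induction hv using Submodule.span_induction with
  | mem v hv =>
    obtain ⟨ξ, θ, rfl⟩ := hv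
    rw [ouSemigroup_trigL2 hs]
    exact Submodule.smul_mem _ _ (trigL2_mem _ _)
  | zero => simp
  | add f g _ _ hf hg => rw [map_add]; exact Submodule.add_mem _ hf hg
  | smul a f _ hf => rw [map_smul]; exact Submodule.smul_mem _ _ hf

theorem norm_le_of_inner_le_trigSpan {w : L2 d} {c : ℝ} (hc : 0 ≤ c)
    (h : ∀ v ∈ trigSpan d, inner ℝ w v ≤ c * ‖v‖) : ‖w‖ ≤ c := by
  have h1 : IsClosed {v : L2 d | inner ℝ w v ≤ c * ‖v‖} :=
    isClosed_le (by fun_prop) (by fun_prop)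
  have h2 : inner ℝ w w ≤ c * ‖w‖ := h1.closure_subset_iff.2 h (dense_trigSpan w)
  rw [real_inner_self_eq_norm_sq, sq] at h2
  rcases (norm_nonneg w).eq_or_lt with h0 | h0
  · rwa [← h0]
  · exact le_of_mul_le_mul_right h2 h0

/-- Weak derivatives, tested on trigonometric functions, are strong derivatives. -/
theorem ouGenerator_of_weak {f g : L2 d} (h : ∀ ξ θ, Tendsto
    (fun h : ℝ => h⁻¹ * inner ℝ (ouSemigroup h f - f) (trigL2 ξ θ)) (𝓝[>] 0)
    (𝓝 (inner ℝ g (trigL2 ξ θ)))) : ouGenerator f g := by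
  have h1 : ∀ v ∈ trigSpan d, Tendsto (fun h : ℝ => h⁻¹ * inner ℝ (ouSemigroup h f - f) v)
      (𝓝[>] 0) (𝓝 (inner ℝ g v)) := by
    intro v hv
    induction hv using Submodule.span_induction with
    | mem v hv => obtain ⟨ξ, θ, rfl⟩ := hv; exact h ξ θ
    | zero => simp
    | add v w _ _ hv hw => simpa only [inner_add_right, mul_add] using hv.add hw
    | smul a v _ hv =>
      simpa only [real_inner_smul_right, mul_left_comm] using hv.const_mul a
  have h2 : ∀ v ∈ trigSpan d, ∀ s, 0 ≤ s → HasDerivWithinAt (fun s => inner ℝ (ouSemigroup s f) v)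
      (inner ℝ (ouSemigroup s g) v) (Set.Ici s) s := by
    intro v hv s hs
    rw [← hasDerivWithinAt_Ioi_iff_Ici, hasDerivWithinAt_iff_tendsto_slope' (by simp)]
    -- Invariance of the span is used here: by symmetry, the right derivative at `s` tested on `v`
    -- is the one at `0` tested on `e^{sL}v`.
    have h3 := h1 _ (ouSemigroup_mem_trigSpan hs hv)
    have h4 : Tendsto (fun t : ℝ => t - s) (𝓝[>] s) (𝓝[>] 0) := by
      refine tendsto_nhdsWithin_iff.2 ⟨?_, ?_⟩
      · exact ((continuous_sub_right s).tendsto' s 0 (sub_self s)).mono_left nhdsWithin_le_nhds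
      · filter_upwards [self_mem_nhdsWithin] with t (ht : s < t) using sub_pos.2 ht
    have h5 := h3.comp h4
    rw [← inner_ouSemigroup_comm hs] at h5
    refine h5.congr' ?_
    filter_upwards [self_mem_nhdsWithin] with t ht
    have ht' : 0 ≤ t - s := sub_nonneg.2 (le_of_lt ht)
    have e : (ouSemigroup t f : L2 d) = ouSemigroup s (ouSemigroup (t - s) f) := by
      rw [← ContinuousLinearMap.comp_apply, ← ouSemigroup_add hs ht', add_sub_cancel]
    simp only [Function.comp_apply, slope_def_field]
    rw [e, ← inner_ouSemigroup_comm hs, map_sub, inner_sub_left, div_eq_inv_mul]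
  -- Tested on `v`, `e^{sL}f - s g` has right derivative `⟨e^{sL}g - g, v⟩`, at most `ε‖v‖` for
  -- small `s` by strong continuity. The mean value inequality is uniform in `v`, and density of the
  -- span turns it into a norm bound.
  have h3 : ∀ ε > 0, ∀ᶠ t in 𝓝[>] (0 : ℝ), ‖ouSemigroup t f - f - t • g‖ ≤ ε * t := by
    intro ε hε
    have hg := Metric.continuousOn_iff.1 (continuousOn_ouSemigroup g) 0 (by simp) ε hε
    obtain ⟨δ, hδ, hgδ⟩ := hg
    filter_upwards [Ioo_mem_nhdsGT hδ] with t ht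
    refine norm_le_of_inner_le_trigSpan (mul_nonneg hε.le ht.1.le) fun v hv => ?_
    have h4 := norm_image_sub_le_of_norm_deriv_right_le_segment (a := 0) (b := t)
      (f := fun s => inner ℝ (ouSemigroup s f - s • g) v)
      (f' := fun s => inner ℝ (ouSemigroup s g - g) v) (C := ε * ‖v‖) ?_ ?_ ?_ t ⟨ht.1.le, le_rfl⟩
    · have h5 := (le_abs_self _).trans h4
      simp only [zero_smul, sub_zero, ouSemigroup_zero, ContinuousLinearMap.id_apply,
        ← inner_sub_left] at h5
      rw [sub_right_comm]
      linarith
    · have h8 : ContinuousOn (fun s : ℝ => ouSemigroup s f - s • g) (Set.Icc 0 t) :=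
        ((continuousOn_ouSemigroup f).mono fun s hs => hs.1).sub
          (Continuous.continuousOn (by fun_prop))
      exact h8.inner continuousOn_const
    · intro s hs
      have h6 := (h2 v hv s hs.1).sub (((hasDerivAt_id s).mul_const (inner ℝ g v)).hasDerivWithinAt)
      simp only [one_mul, ← inner_sub_left] at h6
      refine h6.congr (fun s _ => ?_) ?_ <;>
      simp only [Pi.sub_apply, inner_sub_left, real_inner_smul_left, id]
    · intro s hs
      refine (norm_inner_le_norm _ _).trans (mul_le_mul_of_nonneg_right ?_ (norm_nonneg _))
      have h7 := hgδ s hs.1 (by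
        rw [Real.dist_eq, sub_zero, abs_of_nonneg hs.1]; exact hs.2.trans ht.2)
      rw [ouSemigroup_zero, ContinuousLinearMap.id_apply, dist_eq_norm] at h7
      exact h7.le
  rw [ouGenerator, Metric.tendsto_nhds]
  intro ε hε
  filter_upwards [h3 (ε / 2) (by positivity), self_mem_nhdsWithin] with t ht ht0
  have ht0 : 0 < t := ht0
  have e : t⁻¹ • (ouSemigroup t f - f) - g = t⁻¹ • (ouSemigroup t f - f - t • g) := by
    rw [smul_sub t⁻¹ (_ - f), smul_smul, inv_mul_cancel₀ ht0.ne', one_smul]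
  rw [dist_eq_norm, e, norm_smul, norm_inv, Real.norm_of_nonneg ht0.le, inv_mul_lt_iff₀ ht0]
  nlinarith

/-- The maximal domain is no larger than that of the generator: by symmetry the difference quotient
of `f` against a trigonometric function falls on that function, where the derivative is explicit,
and the weak equation replaces it by `g`. -/
theorem ouGenerator_of_ouOp {f g : L2 d} (h : ouOp f g) : ouGenerator f g := by
  refine ouGenerator_of_weak fun ξ θ => ?_
  have h1 := tendsto_inner_trigL2 f ξ θ
  rw [h.integral_eq (contDiff_trig ξ θ) (memLp_trig ξ θ) (fun j => memLp_partialDeriv_trig j ξ θ)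
    (memLp_ouExpr_trig ξ θ), ← inner_trigL2] at h1
  refine h1.congr' ?_
  filter_upwards [self_mem_nhdsWithin] with t ht
  rw [inner_sub_left, inner_sub_right, inner_ouSemigroup_comm (le_of_lt ht)]

theorem IsTestFunction.ouGenerator {φ : E d → ℝ} (hφ : IsTestFunction φ) :
    ouGenerator (hφ.memLp.toLp φ) (hφ.memLp_ouExpr.toLp _) := by
  refine ouGenerator_of_ouOp fun ψ hψ => ?_
  have h1 : ∫ x, (hφ.memLp.toLp φ) x * ouExpr ψ x ∂(gaussianMeasure d) =
      ∫ x, φ x * ouExpr ψ x ∂(gaussianMeasure d) := by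
    refine integral_congr_ae ?_
    filter_upwards [hφ.memLp.coeFn_toLp] with x hx
    rw [hx]
  have h2 : ∫ x, (hφ.memLp_ouExpr.toLp _) x * ψ x ∂(gaussianMeasure d) =
      ∫ x, ouExpr φ x * ψ x ∂(gaussianMeasure d) := by
    refine integral_congr_ae ?_
    filter_upwards [hφ.memLp_ouExpr.coeFn_toLp] with x hx
    rw [hx]
  rw [h1, h2, integral_mul_ouExpr_comm hφ hψ]

theorem ouOp_iff_inner {f g : L2 d} : ouOp f g ↔ ∀ (φ : E d → ℝ) (hφ : IsTestFunction φ),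
    inner ℝ f (hφ.memLp_ouExpr.toLp _) = inner ℝ g (hφ.memLp.toLp φ) :=
  forall₂_congr fun φ hφ => by rw [inner_toLp, inner_toLp]

/-- For the converse, test functions lie in the domain of the generator, and symmetry of the
semigroup moves the difference quotient between `f` and `φ`. -/
theorem ouOp_iff_ouGenerator {f g : L2 d} : ouOp f g ↔ ouGenerator f g := by
  refine ⟨ouGenerator_of_ouOp, fun h => ouOp_iff_inner.2 fun φ hφ => ?_⟩
  refine tendsto_nhds_unique ?_ (h.inner (hφ.memLp.toLp φ))
  have h1 := hφ.ouGenerator.inner f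
  rw [real_inner_comm] at h1
  refine h1.congr' ?_
  filter_upwards [self_mem_nhdsWithin] with t ht
  rw [inner_sub_left, inner_sub_left, inner_ouSemigroup_comm (le_of_lt ht), real_inner_comm,
    real_inner_comm f]

theorem isSemigroupGeneratedBy_ouSemigroup :
    IsSemigroupGeneratedBy (ouOp (d := d)) ouSemigroup where
  zero := ouSemigroup_zero
  add _ _ := ouSemigroup_add
  continuousOn := continuousOn_ouSemigroup
  generator _ _ := ouOp_iff_ouGenerator

theorem ouOp.unique {f g g' : L2 d} (h : ouOp f g) (h' : ouOp f g') : g = g' :=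
  tendsto_nhds_unique (ouOp_iff_ouGenerator.1 h) (ouOp_iff_ouGenerator.1 h')

/-! ### Powers of the generator applied to the semigroup -/

/-- The coefficients `F_n` with `∂_s^n M_s = F_n M_s`. -/
def timePoly (d : ℕ) : (n : ℕ) → {F : ℝ → E d → E d → ℝ // IsPoly (2 * n) F}
  | 0 => ⟨fun _ _ _ => 1, IsPoly.const 1⟩
  | n + 1 => ⟨(timePoly d n).2.exists_hasDerivAt_mul_mehler.choose,
      (timePoly d n).2.exists_hasDerivAt_mul_mehler.choose_spec.1⟩

/-- The `n`-th derivative in time of the Mehler kernel. -/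
def mehlerDeriv (n : ℕ) (s : ℝ) (x y : E d) : ℝ := (timePoly d n).1 s x y * mehler s x y

theorem mehlerDeriv_zero : mehlerDeriv (d := d) 0 = mehler := by
  ext s x y; simp [mehlerDeriv, timePoly]

theorem hasDerivAt_mehlerDeriv (n : ℕ) {s : ℝ} (hs : 0 < s) (x y : E d) :
    HasDerivAt (fun s => mehlerDeriv n s x y) (mehlerDeriv (n + 1) s x y) s :=
  (timePoly d n).2.exists_hasDerivAt_mul_mehler.choose_spec.2 s hs x y

theorem dominated_mehlerDeriv (n : ℕ) {s : ℝ} (hs : 0 < s) :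
    Dominated (mehlerDeriv n s : E d → E d → ℝ) :=
  (timePoly d n).2.dominated hs

/-- The bilinear form with kernel `∂_s^n M_s`. -/
def pairing (n : ℕ) (u v : L2 d) (s : ℝ) : ℝ :=
  ∫ p, mehlerDeriv n s p.1 p.2 * (v p.1 * u p.2) ∂((gaussianMeasure d).prod (gaussianMeasure d))

theorem inner_mehlerDeriv_apply (n : ℕ) {s : ℝ} (hs : 0 < s) (u v : L2 d) :
    inner ℝ ((dominated_mehlerDeriv n hs).apply u) v = pairing n u v s :=
  (dominated_mehlerDeriv n hs).inner_apply u v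

theorem hasDerivAt_pairing (n : ℕ) (u v : L2 d) {s : ℝ} (hs : 0 < s) :
    HasDerivAt (pairing n u v) (pairing (n + 1) u v s) s := by
  -- A single dominating function serves all times in `(s/2, ∞)`, a neighbourhood of `s`.
  obtain ⟨c, δ, hδ, hb⟩ := (timePoly d (n + 1)).2.exists_abs_mul_mehler_le (half_pos hs)
  have hm : ∀ n, ∀ s, 0 < s → AEStronglyMeasurable
      (fun p : E d × E d => mehlerDeriv n s p.1 p.2 * (v p.1 * u p.2))
      ((gaussianMeasure d).prod (gaussianMeasure d)) := fun n s hs =>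
    ((dominated_mehlerDeriv n hs).integrable_prod u v).1
  refine (hasDerivAt_integral_of_dominated_loc_of_deriv_le
    (μ := (gaussianMeasure d).prod (gaussianMeasure d))
    (F := fun s p => mehlerDeriv n s p.1 p.2 * (v p.1 * u p.2))
    (F' := fun s p => mehlerDeriv (n + 1) s p.1 p.2 * (v p.1 * u p.2))
    (bound := fun p => c * ((|v p.1| * weight δ p.1) * (|u p.2| * weight δ p.2)))
    (Ioi_mem_nhds (half_lt_self hs)) ?_ ?_ ?_ ?_ ?_ ?_).2
  · filter_upwards [lt_mem_nhds hs] with s hs using hm n s hs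
  · exact (dominated_mehlerDeriv n hs).integrable_prod u v
  · exact hm (n + 1) s hs
  · refine ae_of_all _ fun p s' hs' => ?_
    rw [Real.norm_eq_abs, abs_mul, abs_mul]
    refine (mul_le_mul_of_nonneg_right (hb s' (le_of_lt hs') p.1 p.2) (by positivity)).trans_eq ?_
    ring
  · exact (((Lp.memLp v).abs.integrable_mul (memLp_weight hδ)).mul_prod
      ((Lp.memLp u).abs.integrable_mul (memLp_weight hδ))).const_mul c
  · exact ae_of_all _ fun p s' hs' =>
      (hasDerivAt_mehlerDeriv n ((half_pos hs).trans hs') p.1 p.2).mul_const _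

/-- For `n = 0` this is symmetry and the semigroup law. Differentiating the identity in `s` passes
from `n` to `n + 1`. -/
theorem pairing_ouSemigroup (n : ℕ) (u v : L2 d) {h : ℝ} (hh : 0 ≤ h) : ∀ s, 0 < s →
    pairing n u (ouSemigroup h v) s = pairing n u v (s + h) := by
  induction n with
  | zero =>
    intro s hs
    have e : ∀ (v : L2 d) s, 0 < s → pairing 0 u v s = inner ℝ (ouSemigroup s u) v := by
      intro v s hs
      rw [← inner_mehlerDeriv_apply 0 hs, ouSemigroup_of_pos hs]
      congr 1
      exact Dominated.apply_congr _ _ (by rw [mehlerDeriv_zero]) u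
    rw [e _ s hs, e _ _ (by linarith), ← inner_ouSemigroup_comm hh, add_comm s h,
      ouSemigroup_add hh hs.le, ContinuousLinearMap.comp_apply]
  | succ n ih =>
    intro s hs
    have h1 := hasDerivAt_pairing n u (ouSemigroup h v) hs
    have h2 := (hasDerivAt_pairing n u v (by linarith : 0 < s + h)).comp_add_const s h
    refine h1.unique (h2.congr_of_eventuallyEq ?_)
    filter_upwards [lt_mem_nhds hs] with s hs using ih s hs

/-- By `pairing_ouSemigroup`, applying `e^{hL}` shifts the time of the `n`-th form by `h`, so the
weak derivative at `h = 0` is the form of order `n + 1`; weak differentiability suffices. -/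
theorem ouOp_mehlerDeriv_apply (n : ℕ) {s : ℝ} (hs : 0 < s) (u : L2 d) :
    ouOp ((dominated_mehlerDeriv n hs).apply u) ((dominated_mehlerDeriv (n + 1) hs).apply u) := by
  refine ouOp_iff_ouGenerator.2 (ouGenerator_of_weak fun ξ θ => ?_)
  have h1 := (hasDerivAt_iff_tendsto_slope_zero.1
    (hasDerivAt_pairing n u (trigL2 ξ θ) hs)).mono_left
    (nhdsWithin_mono 0 fun (h : ℝ) (hh : 0 < h) => hh.ne')
  rw [inner_mehlerDeriv_apply (n + 1) hs]
  refine h1.congr' ?_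
  filter_upwards [self_mem_nhdsWithin] with h (hh : 0 < h)
  rw [inner_sub_left, inner_ouSemigroup_comm hh.le, inner_mehlerDeriv_apply n hs,
    inner_mehlerDeriv_apply n hs, pairing_ouSemigroup n u _ hh.le s hs, smul_eq_mul]

theorem ouOp.smul {f g : L2 d} (h : ouOp f g) (c : ℝ) : ouOp (c • f) (c • g) := by
  rw [ouOp_iff_inner] at h ⊢
  intro φ hφ
  rw [real_inner_smul_left, real_inner_smul_left, h φ hφ]

theorem opPow_ouOp (n : ℕ) (t : ℝ) {s : ℝ} (hs : 0 < s) (u : L2 d) :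
    opPow (opSMul (t ^ 2) ouOp) n (ouSemigroup s u)
      (t ^ (2 * n) • (dominated_mehlerDeriv n hs).apply u) := by
  induction n with
  | zero =>
    rw [mul_zero, pow_zero, one_smul, ouSemigroup_of_pos hs]
    exact Dominated.apply_congr _ _ (by rw [mehlerDeriv_zero]) u
  | succ n ih =>
    refine ⟨_, ih, _, (ouOp_mehlerDeriv_apply n hs u).smul _, ?_⟩
    rw [smul_smul, ← pow_add, mul_add, mul_one, add_comm]

/-- Operators are only graphs, so single-valuedness is needed to identify an arbitrary value of the
operator with the one given by the kernel. -/
theorem opPow_unique (n : ℕ) (t : ℝ) {f g g' : L2 d} (h : opPow (opSMul (t ^ 2) ouOp) n f g)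
    (h' : opPow (opSMul (t ^ 2) ouOp) n f g') : g = g' := by
  induction n generalizing g g' with
  | zero => exact Eq.trans h (Eq.symm h')
  | succ n ih =>
    obtain ⟨k, hk, l, hl, rfl⟩ := h
    obtain ⟨k', hk', l', hl', rfl⟩ := h'
    rw [ih hk hk'] at hl
    rw [hl.unique hl']

/-! ### The kernels -/

/-- The kernel of `(t²L)^N e^{(t²/α)L}`. -/
def kernelK (N : ℕ) (t α : ℝ) (x y : E d) : ℝ := t ^ (2 * N) * mehlerDeriv N (t ^ 2 / α) x y

/-- The kernel of `(t²L)^N e^{(t²/α)L} t ∂_j^*`. -/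
def kernelKt (N : ℕ) (t α : ℝ) (j : Fin d) (x y : E d) : ℝ :=
  t * partialDeriv j (fun y' => kernelK N t α x y') y

variable {N : ℕ} {t α : ℝ}

theorem dominated_kernelK (ht : 0 < t) (hα : 0 < α) :
    Dominated (kernelK N t α : E d → E d → ℝ) := by
  obtain ⟨c, δ, hδ, hb⟩ := (dominated_mehlerDeriv (d := d) N (by positivity : 0 < t ^ 2 / α)).bound
  refine ⟨continuous_const.mul (dominated_mehlerDeriv N (by positivity)).cont,
    t ^ (2 * N) * c, δ, hδ, fun x y => ?_⟩
  rw [kernelK, abs_mul, abs_of_pos (by positivity), mul_assoc]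
  exact mul_le_mul_of_nonneg_left (hb x y) (by positivity)

theorem contDiff_kernelK_fst (N : ℕ) (t α : ℝ) (y : E d) :
    ContDiff ℝ ∞ fun x => kernelK N t α x y :=
  contDiff_const.mul ((timePoly d N).2.contDiff_mul_mehler_fst _ y)

theorem contDiff_kernelK_snd (N : ℕ) (t α : ℝ) (x : E d) :
    ContDiff ℝ ∞ fun y => kernelK N t α x y :=
  contDiff_const.mul ((timePoly d N).2.contDiff_mul_mehler_snd _ x)

theorem exists_kernelKt_eq (N : ℕ) (j : Fin d) : ∃ G : ℝ → E d → E d → ℝ, IsPoly (2 * N + 1) G ∧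
    ∀ t α, 0 < t → 0 < α → ∀ x y, kernelKt N t α j x y =
      t ^ (2 * N + 1) * (G (t ^ 2 / α) x y * mehler (t ^ 2 / α) x y) := by
  obtain ⟨G, hG, h⟩ := (timePoly d N).2.exists_partialDeriv_snd j
  refine ⟨G, hG, fun t α ht hα x y => ?_⟩
  rw [← h _ (by positivity), kernelKt, pow_succ', mul_assoc, ← partialDeriv_const_mul j (t ^ (2 * N))
    (((timePoly d N).2.contDiff_mul_mehler_snd _ x).differentiable_infty y)]
  rfl

theorem exists_partialDeriv_kernelK_eq (N : ℕ) (j : Fin d) :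
    ∃ G : ℝ → E d → E d → ℝ, IsPoly (2 * N + 1) G ∧ ∀ t α, 0 < t → 0 < α → ∀ x y,
      t * partialDeriv j (fun x' => kernelK N t α x' y) x =
      t ^ (2 * N + 1) * (G (t ^ 2 / α) x y * mehler (t ^ 2 / α) x y) := by
  obtain ⟨G, hG, h⟩ := (timePoly d N).2.exists_partialDeriv_fst j
  refine ⟨G, hG, fun t α ht hα x y => ?_⟩
  rw [← h _ (by positivity), pow_succ', mul_assoc, ← partialDeriv_const_mul j (t ^ (2 * N))
    (((timePoly d N).2.contDiff_mul_mehler_fst _ y).differentiable_infty x)]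
  rfl

theorem dominated_kernelKt (ht : 0 < t) (hα : 0 < α) (j : Fin d) :
    Dominated (kernelKt N t α j) := by
  obtain ⟨G, hG, h⟩ := exists_kernelKt_eq N j
  have h1 := hG.dominated (s := t ^ 2 / α) (by positivity)
  obtain ⟨c, δ, hδ, hb⟩ := h1.bound
  have h2 : kernelKt N t α j = fun x y =>
      t ^ (2 * N + 1) * (G (t ^ 2 / α) x y * mehler (t ^ 2 / α) x y) := by
    ext x y; exact h t α ht hα x y
  rw [h2]
  refine ⟨continuous_const.mul h1.cont, t ^ (2 * N + 1) * c, δ, hδ, fun x y => ?_⟩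
  rw [abs_mul, abs_of_pos (by positivity), mul_assoc]
  exact mul_le_mul_of_nonneg_left (hb x y) (by positivity)

theorem exists_opK (N : ℕ) (ht : 0 < t) (hα : 0 < α) (u : L2 d) :
    ∃ v, opK ouSemigroup N t α u v :=
  ⟨_, opPow_ouOp N t (by positivity) u⟩

theorem isIntegralKernel_kernelK (N : ℕ) (ht : 0 < t) (hα : 0 < α) :
    IsIntegralKernel (opK ouSemigroup N t α) (kernelK (d := d) N t α) := by
  intro u v huv
  have hs : 0 < t ^ 2 / α := by positivity
  have hv := opPow_unique N t huv (opPow_ouOp N t hs u)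
  filter_upwards [Lp.coeFn_smul (t ^ (2 * N)) ((dominated_mehlerDeriv N hs).apply u),
    (dominated_mehlerDeriv N hs).coeFn_apply u] with x h1 h2
  refine ⟨(dominated_kernelK ht hα).integrable u x, ?_⟩
  rw [hv, h1, Pi.smul_apply, h2, smul_eq_mul, ← integral_const_mul]
  simp only [kernelK, mul_assoc]

/-- For fixed `x`, `∫ K(x,y) (∂_j^*u)(y) dγ(y) = ∫ ∂_{y_j}K(x,y) u(y) dγ(y)`, because `K(x, ·)` and
its derivative are square integrable. -/
theorem isIntegralKernel_kernelKt (N : ℕ) (ht : 0 < t) (hα : 0 < α) (j : Fin d) :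
    IsIntegralKernel (opKtilde ouSemigroup N t α j) (kernelKt N t α j) := by
  rintro u v ⟨w, ⟨w', hw', rfl⟩, hv⟩
  filter_upwards [isIntegralKernel_kernelK N ht hα _ _ hv] with x hx
  refine ⟨(dominated_kernelKt ht hα j).integrable u x, ?_⟩
  have hd : MemLp (partialDeriv j (kernelK N t α x)) 2 (gaussianMeasure d) := by
    have h := ((dominated_kernelKt (N := N) ht hα j).memLp_right x).const_mul t⁻¹
    refine (memLp_congr_ae (ae_of_all _ fun y => ?_)).1 h
    simp only [kernelKt]
    rw [inv_mul_cancel_left₀ ht.ne']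
  have h1 := hw'.integral_eq (contDiff_kernelK_snd N t α x)
    ((dominated_kernelK ht hα).memLp_right x) hd
  rw [← hx.2]
  have h2 : ∫ y, kernelK N t α x y * (t • w') y ∂(gaussianMeasure d) =
      t * ∫ y, w' y * kernelK N t α x y ∂(gaussianMeasure d) := by
    rw [← integral_const_mul]
    refine integral_congr_ae ?_
    filter_upwards [Lp.coeFn_smul t w'] with y hy
    rw [hy, Pi.smul_apply, smul_eq_mul]; ring
  rw [h2, ← h1, ← integral_const_mul]
  congr 1; ext y
  rw [kernelKt]; ring

theorem PreBound.congr {T c : ℝ} {m : ℕ} {k k' : ℝ → ℝ → E d → E d → ℝ} (h : PreBound T m c k)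
    (hk : ∀ t α, 0 < t → 0 < α → ∀ x y, k' t α x y = k t α x y) : PreBound T m c k' := by
  intro t α C ht htT hα hC x y hx
  rw [hk t α ht (lt_of_lt_of_le (by positivity) hα)]
  exact h t α C ht htT hα hC x y hx

theorem exists_preBound_kernels (d N : ℕ) {T : ℝ} (hT : 0 < T) : ∃ c : ℝ, 0 < c ∧
    PreBound T (2 * N + 1) c (kernelK (d := d) N) ∧ ∀ j : Fin d,
      PreBound T (2 * N + 1) c (fun t α => kernelKt N t α j) ∧
      PreBound T (2 * N + 1) c
        (fun t α x y => t * partialDeriv j (fun x' => kernelK N t α x' y) x) := by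
  obtain ⟨c, hc, h⟩ := (timePoly d N).2.exists_preBound hT
  have h1 : ∀ j : Fin d, ∃ c : ℝ, 0 ≤ c ∧
      PreBound T (2 * N + 1) c (fun t α => kernelKt N t α j) := fun j => by
    obtain ⟨G, hG, h⟩ := exists_kernelKt_eq N j
    obtain ⟨c, hc, hb⟩ := hG.exists_preBound hT
    exact ⟨c, hc, hb.congr h⟩
  have h2 : ∀ j : Fin d, ∃ c : ℝ, 0 ≤ c ∧ PreBound T (2 * N + 1) c
      (fun t α x y => t * partialDeriv j (fun x' => kernelK N t α x' y) x) := fun j => by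
    obtain ⟨G, hG, h⟩ := exists_partialDeriv_kernelK_eq N j
    obtain ⟨c, hc, hb⟩ := hG.exists_preBound hT
    exact ⟨c, hc, hb.congr h⟩
  choose c1 hc1 h1 using h1
  choose c2 hc2 h2 using h2
  have hsum : ∀ j, c1 j + c2 j ≤ ∑ j, (c1 j + c2 j) := fun j =>
    Finset.single_le_sum (f := fun j => c1 j + c2 j) (fun j _ => add_nonneg (hc1 j) (hc2 j))
      (Finset.mem_univ j)
  have hsum0 : 0 ≤ ∑ j, (c1 j + c2 j) :=
    Finset.sum_nonneg fun j _ => add_nonneg (hc1 j) (hc2 j)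
  -- Summing over `j` yields one constant for all kernels; the `1` makes it strictly positive.
  refine ⟨1 + c + ∑ j, (c1 j + c2 j), by positivity, ?_, fun j => ⟨?_, ?_⟩⟩
  · exact PreBound.mono hc h (Nat.le_succ _) (by linarith)
  · exact (h1 j).mono (hc1 j) le_rfl (by linarith [hsum j, hc2 j])
  · exact (h2 j).mono (hc2 j) le_rfl (by linarith [hsum j, hc1 j])

end OrnsteinUhlenbeck

end

/-! ### The main theorem. -/

theorem mainTheorem2 (d N : ℕ) (hd : 1 ≤ d) (hN : 1 ≤ N) :
    ∃ S : ℝ → OrnsteinUhlenbeck.L2 d →L[ℝ] OrnsteinUhlenbeck.L2 d,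
      OrnsteinUhlenbeck.IsSemigroupGeneratedBy OrnsteinUhlenbeck.ouOp S ∧
      ∃ (K : ℝ → ℝ → OrnsteinUhlenbeck.E d → OrnsteinUhlenbeck.E d → ℝ)
        (Kt : ℝ → ℝ → Fin d → OrnsteinUhlenbeck.E d → OrnsteinUhlenbeck.E d → ℝ),
        -- `K t α` and `Kt t α j` are the (continuous) kernels of the two operators
        (∀ t α : ℝ, 0 < t → 1 < α →
          (∀ u, ∃ v, OrnsteinUhlenbeck.opK S N t α u v) ∧
          Continuous (fun p : OrnsteinUhlenbeck.E d × OrnsteinUhlenbeck.E d => K t α p.1 p.2) ∧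
          OrnsteinUhlenbeck.IsIntegralKernel (OrnsteinUhlenbeck.opK S N t α) (K t α) ∧
          (∀ y, Differentiable ℝ (fun x => K t α x y)) ∧
          ∀ j : Fin d,
            Continuous (fun p : OrnsteinUhlenbeck.E d × OrnsteinUhlenbeck.E d =>
              Kt t α j p.1 p.2) ∧
            OrnsteinUhlenbeck.IsIntegralKernel (OrnsteinUhlenbeck.opKtilde S N t α j)
              (Kt t α j)) ∧
        ∀ T : ℝ, 0 < T →
          -- the constant depends on `d, N, T` only, the threshold for `α` also on `C`
          (∃ c : ℝ, 0 < c ∧ ∀ C : ℝ, 0 < C → ∃ α₀ : ℝ, 1 < α₀ ∧ ∀ α : ℝ, α₀ ≤ α →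
            OrnsteinUhlenbeck.KernelBound T C α c (fun t => K t α) ∧
            ∀ j : Fin d,
              OrnsteinUhlenbeck.KernelBound T C α c (fun t => Kt t α j) ∧
              OrnsteinUhlenbeck.KernelBound T C α c (fun t x y =>
                t * OrnsteinUhlenbeck.partialDeriv j (fun x' => K t α x' y) x)) ∧
          -- the threshold for `α` depends on `d, N, T` only, the constant also on `C`
          (∃ α₀ : ℝ, 1 < α₀ ∧ ∀ C : ℝ, 0 < C → ∃ c : ℝ, 0 < c ∧ ∀ α : ℝ, α₀ ≤ α →
            OrnsteinUhlenbeck.KernelBound T C α c (fun t => K t α) ∧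
            ∀ j : Fin d,
              OrnsteinUhlenbeck.KernelBound T C α c (fun t => Kt t α j) ∧
              OrnsteinUhlenbeck.KernelBound T C α c (fun t x y =>
                t * OrnsteinUhlenbeck.partialDeriv j (fun x' => K t α x' y) x)) := by
  refine ⟨OrnsteinUhlenbeck.ouSemigroup, OrnsteinUhlenbeck.isSemigroupGeneratedBy_ouSemigroup,
    OrnsteinUhlenbeck.kernelK N, OrnsteinUhlenbeck.kernelKt N, fun t α ht hα => ?_,
    fun T hT => ?_⟩
  · have hα0 : 0 < α := one_pos.trans hα
    exact ⟨OrnsteinUhlenbeck.exists_opK N ht hα0,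
      (OrnsteinUhlenbeck.dominated_kernelK ht hα0).cont,
      OrnsteinUhlenbeck.isIntegralKernel_kernelK N ht hα0,
      fun y => (OrnsteinUhlenbeck.contDiff_kernelK_fst N t α y).differentiable_infty,
      fun j => ⟨(OrnsteinUhlenbeck.dominated_kernelKt ht hα0 j).cont,
        OrnsteinUhlenbeck.isIntegralKernel_kernelKt N ht hα0 j⟩⟩
  · obtain ⟨c, hc, hK, hj⟩ := OrnsteinUhlenbeck.exists_preBound_kernels d N hT
    have hexp : 1 < 10 * Real.exp (2 * T) := by
      linarith [Real.one_le_exp (by positivity : 0 ≤ 2 * T)]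
    -- The same preliminary bound serves both parts. The threshold `10e^{2T}` is the one required by
    -- `exponent_le`, and it does not involve `C`.
    refine ⟨⟨c, hc, fun C hC => ?_⟩, ⟨10 * Real.exp (2 * T), hexp, fun C hC => ?_⟩⟩
    · obtain ⟨α₀, hα₀, h⟩ := OrnsteinUhlenbeck.exists_threshold (2 * N + 1) (2 * N + 1 + d) hC
      refine ⟨max α₀ (10 * Real.exp (2 * T)), hα₀.trans_le (le_max_left _ _), fun α hα => ?_⟩
      have hα1 : 10 * Real.exp (2 * T) ≤ α := (le_max_right _ _).trans hα
      have hcc := mul_le_mul_of_nonneg_left (h α ((le_max_left _ _).trans hα)) hc.le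
      exact ⟨hK.kernelBound hC hα1 hcc, fun j =>
        ⟨(hj j).1.kernelBound hC hα1 hcc, (hj j).2.kernelBound hC hα1 hcc⟩⟩
    · obtain ⟨c', hc', h⟩ := OrnsteinUhlenbeck.exists_factor (2 * N + 1) (2 * N + 1 + d) hC
      refine ⟨c * c', by positivity, fun α hα => ?_⟩
      have hcc := mul_le_mul_of_nonneg_left (h α (hexp.le.trans hα)) hc.le
      rw [← mul_assoc c c'] at hcc
      exact ⟨hK.kernelBound hC hα hcc, fun j =>
        ⟨(hj j).1.kernelBound hC hα hcc, (hj j).2.kernelBound hC hα hcc⟩⟩
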